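/- **Setting.** Let $v=(k_n,\ell_n,m_n)_{n\ge 0}$ be natural numbers with $k_n,m_n\ge 1$. The cutting and stacking construction starts with the column $C_0=I_0=[0,1)$ of height $h_0=1$. Given a column $C_n$ of height $h_n$, put $H_n=h_n+\ell_n$. Cut $C_n$ into $k_n$ subcolumns of equal width. Place $\ell_n$ spacers on top of each of the first $k_n-1$ subcolumns and stack these from left to right into a column of height $(k_n-1)H_n$. Cut this column, and also the last subcolumn (of height $h_n$), into $m_n$ subcolumns of equal width, stack each of the two families from left to right, put the second resulting column on top of the first, and add on top as many spacers as there are levels so far. This gives $C_{n+1}$, of height $$h_{n+1}=2m_n(h_n+\ell_n)(k_n-1)+2m_nh_n .$$ Spacers are new intervals of the same width as the levels, taken consecutively from the half-line. Let $X=\bigcup_n C_n$ with Lebesgue measure $\mu$ (so $\mu(I_0)=1$), and let $T_v:X\to X$ translate each level of each $C_n$, except the top one, onto the level directly above it. Let $\hat h_n$ be the number of levels of $C_n$ contained in $I_0$. For $0<\alpha<1$ let $V_\alpha$ be the set of all $T_v$ with $k_n=n+1$, $\ell_n=\lfloor n^\alpha\rfloor h_n$, $m_n\ge 1$ and $\lfloor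 n^\alpha\rfloor/m_n\to 0$, and let $V=\bigcup_{0<\alpha<1}V_\alpha$. An invertible measure preserving transformation $T$ of $(X,\mu)$ is *weakly rationally ergodic* if it is conservative ergodic and there is a measurable set $F$ with $0<\mu(F)<\infty$ such that, with $a_t(F)=\mu(F)^{-2}\sum_{i=0}^{t-1}\mu(F\cap T^iF)$, $$\lim_{t\to\infty}\frac1{a_t(F)}\sum_{i=0}^{t-1}\mu(A\cap T^iB)=\mu(A)\mu(B)\qquad\text{for all measurable }A,B\subset F. \tag{1}$$ **Normalizing sequence.** For integers $n,q\ge 0$ put $N_n=k_nm_n=(n+1)m_n$ and $$g_n(q)=\hat h_n\,\bar q\Bigl(1-\frac{\bar q}{2N_n}\Bigr),\qquad \bar q=\min(q,N_n).$$ For $t\ge h_1$ choose $n$ with $h_n\le t<h_{n+1}$, write $t=qH_n+r$ with $0\le r<H_n$, and put $c=\min(q,N_n)$. * If $r<h_n$, let $q'=\lfloor r/H_{n-1}\rfloor$ and $a_t=g_n(q)+g_{n-1}(q')$. * If $h_n\le r<H_n-h_n$, let $a_t=g_n(q)+\tfrac12\hat h_n$. * If $r\ge H_n-h_n$ (and $r\ge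 h_n$), let $q''=\lfloor (H_n-r)/H_{n-1}\rfloor$ and $$a_t=(c+1)\hat h_n\Bigl(1-\frac{c}{2N_n}\Bigr)-g_{n-1}(q'')\Bigl(1-\frac{c}{N_n}\Bigr).$$ (The values $a_t$ for $t<h_1$ are irrelevant.) **Theorem.** Let $T=T_v\in V$. Then $\mu(X)=\infty$, and $T$ is an invertible (injective, with range of full measure), conservative, ergodic, measure preserving transformation of $(X,\mu)$ that is weakly rationally ergodic. More precisely, (1) holds with $F=I_0$, and moreover $$\lim_{t\to\infty}\frac1{a_t}\sum_{i=0}^{t-1}\mu(A\cap T^iB)=\mu(A)\mu(B)\qquad\text{for all measurable }A,B\subset I_0 .$$ -/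

import Mathlib

open MeasureTheory Set Filter Topology

noncomputable section

namespace CutStack

/-- The data `v = (k_n, ℓ_n, m_n)` of a cutting and stacking construction. -/
structure Params where
  k : ℕ → ℕ
  l : ℕ → ℕ
  m : ℕ → ℕ

namespace Params

variable (v : Params)

/-- The height `h_n` of the column `C_n`. -/
def height : ℕ → ℕ
  | 0 => 1
  | n + 1 => 2 * v.m n * (height n + v.l n) * (v.k n - 1) + 2 * v.m n * height n

/-- `H_n = h_n + ℓ_n`. -/
def bigH (n : ℕ) : ℕ := v.height n + v.l n

/-- The number `k_n m_n` of copies (subcolumns) of `C_n` that are stacked to form `C_{n+1}`. -/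
def copies (n : ℕ) : ℕ := v.k n * v.m n

/-- The width `w_n` of the levels of `C_n`; the initial interval is `I_0 = [0, 1)`. -/
def width : ℕ → ℝ
  | 0 => 1
  | n + 1 => width n / (v.copies n : ℝ)

/-- The levels of `C_n` are the `h_n` intervals `[a w_n, (a + 1) w_n)`, `0 ≤ a < h_n`, in an order
given by `slot`: the level at height `p` (counted from the bottom, starting with `0`) is the one
with `a = slot n p`.  So `C_n`, as a set, is `[0, h_n w_n)`; every level is cut from left to right
into `k_n m_n` intervals of width `w_{n+1}`, and the spacers of stage `n` are the consecutive
intervals that start at `h_n w_n`.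

The column `C_{n+1}` consists, from bottom to top, of
* for each `j < m_n` in turn and each `i < k_n - 1` in turn, the `j`-th piece of the `i`-th
  subcolumn of `C_n`, with the `j`-th piece of the `ℓ_n` spacers placed above that subcolumn;
* for each `j < m_n` in turn, the `j`-th piece of the last subcolumn of `C_n`, with no spacers;
* as many spacers as there are levels in the two parts above together. -/
def slot : ℕ → ℕ → ℕ
  | 0, _ => 0
  | n + 1, p =>
    let h := v.height n
    let H := v.bigH n
    let k := v.k n
    let l := v.l n
    let m := v.m n
    let tall := m * (H * (k - 1))
    let low := m * h
    if p < tall then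
      let j := p / (H * (k - 1))
      let i := p % (H * (k - 1)) / H
      let s := p % (H * (k - 1)) % H
      if s < h then slot n s * (k * m) + (i * m + j)
      else h * (k * m) + ((i * l + (s - h)) * m + j)
    else if p < tall + low then
      let j := (p - tall) / h
      let s := (p - tall) % h
      slot n s * (k * m) + ((k - 1) * m + j)
    else h * (k * m) + ((k - 1) * l * m + (p - (tall + low)))

/-- The level of `C_n` at height `p`. -/
def level (n p : ℕ) : Set ℝ :=
  Ico ((v.slot n p : ℝ) * v.width n) (((v.slot n p : ℝ) + 1) * v.width n)

/-- The column `C_n` as a set. -/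
def column (n : ℕ) : Set ℝ := ⋃ p ∈ Finset.range (v.height n), v.level n p

/-- The space `X = ⋃ C_n`. -/
def space : Set ℝ := ⋃ n, v.column n

/-- Lebesgue measure on `X`. -/
def measure : Measure ℝ := volume.restrict v.space

/-- The initial interval `I_0 = C_0`. -/
def base : Set ℝ := v.column 0

open Classical in
/-- The transformation `T_v`: each level of each `C_n`, except the top one, is translated onto the
level directly above it.  (The levels of one column are disjoint and the translations for different
columns agree where both are defined, so the choice of `q = (n, p)` is immaterial; every point of
`X` lies in a level that is not on top of its column, for some `n`.)  Off `X`, a null set for the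
measure used, it is the identity. -/
def map (x : ℝ) : ℝ :=
  if hx : ∃ q : ℕ × ℕ, q.2 + 1 < v.height q.1 ∧ x ∈ v.level q.1 q.2 then
    x + ((v.slot hx.choose.1 (hx.choose.2 + 1) : ℝ) - (v.slot hx.choose.1 hx.choose.2 : ℝ)) *
      v.width hx.choose.1
  else x

/-- The number `ĥ_n` of levels of `C_n` that are contained in `I_0`, which is the height of the
tower that `C_n` induces for the transformation induced by `T_v` on `I_0`. -/
def hatHeight (n : ℕ) : ℕ := {p : ℕ | p < v.height n ∧ v.level n p ⊆ v.base}.ncard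

/-- `ĥ_n q (1 - q / (2 k_n m_n))`, frozen from `q = k_n m_n` on. -/
def profile (n q : ℕ) : ℝ :=
  (v.hatHeight n : ℝ) * (min q (v.copies n) : ℕ) *
    (1 - ((min q (v.copies n) : ℕ) : ℝ) / (2 * (v.copies n : ℝ)))

/-- The `n` with `h_n ≤ t < h_{n+1}` (for `t ≥ 1`, when the heights at least double). -/
def stage (t : ℕ) : ℕ := Nat.findGreatest (fun n => v.height n ≤ t) t

/-- The normalizing sequence `a_t`. -/
def normalizer (t : ℕ) : ℝ :=
  let n := v.stage t
  let h := v.height n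
  let H := v.bigH n
  let q := t / H
  let r := t % H
  if r < h then v.profile n q + v.profile (n - 1) (r / v.bigH (n - 1))
  else if r < H - h then v.profile n q + (v.hatHeight n : ℝ) / 2
  else
    let c : ℝ := (min q (v.copies n) : ℕ)
    (c + 1) * (v.hatHeight n : ℝ) * (1 - c / (2 * (v.copies n : ℝ)))
      - v.profile (n - 1) ((H - r) / v.bigH (n - 1)) * (1 - c / (v.copies n : ℝ))

end Params

/-- The class `V_α`: `k_n = n + 1`, `ℓ_n = ⌊n^α⌋ h_n`, `m_n ≥ 1` and `⌊n^α⌋ / m_n → 0`. -/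
def classV (α : ℝ) : Set Params :=
  {v | (∀ n, v.k n = n + 1) ∧ (∀ n, v.l n = ⌊(n : ℝ) ^ α⌋₊ * v.height n) ∧ (∀ n, 1 ≤ v.m n) ∧
    Tendsto (fun n : ℕ => (⌊(n : ℝ) ^ α⌋₊ : ℝ) / (v.m n : ℝ)) atTop (𝓝 0)}

/-- The class `V`, the union of the `V_α` over `0 < α < 1`. -/
def familyV : Set Params := ⋃ α ∈ Ioo (0 : ℝ) 1, classV α

end CutStack

/-- The sum of `μ (A ∩ T^i B)` over `0 ≤ i < t`. -/
def overlapSum {X : Type*} [MeasurableSpace X] (T : X → X) (μ : Measure X) (A B : Set X) (t : ℕ) :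
    ℝ :=
  ∑ i ∈ Finset.range t, μ.real (A ∩ T^[i] '' B)

/-- `F` is a set of positive finite measure such that, with
`a_t(F) = ∑_{i < t} μ (F ∩ T^i F) / μ(F)^2`, the averages `(1 / a_t(F)) ∑_{i < t} μ (A ∩ T^i B)`
tend to `μ(A) μ(B)` for all measurable `A, B ⊆ F`. -/
def IsWeakRationalErgodicSet {X : Type*} [MeasurableSpace X] (T : X → X) (μ : Measure X)
    (F : Set X) : Prop :=
  MeasurableSet F ∧ 0 < μ F ∧ μ F < ⊤ ∧
    ∀ A B : Set X, MeasurableSet A → MeasurableSet B → A ⊆ F → B ⊆ F →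
      Tendsto (fun t : ℕ => (1 / (overlapSum T μ F F t / μ.real F ^ 2)) * overlapSum T μ A B t)
        atTop (𝓝 (μ.real A * μ.real B))

/-- Weak rational ergodicity (for an invertible transformation). -/
def WeaklyRationallyErgodic {X : Type*} [MeasurableSpace X] (T : X → X) (μ : Measure X) : Prop :=
  Conservative T μ ∧ Ergodic T μ ∧ ∃ F : Set X, IsWeakRationalErgodicSet T μ F

end

/-!
The theorem follows from one statement about `I_0`, the convergence of
`(1 / a_t) ∑_{i < t} μ (A ∩ T^i B)` to `μ A * μ B` for measurable `A, B ⊆ I_0`: a set without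
overlaps at positive times is then null, which excludes wandering sets and nontrivial invariant
sets, and every level of a column is a translate under the dynamics of a level in `I_0`.

The convergence has three ingredients.

* *The total*, `A = B = I_0` (`tendsto_overlapSum_base`). Let `t` lie between the heights `h_n` and
  `h_{n+1}`, say `t = q H_n + r` with `r < H_n`. As the upper half of `C_{n+2}` consists of spacers,
  the sum is the number of pairs of levels of `C_{n+2}` in `I_0` at a distance less than `t`, divided
  by the number of these levels (`overlapSum_base`). Most pairs lie among the tall copies of `C_n`
  in one copy of `C_{n+1}`; these copies are `H_n` apart, so that their pairs can be counted exactly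
  (`tallPairCount_eq`). Only a fraction `1 / (n + 1)` of the copies is low, and a level in a low copy
  sees about `⌊n ^ α⌋ + 1` times as many copies as one in a tall copy. As `α < 1`, the low copies
  are negligible (`pairCount_succ_le`, `pairCount_sub_tall_le`). The remaining terms of `a_t` come
  from the copy of `C_n` that is reached last, and are given by the same count one stage earlier
  (`abs_pairCount_succ_sub_profile_le`).

* *Uniform integrability* (`overlapSum_le`). The number of visits to `I_0` is not bounded by a
  multiple of `a_t`, since points in low copies return too often. But the visits along tall copies
  are bounded by `8 a_t`, and all others together contribute `o(a_t)`. So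
  `∑_{i < t} μ (A ∩ T^i B) ≤ (8 μ A + o(1)) a_t`, and likewise with `μ B`.

* *Invariance*. Replacing a level by a translate `T^s J` shifts the sum by `s` terms, and `a_t → ∞`.
  So all levels of `C_n` in `I_0` have asymptotically the same overlaps with a given set, hence the
  right share of the total (`tendsto_level_of_tendsto_sub`). Uniform integrability extends this from
  levels to all measurable subsets of `I_0` (`tendsto_of_tendsto_level`).
-/

noncomputable section

namespace CutStack

namespace Params

/-! ### The combinatorics of the columns -/

/-- All `k_n` and `m_n` are positive, so that the cutting makes sense, and `k_n ≥ 2` for `n ≥ 1`,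
so that the width of the levels tends to zero. -/
structure Nondegenerate (v : Params) : Prop where
  k_pos : ∀ n, 1 ≤ v.k n
  m_pos : ∀ n, 1 ≤ v.m n
  two_le_k : ∀ n, 1 ≤ n → 2 ≤ v.k n

variable (v : Params)

/-- The number of copies of `C_n` in `C_{n+1}` that carry spacers (the *tall* copies). -/
def tallCount (n : ℕ) : ℕ := v.m n * (v.k n - 1)

/-- The height in `C_{n+1}` at which the copy number `c` of `C_n` starts, the copies being
numbered from bottom to top. -/
def start (n c : ℕ) : ℕ :=
  if c < v.tallCount n then c * v.bigH n
  else v.tallCount n * v.bigH n + (c - v.tallCount n) * v.height n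

/-- The place, from left to right, of the copy number `c` of `C_n` among the pieces into which
each level of `C_n` is cut. -/
def piece (n c : ℕ) : ℕ :=
  if c < v.tallCount n then c % (v.k n - 1) * v.m n + c / (v.k n - 1)
  else (v.k n - 1) * v.m n + (c - v.tallCount n)

/-- The number of levels of `C_n` in `I_0` as a product; see `hatHeight_eq`. -/
def hat (n : ℕ) : ℕ := ∏ j ∈ Finset.range n, v.copies j

variable {v}

lemma height_succ (n : ℕ) :
    v.height (n + 1) = 2 * (v.tallCount n * v.bigH n + v.m n * v.height n) := by
  simp only [height, tallCount, bigH]; ring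

lemma hat_succ (n : ℕ) : v.hat (n + 1) = v.hat n * v.copies n := by
  simp [hat, Finset.prod_range_succ]

lemma height_le_bigH (n : ℕ) : v.height n ≤ v.bigH n := Nat.le_add_right _ _

lemma width_eq (n : ℕ) : v.width n = (v.hat n : ℝ)⁻¹ := by
  induction n with
  | zero => simp [width, hat]
  | succ n ih => rw [width, ih, hat_succ]; push_cast; rw [mul_inv, div_eq_mul_inv]

namespace Nondegenerate

variable (hv : v.Nondegenerate)
include hv

lemma copies_eq (n : ℕ) : v.copies n = v.tallCount n + v.m n := by
  obtain ⟨k, hk⟩ := Nat.exists_eq_add_of_le' (hv.k_pos n)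
  simp only [copies, tallCount, hk, Nat.add_sub_cancel]; ring

lemma copies_pos (n : ℕ) : 0 < v.copies n := Nat.mul_pos (hv.k_pos n) (hv.m_pos n)

lemma hat_pos (n : ℕ) : 0 < v.hat n := Finset.prod_pos fun j _ => hv.copies_pos j

lemma copies_mul_height_le (n : ℕ) :
    v.copies n * v.height n ≤ v.tallCount n * v.bigH n + v.m n * v.height n := by
  rw [hv.copies_eq, add_mul]
  gcongr
  exact height_le_bigH n

lemma two_mul_height_le (n : ℕ) : 2 * v.height n ≤ v.height (n + 1) := by
  rw [height_succ]
  have := hv.copies_mul_height_le n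
  have := Nat.le_mul_of_pos_left (v.height n) (hv.copies_pos n)
  omega

lemma two_pow_le_height (n : ℕ) : 2 ^ n ≤ v.height n := by
  induction n with
  | zero => simp [height]
  | succ n ih => have := hv.two_mul_height_le n; rw [pow_succ]; omega

lemma height_pos (n : ℕ) : 0 < v.height n :=
  lt_of_lt_of_le (by positivity) (hv.two_pow_le_height n)

lemma lt_height (n : ℕ) : n < v.height n := Nat.lt_two_pow_self.trans_le (hv.two_pow_le_height n)

lemma bigH_pos (n : ℕ) : 0 < v.bigH n := (hv.height_pos n).trans_le (height_le_bigH n)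

lemma width_pos (n : ℕ) : 0 < v.width n := by
  have := hv.hat_pos n; rw [width_eq]; positivity

/-- All copies of `C_n` lie in the lower half of `C_{n+1}`. -/
lemma start_add_height_le {n c : ℕ} (hc : c < v.copies n) :
    2 * (v.start n c + v.height n) ≤ v.height (n + 1) := by
  rw [height_succ]
  rw [hv.copies_eq] at hc
  unfold start
  split_ifs with h
  · have h1 : (c + 1) * v.bigH n ≤ v.tallCount n * v.bigH n := Nat.mul_le_mul_right _ h
    have := height_le_bigH (v := v) n
    have : 0 ≤ v.m n * v.height n := Nat.zero_le _
    rw [add_mul] at h1; omega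
  · have h1 : (c - v.tallCount n + 1) * v.height n ≤ v.m n * v.height n :=
      Nat.mul_le_mul_right _ (by omega)
    rw [add_mul] at h1; omega

lemma slot_start_add {n c s : ℕ} (hc : c < v.copies n) (hs : s < v.height n) :
    v.slot (n + 1) (v.start n c + s) = v.slot n s * v.copies n + v.piece n c := by
  have hsH : s < v.bigH n := hs.trans_le (height_le_bigH n)
  have hH := hv.bigH_pos n
  have htall : v.m n * (v.bigH n * (v.k n - 1)) = v.tallCount n * v.bigH n := by
    simp only [tallCount]; ring
  rw [hv.copies_eq] at hc
  unfold start piece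
  simp only [slot, htall, copies]
  by_cases h : c < v.tallCount n
  · have h1 : (c + 1) * v.bigH n ≤ v.tallCount n * v.bigH n := Nat.mul_le_mul_right _ h
    rw [add_mul] at h1
    have e1 : (c * v.bigH n + s) / v.bigH n = c := by
      rw [Nat.add_comm, Nat.add_mul_div_right _ _ hH, Nat.div_eq_of_lt hsH, zero_add]
    have e2 : (c * v.bigH n + s) % v.bigH n = s := by
      rw [Nat.add_comm, Nat.add_mul_mod_self_right, Nat.mod_eq_of_lt hsH]
    have e3 : (c * v.bigH n + s) / (v.bigH n * (v.k n - 1)) = c / (v.k n - 1) := by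
      rw [← Nat.div_div_eq_div_mul, e1]
    have e4 : (c * v.bigH n + s) % (v.bigH n * (v.k n - 1)) =
        s + v.bigH n * (c % (v.k n - 1)) := by
      rw [Nat.mod_mul, e1, e2]
    have e5 : (s + v.bigH n * (c % (v.k n - 1))) / v.bigH n = c % (v.k n - 1) := by
      rw [Nat.add_mul_div_left _ _ hH, Nat.div_eq_of_lt hsH, zero_add]
    have e6 : (s + v.bigH n * (c % (v.k n - 1))) % v.bigH n = s := by
      rw [Nat.add_mul_mod_self_left, Nat.mod_eq_of_lt hsH]
    simp only [h, if_true]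
    rw [if_pos (by omega), e3, e4, e5, e6, if_pos hs]
  · have hh := hv.height_pos n
    simp only [h, if_false]
    have h1 : (c - v.tallCount n + 1) * v.height n ≤ v.m n * v.height n :=
      Nat.mul_le_mul_right _ (by omega)
    rw [add_mul] at h1
    rw [if_neg (by omega), if_pos (by omega)]
    have e0 : v.tallCount n * v.bigH n + (c - v.tallCount n) * v.height n + s -
        v.tallCount n * v.bigH n = s + (c - v.tallCount n) * v.height n := by omega
    rw [e0, Nat.add_mul_div_right _ _ hh, Nat.div_eq_of_lt hs, Nat.add_mul_mod_self_right,
      Nat.mod_eq_of_lt hs, zero_add]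

lemma piece_lt {n c : ℕ} (hc : c < v.copies n) : v.piece n c < v.copies n := by
  have e : v.tallCount n = (v.k n - 1) * v.m n := by rw [tallCount, mul_comm]
  rw [hv.copies_eq] at *
  unfold piece
  split_ifs with h
  · have hk : 0 < v.k n - 1 := by
      by_contra h0; simp [tallCount, Nat.eq_zero_of_not_pos h0] at h
    have h1 : c / (v.k n - 1) < v.m n := (Nat.div_lt_iff_lt_mul hk).2 h
    have h2 : (c % (v.k n - 1) + 1) * v.m n ≤ (v.k n - 1) * v.m n :=
      Nat.mul_le_mul_right _ (Nat.mod_lt _ hk)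
    rw [add_mul] at h2; omega
  · omega

lemma exists_piece_eq {n b : ℕ} (hb : b < v.copies n) : ∃ c < v.copies n, v.piece n c = b := by
  have e : v.tallCount n = (v.k n - 1) * v.m n := by rw [tallCount, mul_comm]
  have hm := hv.m_pos n
  rw [hv.copies_eq] at *
  by_cases h : b < v.tallCount n
  · have hk : 0 < v.k n - 1 := by
      by_contra h0; simp [tallCount, Nat.eq_zero_of_not_pos h0] at h
    have h1 : b / v.m n < v.k n - 1 := (Nat.div_lt_iff_lt_mul hm).2 (e ▸ h)
    have h2 : b % v.m n < v.m n := Nat.mod_lt _ hm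
    have h3 : (b % v.m n + 1) * (v.k n - 1) ≤ v.m n * (v.k n - 1) := Nat.mul_le_mul_right _ h2
    have h4 : b % v.m n * (v.k n - 1) + b / v.m n < v.tallCount n := by
      rw [tallCount]; rw [add_mul] at h3; omega
    refine ⟨b % v.m n * (v.k n - 1) + b / v.m n, by omega, ?_⟩
    unfold piece
    rw [if_pos h4, add_comm (b % v.m n * (v.k n - 1)), Nat.add_mul_mod_self_right,
      Nat.mod_eq_of_lt h1,
      Nat.add_mul_div_right _ _ hk, Nat.div_eq_of_lt h1, zero_add, Nat.div_add_mod']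
  · refine ⟨b, hb, ?_⟩
    unfold piece
    rw [if_neg h]; omega

/-- Every slot beyond those of `C_n` is taken by a spacer of stage `n`. -/
lemma exists_slot_spacer {n a : ℕ} (ha : v.height n * v.copies n ≤ a)
    (ha' : a < v.height (n + 1)) : ∃ p < v.height (n + 1), v.slot (n + 1) p = a := by
  have hm := hv.m_pos n
  have hH := hv.bigH_pos n
  have htall : v.m n * (v.bigH n * (v.k n - 1)) = v.tallCount n * v.bigH n := by
    simp only [tallCount]; ring
  obtain ⟨b, rfl⟩ := Nat.exists_eq_add_of_le ha
  by_cases hb : b < (v.k n - 1) * v.l n * v.m n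
  · have hl : 0 < v.l n := by
      by_contra h0; simp [Nat.eq_zero_of_not_pos h0] at hb
    have hk : 0 < v.k n - 1 := by
      by_contra h0; simp [Nat.eq_zero_of_not_pos h0] at hb
    set j := b % v.m n with hj
    set e := b / v.m n with he
    have hjm : j < v.m n := Nat.mod_lt _ hm
    have hek : e < (v.k n - 1) * v.l n := (Nat.div_lt_iff_lt_mul hm).2 hb
    set u := e % v.l n with hu
    set i := e / v.l n with hi
    have hul : u < v.l n := Nat.mod_lt _ hl
    have hik : i < v.k n - 1 := (Nat.div_lt_iff_lt_mul hl).2 hek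
    have hsH : v.height n + u < v.bigH n := by unfold bigH; omega
    set c := j * (v.k n - 1) + i with hc
    have hcK : c < v.tallCount n := by
      have h3 : (j + 1) * (v.k n - 1) ≤ v.m n * (v.k n - 1) := Nat.mul_le_mul_right _ hjm
      rw [tallCount]; rw [add_mul] at h3; omega
    have h1 : (c + 1) * v.bigH n ≤ v.tallCount n * v.bigH n := Nat.mul_le_mul_right _ hcK
    rw [add_mul] at h1
    refine ⟨c * v.bigH n + (v.height n + u), by rw [height_succ]; omega, ?_⟩
    have e1 : (c * v.bigH n + (v.height n + u)) / v.bigH n = c := by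
      rw [Nat.add_comm, Nat.add_mul_div_right _ _ hH, Nat.div_eq_of_lt hsH, zero_add]
    have e2 : (c * v.bigH n + (v.height n + u)) % v.bigH n = v.height n + u := by
      rw [Nat.add_comm, Nat.add_mul_mod_self_right, Nat.mod_eq_of_lt hsH]
    have c1 : c / (v.k n - 1) = j := by
      rw [hc, add_comm, Nat.add_mul_div_right _ _ hk, Nat.div_eq_of_lt hik, zero_add]
    have c2 : c % (v.k n - 1) = i := by
      rw [hc, add_comm, Nat.add_mul_mod_self_right, Nat.mod_eq_of_lt hik]
    have e3 : (c * v.bigH n + (v.height n + u)) / (v.bigH n * (v.k n - 1)) = j := by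
      rw [← Nat.div_div_eq_div_mul, e1, c1]
    have e4 : (c * v.bigH n + (v.height n + u)) % (v.bigH n * (v.k n - 1)) =
        (v.height n + u) + v.bigH n * i := by
      rw [Nat.mod_mul, e1, e2, c2]
    have e5 : (v.height n + u + v.bigH n * i) / v.bigH n = i := by
      rw [Nat.add_mul_div_left _ _ hH, Nat.div_eq_of_lt hsH, zero_add]
    have e6 : (v.height n + u + v.bigH n * i) % v.bigH n = v.height n + u := by
      rw [Nat.add_mul_mod_self_left, Nat.mod_eq_of_lt hsH]
    simp only [slot, htall, copies]
    rw [if_pos (by omega), e3, e4, e5, e6, if_neg (by omega), Nat.add_sub_cancel_left]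
    have : i * v.l n + u = e := Nat.div_add_mod' _ _
    rw [this, Nat.div_add_mod']
  · obtain ⟨d, rfl⟩ := Nat.exists_eq_add_of_le (not_lt.1 hb)
    have hle : v.height (n + 1) = v.height n * v.copies n + (v.k n - 1) * v.l n * v.m n +
        (v.tallCount n * v.bigH n + v.m n * v.height n) := by
      rw [height_succ, hv.copies_eq, tallCount, bigH]; ring
    refine ⟨v.tallCount n * v.bigH n + v.m n * v.height n + d, by rw [height_succ] at *; omega, ?_⟩
    simp only [slot, htall]
    rw [if_neg (by omega), if_neg (by omega), Nat.add_sub_cancel_left]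
    rfl

lemma range_subset_image_slot (n : ℕ) :
    Finset.range (v.height n) ⊆ (Finset.range (v.height n)).image (v.slot n) := by
  intro a ha
  simp only [Finset.mem_image, Finset.mem_range] at *
  induction n generalizing a with
  | zero => simp only [height, slot] at *; exact ⟨0, by omega, by omega⟩
  | succ n ih =>
    by_cases h : a < v.height n * v.copies n
    · obtain ⟨s, hs, hs'⟩ := ih ((Nat.div_lt_iff_lt_mul (hv.copies_pos n)).2 h)
      obtain ⟨c, hc, hc'⟩ := hv.exists_piece_eq (Nat.mod_lt a (hv.copies_pos n))
      refine ⟨v.start n c + s, ?_, ?_⟩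
      · have := hv.start_add_height_le hc; omega
      · rw [hv.slot_start_add hc hs, hs', hc', Nat.div_add_mod']
    · exact hv.exists_slot_spacer (not_lt.1 h) ha

lemma image_slot (n : ℕ) :
    (Finset.range (v.height n)).image (v.slot n) = Finset.range (v.height n) :=
  (Finset.eq_of_subset_of_card_le (hv.range_subset_image_slot n) Finset.card_image_le).symm

lemma slot_lt {n p : ℕ} (hp : p < v.height n) : v.slot n p < v.height n := by
  have h : v.slot n p ∈ (Finset.range (v.height n)).image (v.slot n) :=
    Finset.mem_image_of_mem _ (Finset.mem_range.2 hp)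
  rwa [hv.image_slot, Finset.mem_range] at h

lemma slot_inj {n p p' : ℕ} (hp : p < v.height n) (hp' : p' < v.height n)
    (h : v.slot n p = v.slot n p') : p = p' := by
  have hinj : Set.InjOn (v.slot n) (Finset.range (v.height n)) :=
    Finset.card_image_iff.1 (by rw [hv.image_slot])
  exact hinj (by simpa using hp) (by simpa using hp') h

lemma exists_slot_eq {n a : ℕ} (ha : a < v.height n) : ∃ p < v.height n, v.slot n p = a := by
  have := hv.range_subset_image_slot n (Finset.mem_range.2 ha)
  simpa using this

lemma piece_inj {n c c' : ℕ} (hc : c < v.copies n) (hc' : c' < v.copies n)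
    (h : v.piece n c = v.piece n c') : c = c' := by
  have hsub : Finset.range (v.copies n) ⊆ (Finset.range (v.copies n)).image (v.piece n) := by
    intro a ha
    simpa using hv.exists_piece_eq (Finset.mem_range.1 ha)
  have e := Finset.eq_of_subset_of_card_le hsub Finset.card_image_le
  have hinj : Set.InjOn (v.piece n) (Finset.range (v.copies n)) :=
    Finset.card_image_iff.1 (by rw [← e])
  exact hinj (by simpa using hc) (by simpa using hc') h

/-! ### The levels as sets -/

lemma mem_level {n p : ℕ} {x : ℝ} :
    x ∈ v.level n p ↔ 0 ≤ x ∧ ⌊x * v.hat n⌋₊ = v.slot n p := by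
  have hh : (0 : ℝ) < v.hat n := by exact_mod_cast hv.hat_pos n
  rw [level, width_eq, mem_Ico, mul_inv_le_iff₀ hh, lt_mul_inv_iff₀ hh]
  constructor
  · rintro ⟨h1, h2⟩
    have : 0 ≤ x * v.hat n := (Nat.cast_nonneg _).trans h1
    exact ⟨nonneg_of_mul_nonneg_left this hh, (Nat.floor_eq_iff this).2 ⟨h1, h2⟩⟩
  · rintro ⟨h1, h2⟩
    exact (Nat.floor_eq_iff (by positivity)).1 h2

lemma level_disjoint {n p p' : ℕ} (hp : p < v.height n) (hp' : p' < v.height n) {x : ℝ}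
    (h : x ∈ v.level n p) (h' : x ∈ v.level n p') : p = p' :=
  hv.slot_inj hp hp' (((hv.mem_level).1 h).2.symm.trans ((hv.mem_level).1 h').2)

lemma mem_column {n : ℕ} {x : ℝ} :
    x ∈ v.column n ↔ 0 ≤ x ∧ ⌊x * v.hat n⌋₊ < v.height n := by
  simp only [column, Finset.mem_range, mem_iUnion, hv.mem_level, exists_prop]
  constructor
  · rintro ⟨p, hp, h0, h⟩; exact ⟨h0, h ▸ hv.slot_lt hp⟩
  · rintro ⟨h0, h⟩
    obtain ⟨p, hp, hp'⟩ := hv.exists_slot_eq h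
    exact ⟨p, hp, h0, hp'.symm⟩

lemma floor_mul_hat_succ (n : ℕ) (x : ℝ) :
    ⌊x * v.hat n⌋₊ = ⌊x * v.hat (n + 1)⌋₊ / v.copies n := by
  have hc : (v.copies n : ℝ) ≠ 0 := by exact_mod_cast (hv.copies_pos n).ne'
  rw [← Nat.floor_div_natCast, hat_succ]
  congr 1; push_cast; field_simp

/-- A level of `C_n` is made of one level of `C_{n+1}` in each copy of `C_n`. -/
lemma mem_level_iff_exists {n s : ℕ} (hs : s < v.height n) {x : ℝ} :
    x ∈ v.level n s ↔ ∃ c < v.copies n, x ∈ v.level (n + 1) (v.start n c + s) := by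
  simp only [hv.mem_level, hv.floor_mul_hat_succ n x]
  constructor
  · rintro ⟨h0, h⟩
    obtain ⟨c, hc, hc'⟩ := hv.exists_piece_eq
      (Nat.mod_lt ⌊x * v.hat (n + 1)⌋₊ (hv.copies_pos n))
    exact ⟨c, hc, h0, by rw [hv.slot_start_add hc hs, ← h, hc', Nat.div_add_mod']⟩
  · rintro ⟨c, hc, h0, h⟩
    refine ⟨h0, ?_⟩
    rw [h, hv.slot_start_add hc hs, add_comm, Nat.add_mul_div_right _ _ (hv.copies_pos n),
      Nat.div_eq_of_lt (hv.piece_lt hc), zero_add]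

lemma column_mono : Monotone v.column := by
  refine monotone_nat_of_le_succ fun n x hx => ?_
  simp only [column, Finset.mem_range, mem_iUnion, exists_prop] at hx ⊢
  obtain ⟨p, hp, hx⟩ := hx
  obtain ⟨c, hc, hx⟩ := (hv.mem_level_iff_exists hp).1 hx
  exact ⟨_, by have := hv.start_add_height_le hc; omega, hx⟩

lemma two_pow_mul_hat_le (n : ℕ) : 2 ^ n * v.hat n ≤ v.height n := by
  induction n with
  | zero => simp [hat, height]
  | succ n ih =>
    have h1 := hv.copies_mul_height_le n
    have h2 := Nat.mul_le_mul_left (v.copies n) ih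
    rw [height_succ, hat_succ]
    calc 2 ^ (n + 1) * (v.hat n * v.copies n) = 2 * (v.copies n * (2 ^ n * v.hat n)) := by ring
      _ ≤ _ := by omega

/-- The space is the whole half-line, since the measure of the columns at least doubles. -/
lemma space_eq : v.space = Ici 0 := by
  ext x
  simp only [space, mem_iUnion, hv.mem_column, mem_Ici]
  refine ⟨fun ⟨n, h, _⟩ => h, fun h => ?_⟩
  obtain ⟨n, hn⟩ := pow_unbounded_of_one_lt x (one_lt_two)
  refine ⟨n, h, (Nat.floor_lt (by positivity)).2 ?_⟩
  have hh : (0 : ℝ) < v.hat n := by exact_mod_cast hv.hat_pos n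
  calc x * v.hat n < 2 ^ n * v.hat n := by gcongr
    _ ≤ v.height n := by exact_mod_cast hv.two_pow_mul_hat_le n

lemma base_eq : v.base = Ico 0 1 := by
  ext x
  rw [base, hv.mem_column]
  simp only [hat, height, Finset.range_zero, Finset.prod_empty, Nat.cast_one, mul_one, mem_Ico]
  exact and_congr_right fun h => by rw [Nat.floor_lt h, Nat.cast_one]

lemma level_subset_base_iff {n p : ℕ} : v.level n p ⊆ v.base ↔ v.slot n p < v.hat n := by
  have hw := hv.width_pos n
  have hh : (0 : ℝ) < v.hat n := by exact_mod_cast hv.hat_pos n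
  have hlt : (v.slot n p : ℝ) * v.width n < ((v.slot n p : ℝ) + 1) * v.width n := by
    gcongr; linarith
  rw [hv.base_eq, level, Ico_subset_Ico_iff hlt, width_eq, mul_inv_le_iff₀ hh, one_mul,
    ← Nat.cast_succ, Nat.cast_le, Nat.succ_le_iff]
  exact and_iff_right (by positivity)

end Nondegenerate

/-! ### The levels that make up the initial interval -/

/-- The heights of the levels of `C_n` that are contained in `I_0`. -/
def basePos (v : Params) (n : ℕ) : Finset ℕ :=
  (Finset.range (v.height n)).filter fun p => v.slot n p < v.hat n

lemma lt_height_of_mem {n p : ℕ} (hp : p ∈ v.basePos n) : p < v.height n :=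
  Finset.mem_range.1 (Finset.mem_filter.1 hp).1

lemma measurableSet_level (n p : ℕ) : MeasurableSet (v.level n p) := measurableSet_Ico

lemma shift_mem_level {n p p' : ℕ} {x : ℝ} (hx : x ∈ v.level n p) :
    x + ((v.slot n p' : ℝ) - v.slot n p) * v.width n ∈ v.level n p' := by
  simp only [level, mem_Ico] at *
  constructor <;> nlinarith

namespace Nondegenerate

variable (hv : v.Nondegenerate)
include hv

lemma two_pow_le_hat (n : ℕ) : 2 ^ n ≤ v.hat (n + 1) := by
  induction n with
  | zero => exact hv.hat_pos 1
  | succ n ih =>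
    rw [hat_succ, pow_succ]
    exact Nat.mul_le_mul ih
      ((hv.two_le_k _ (by omega)).trans (Nat.le_mul_of_pos_right _ (hv.m_pos _)))

lemma tendsto_hat : Tendsto v.hat atTop atTop :=
  (tendsto_add_atTop_iff_nat 1).1 <|
    tendsto_atTop_mono hv.two_pow_le_hat (tendsto_pow_atTop_atTop_of_one_lt one_lt_two)

lemma tendsto_width : Tendsto v.width atTop (𝓝 0) := by
  rw [show v.width = fun n => (v.hat n : ℝ)⁻¹ from funext width_eq]
  exact tendsto_inv_atTop_zero.comp (tendsto_natCast_atTop_atTop.comp hv.tendsto_hat)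

lemma slot_lt_of_lt_hat {n a : ℕ} (h : a < v.hat n) : a < v.height n :=
  h.trans_le ((Nat.le_mul_of_pos_left _ (by positivity)).trans (hv.two_pow_mul_hat_le n))

lemma image_slot_basePos (n : ℕ) :
    (v.basePos n).image (v.slot n) = Finset.range (v.hat n) := by
  ext a
  simp only [basePos, Finset.mem_image, Finset.mem_filter, Finset.mem_range]
  constructor
  · rintro ⟨p, ⟨_, h⟩, rfl⟩; exact h
  · intro h
    obtain ⟨p, hp, rfl⟩ := hv.exists_slot_eq (hv.slot_lt_of_lt_hat h)
    exact ⟨p, ⟨hp, h⟩, rfl⟩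

lemma card_basePos (n : ℕ) : (v.basePos n).card = v.hat n := by
  rw [← Finset.card_range (v.hat n), ← hv.image_slot_basePos n, Finset.card_image_of_injOn]
  intro p hp p' hp' h
  exact hv.slot_inj (lt_height_of_mem hp) (lt_height_of_mem hp') h

lemma hatHeight_eq (n : ℕ) : v.hatHeight n = v.hat n := by
  rw [hatHeight, ← hv.card_basePos n, ← Set.ncard_coe_finset]
  congr 1
  ext p
  simp [basePos, hv.level_subset_base_iff]

lemma slot_lt_hat_iff_of_start {n c s : ℕ} (hc : c < v.copies n) (hs : s < v.height n) :
    v.slot (n + 1) (v.start n c + s) < v.hat (n + 1) ↔ v.slot n s < v.hat n := by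
  rw [hv.slot_start_add hc hs, hat_succ, ← Nat.div_lt_iff_lt_mul (hv.copies_pos n), add_comm,
    Nat.add_mul_div_right _ _ (hv.copies_pos n), Nat.div_eq_of_lt (hv.piece_lt hc), zero_add]

lemma start_add_inj {n c s c' s' : ℕ} (hc : c < v.copies n) (hs : s < v.height n)
    (hc' : c' < v.copies n) (hs' : s' < v.height n)
    (h : v.start n c + s = v.start n c' + s') : c = c' ∧ s = s' := by
  have e := hv.slot_start_add hc hs
  rw [h, hv.slot_start_add hc' hs'] at e
  have e1 := congrArg (· % v.copies n) e
  simp only [Nat.mul_add_mod_self_right, Nat.mod_eq_of_lt (hv.piece_lt hc),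
    Nat.mod_eq_of_lt (hv.piece_lt hc')] at e1
  obtain rfl := hv.piece_inj hc' hc e1
  exact ⟨rfl, by omega⟩

/-- The levels of `C_{n+1}` in `I_0` are those of the copies of `C_n`. -/
lemma basePos_succ (n : ℕ) :
    v.basePos (n + 1) = (Finset.range (v.copies n) ×ˢ v.basePos n).image
      fun x => v.start n x.1 + x.2 := by
  ext p
  simp only [Finset.mem_image, Finset.mem_product, Finset.mem_range, Prod.exists]
  constructor
  · intro hp
    have hp1 := lt_height_of_mem hp
    have hp2 := (Finset.mem_filter.1 hp).2
    rw [hat_succ] at hp2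
    obtain ⟨s, hs, hs'⟩ := hv.exists_slot_eq (hv.slot_lt_of_lt_hat
      ((Nat.div_lt_iff_lt_mul (hv.copies_pos n)).2 hp2))
    obtain ⟨c, hc, hc'⟩ := hv.exists_piece_eq (Nat.mod_lt (v.slot (n + 1) p) (hv.copies_pos n))
    have e : v.slot (n + 1) (v.start n c + s) = v.slot (n + 1) p := by
      rw [hv.slot_start_add hc hs, hs', hc', Nat.div_add_mod']
    have hlt : v.start n c + s < v.height (n + 1) := by
      have := hv.start_add_height_le hc; omega
    refine ⟨c, s, ⟨hc, Finset.mem_filter.2 ⟨Finset.mem_range.2 hs, ?_⟩⟩, hv.slot_inj hlt hp1 e⟩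
    rw [hs']; exact (Nat.div_lt_iff_lt_mul (hv.copies_pos n)).2 hp2
  · rintro ⟨c, s, ⟨hc, hs⟩, rfl⟩
    have h1 := lt_height_of_mem hs
    refine Finset.mem_filter.2 ⟨Finset.mem_range.2 ?_, ?_⟩
    · have := hv.start_add_height_le hc; omega
    · exact (hv.slot_lt_hat_iff_of_start hc h1).2 (Finset.mem_filter.1 hs).2

lemma sum_basePos_succ (n : ℕ) (f : ℕ → ℝ) :
    ∑ p ∈ v.basePos (n + 1), f p =
      ∑ c ∈ Finset.range (v.copies n), ∑ s ∈ v.basePos n, f (v.start n c + s) := by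
  rw [hv.basePos_succ, Finset.sum_image, Finset.sum_product]
  rintro ⟨c, s⟩ h ⟨c', s'⟩ h' e
  simp only [Finset.coe_product, mem_prod, Finset.mem_coe, Finset.mem_range] at h h'
  obtain ⟨rfl, rfl⟩ := hv.start_add_inj h.1 (lt_height_of_mem h.2) h'.1 (lt_height_of_mem h'.2) e
  rfl

/-- The upper half of `C_n`, `n ≥ 1`, does not meet `I_0`. -/
lemma two_mul_lt_of_mem {n p : ℕ} (hp : p ∈ v.basePos n) : 2 * p < v.height n := by
  cases n with
  | zero => have := lt_height_of_mem hp; simp only [height] at *; omega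
  | succ n =>
    rw [hv.basePos_succ] at hp
    simp only [Finset.mem_image, Finset.mem_product, Finset.mem_range, Prod.exists] at hp
    obtain ⟨c, s, ⟨hc, hs⟩, rfl⟩ := hp
    have := lt_height_of_mem hs
    have := hv.start_add_height_le hc
    omega

lemma mem_base_iff (n : ℕ) {x : ℝ} : x ∈ v.base ↔ ∃ p ∈ v.basePos n, x ∈ v.level n p := by
  constructor
  · intro hx
    have hc := (hv.mem_column).1 (hv.column_mono (Nat.zero_le n) hx)
    obtain ⟨p, hp, hp'⟩ := hv.exists_slot_eq hc.2
    have hl : x ∈ v.level n p := hv.mem_level.2 ⟨hc.1, hp'.symm⟩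
    refine ⟨p, Finset.mem_filter.2 ⟨Finset.mem_range.2 hp, ?_⟩, hl⟩
    rw [hp', Nat.floor_lt (by have := hc.1; positivity)]
    rw [hv.base_eq] at hx
    have hh : (0 : ℝ) < v.hat n := by exact_mod_cast hv.hat_pos n
    nlinarith [hx.2]
  · rintro ⟨p, hp, hx⟩
    exact hv.level_subset_base_iff.2 (Finset.mem_filter.1 hp).2 hx

/-! ### The transformation on the levels -/

/-- A point of `C_n` lies in every later column, in a translate of an initial segment of the
column `C_n`. -/
lemma exists_lift {n p N : ℕ} (hN : n ≤ N) (hp : p < v.height n) {x : ℝ} (hx : x ∈ v.level n p) :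
    ∃ p', x ∈ v.level N p' ∧ ∀ i, p + i < v.height n → p' + i < v.height N ∧
      ((v.slot N (p' + i) : ℝ) - v.slot N p') * v.width N =
        ((v.slot n (p + i) : ℝ) - v.slot n p) * v.width n := by
  induction N, hN using Nat.le_induction with
  | base => exact ⟨p, hx, fun i hi => ⟨hi, rfl⟩⟩
  | succ N hN ih =>
    obtain ⟨p', hp', h⟩ := ih
    obtain ⟨c, hc, hxc⟩ := (hv.mem_level_iff_exists (by simpa using (h 0 (by simpa)).1)).1 hp'
    refine ⟨v.start N c + p', hxc, fun i hi => ?_⟩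
    obtain ⟨h1, h2⟩ := h i hi
    refine ⟨by have := hv.start_add_height_le hc; omega, ?_⟩
    rw [← h2, add_assoc, hv.slot_start_add hc h1,
      hv.slot_start_add hc (by omega), width_eq, width_eq, hat_succ]
    have : (v.copies N : ℝ) ≠ 0 := by exact_mod_cast (hv.copies_pos N).ne'
    have : (v.hat N : ℝ) ≠ 0 := by exact_mod_cast (hv.hat_pos N).ne'
    push_cast; field_simp; ring

lemma map_eq {n p : ℕ} (hp : p + 1 < v.height n) {x : ℝ} (hx : x ∈ v.level n p) :
    v.map x = x + ((v.slot n (p + 1) : ℝ) - v.slot n p) * v.width n := by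
  have hex : ∃ q : ℕ × ℕ, q.2 + 1 < v.height q.1 ∧ x ∈ v.level q.1 q.2 := ⟨(n, p), hp, hx⟩
  rw [map, dif_pos hex]
  obtain ⟨h1, h2⟩ := hex.choose_spec
  set q := hex.choose
  obtain ⟨p₁, hx₁, H₁⟩ := hv.exists_lift (le_max_left n q.1) (by omega) hx
  obtain ⟨p₂, hx₂, H₂⟩ := hv.exists_lift (le_max_right n q.1) (by omega) h2
  have e1 := H₁ 1 hp
  have e2 := H₂ 1 h1
  obtain rfl := hv.level_disjoint (by omega) (by omega) hx₁ hx₂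
  rw [← e1.2, ← e2.2]

lemma map_of_neg {x : ℝ} (hx : x < 0) : v.map x = x := by
  rw [map, dif_neg]
  rintro ⟨q, _, h⟩
  exact absurd (hv.mem_level.1 h).1 (not_le.2 hx)

lemma iterate_map_eq {n p i : ℕ} (hp : p + i < v.height n) {x : ℝ} (hx : x ∈ v.level n p) :
    v.map^[i] x = x + ((v.slot n (p + i) : ℝ) - v.slot n p) * v.width n := by
  induction i with
  | zero => simp
  | succ i ih =>
    have h := ih (by omega)
    have hm : v.map^[i] x ∈ v.level n (p + i) := h ▸ shift_mem_level hx
    rw [Function.iterate_succ_apply', hv.map_eq (by omega) hm, h]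
    rw [← add_assoc p i 1]
    ring

lemma iterate_map_mem {n p i : ℕ} (hp : p + i < v.height n) {x : ℝ} (hx : x ∈ v.level n p) :
    v.map^[i] x ∈ v.level n (p + i) :=
  hv.iterate_map_eq hp hx ▸ shift_mem_level hx

/-- The level at height `p` of a column is moved up by `i` levels in time `i`. -/
lemma image_iterate_level {n p i : ℕ} (hp : p + i < v.height n) :
    v.map^[i] '' v.level n p = v.level n (p + i) := by
  refine Subset.antisymm (image_subset_iff.2 fun x hx => hv.iterate_map_mem hp hx) fun y hy => ?_
  refine ⟨_, shift_mem_level (p' := p) hy, ?_⟩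
  rw [hv.iterate_map_eq hp (shift_mem_level hy)]
  ring

/-- Every point of the space lies, from some column on, in a level that is not on top. -/
lemma exists_level {x : ℝ} (hx : 0 ≤ x) :
    ∃ n₀, ∀ n, n₀ ≤ n → ∃ p, p + 1 < v.height n ∧ x ∈ v.level n p := by
  have hs : x ∈ v.space := hv.space_eq ▸ hx
  obtain ⟨n, hn⟩ := mem_iUnion.1 hs
  simp only [column, Finset.mem_range, mem_iUnion, exists_prop] at hn
  obtain ⟨p, hp, hx⟩ := hn
  obtain ⟨c, hc, hxc⟩ := (hv.mem_level_iff_exists hp).1 hx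
  have h := hv.start_add_height_le hc
  refine ⟨n + 1, fun N hN => ?_⟩
  obtain ⟨p', hp', H⟩ := hv.exists_lift hN (by omega) hxc
  exact ⟨p', (H 1 (by omega)).1, hp'⟩

lemma map_nonneg {x : ℝ} (hx : 0 ≤ x) : 0 ≤ v.map x := by
  obtain ⟨n, hn⟩ := hv.exists_level hx
  obtain ⟨p, hp, hx⟩ := hn n le_rfl
  have := hv.iterate_map_mem hp hx
  exact (hv.mem_level.1 this).1

lemma map_injective : Function.Injective v.map := by
  intro x y h
  rcases lt_or_ge x 0 with hx | hx <;> rcases lt_or_ge y 0 with hy | hy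
  · rwa [hv.map_of_neg hx, hv.map_of_neg hy] at h
  · have := hv.map_nonneg hy; rw [← h, hv.map_of_neg hx] at this; linarith
  · have := hv.map_nonneg hx; rw [h, hv.map_of_neg hy] at this; linarith
  · obtain ⟨n₁, hn₁⟩ := hv.exists_level hx
    obtain ⟨n₂, hn₂⟩ := hv.exists_level hy
    obtain ⟨p, hp, hxp⟩ := hn₁ (max n₁ n₂) (le_max_left _ _)
    obtain ⟨p', hp', hyp⟩ := hn₂ (max n₁ n₂) (le_max_right _ _)
    have h1 := hv.iterate_map_mem hp hxp
    have h2 := hv.iterate_map_mem hp' hyp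
    simp only [Function.iterate_one] at h1 h2
    rw [h] at h1
    have e := hv.level_disjoint hp hp' h1 h2
    obtain rfl : p = p' := by omega
    rw [hv.map_eq hp hxp, hv.map_eq hp hyp] at h
    linarith

lemma measurable_map : Measurable v.map := by
  intro E hE
  have e : v.map ⁻¹' E = (E ∩ Iio 0) ∪ ⋃ q : {q : ℕ × ℕ // q.2 + 1 < v.height q.1},
      (v.level q.1.1 q.1.2 ∩ (fun x => x + ((v.slot q.1.1 (q.1.2 + 1) : ℝ) -
        v.slot q.1.1 q.1.2) * v.width q.1.1) ⁻¹' E) := by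
    ext x
    simp only [mem_preimage, mem_union, mem_inter_iff, mem_Iio, mem_iUnion, Subtype.exists,
      Prod.exists]
    constructor
    · intro hx
      rcases lt_or_ge x 0 with h | h
      · exact Or.inl ⟨hv.map_of_neg h ▸ hx, h⟩
      · obtain ⟨n, hn⟩ := hv.exists_level h
        obtain ⟨p, hp, hxp⟩ := hn n le_rfl
        exact Or.inr ⟨n, p, hp, hxp, hv.map_eq hp hxp ▸ hx⟩
    · rintro (⟨hx, h⟩ | ⟨n, p, hp, hxp, hx⟩)
      · rwa [hv.map_of_neg h]
      · rwa [hv.map_eq hp hxp]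
  rw [e]
  refine (hE.inter measurableSet_Iio).union (MeasurableSet.iUnion fun q => ?_)
  exact (measurableSet_level _ _).inter (measurable_id.add_const _ hE)

lemma measure_eq : v.measure = volume.restrict (Ici 0) := by rw [measure, hv.space_eq]

lemma measure_apply_of_nonneg {E : Set ℝ} (hE : E ⊆ Ici 0) : v.measure E = volume E := by
  rw [hv.measure_eq, Measure.restrict_eq_self _ hE]

lemma level_subset_Ici (n p : ℕ) : v.level n p ⊆ Ici 0 := fun _ hx => (hv.mem_level.1 hx).1

lemma measure_level (n p : ℕ) : v.measure (v.level n p) = ENNReal.ofReal (v.width n) := by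
  rw [hv.measure_apply_of_nonneg (hv.level_subset_Ici n p), level, Real.volume_Ico]
  congr 1; ring

lemma measure_base : v.measure v.base = 1 := by
  rw [hv.measure_apply_of_nonneg (by rw [hv.base_eq]; exact Ico_subset_Ici_self), hv.base_eq]
  simp

lemma measure_univ : v.measure univ = ⊤ := by
  rw [hv.measure_eq, Measure.restrict_apply_univ, Real.volume_Ici]

lemma measure_preimage_inter_level {n p : ℕ} (hp : p + 1 < v.height n) (E : Set ℝ) :
    v.measure (v.map ⁻¹' E ∩ v.level n p) = v.measure (E ∩ v.level n (p + 1)) := by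
  rw [hv.measure_apply_of_nonneg (inter_subset_right.trans (hv.level_subset_Ici _ _)),
    hv.measure_apply_of_nonneg (inter_subset_right.trans (hv.level_subset_Ici _ _)),
    ← measure_preimage_add_right volume
      (((v.slot n (p + 1) : ℝ) - v.slot n p) * v.width n) (E ∩ v.level n (p + 1))]
  congr 1
  ext x
  simp only [mem_inter_iff, mem_preimage]
  constructor
  · rintro ⟨h1, h2⟩
    rw [← hv.map_eq hp h2]
    exact ⟨h1, hv.iterate_map_mem hp h2⟩
  · rintro ⟨h1, h2⟩
    have := shift_mem_level (p' := p) h2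
    have hx : x ∈ v.level n p := by convert this using 1; ring
    exact ⟨by rwa [hv.map_eq hp hx], hx⟩

/-- The union of the levels of `C_n` with heights in `S` has, in `E`, the sum of the measures. -/
lemma measure_inter_biUnion_level {n : ℕ} {S : Finset ℕ} (hS : ∀ p ∈ S, p < v.height n)
    {E : Set ℝ} (hE : MeasurableSet E) :
    v.measure (E ∩ ⋃ p ∈ S, v.level n p) = ∑ p ∈ S, v.measure (E ∩ v.level n p) := by
  rw [inter_iUnion₂, measure_biUnion_finset]
  · intro p hp p' hp' hne
    refine Set.disjoint_left.2 fun x hx hx' => hne ?_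
    exact hv.level_disjoint (hS p hp) (hS p' hp') hx.2 hx'.2
  · exact fun p _ => hE.inter (measurableSet_level n p)

lemma mem_image_iff_exists {y : ℝ} :
    y ∈ v.map '' Ici 0 ↔ ∃ n p, p + 1 < v.height n ∧ y ∈ v.level n (p + 1) := by
  constructor
  · rintro ⟨x, hx, rfl⟩
    obtain ⟨n, hn⟩ := hv.exists_level hx
    obtain ⟨p, hp, hxp⟩ := hn n le_rfl
    exact ⟨n, p, hp, hv.iterate_map_mem hp hxp⟩
  · rintro ⟨n, p, hp, hy⟩
    rw [← hv.image_iterate_level hp] at hy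
    obtain ⟨x, hx, rfl⟩ := hy
    exact ⟨x, hv.level_subset_Ici _ _ hx, rfl⟩

/-- A point outside the range lies at the bottom of all columns from some column on. -/
lemma measure_compl_image : v.measure (v.map '' Ici 0)ᶜ = 0 := by
  have hsub : (v.map '' Ici 0)ᶜ ∩ Ici 0 ⊆ ⋃ n₀, ⋂ n ≥ n₀, v.level n 0 := by
    rintro y ⟨hy, h0⟩
    obtain ⟨n₀, hn₀⟩ := hv.exists_level h0
    refine mem_iUnion.2 ⟨n₀, mem_iInter₂.2 fun n hn => ?_⟩
    obtain ⟨p, hp, hyp⟩ := hn₀ n hn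
    cases p with
    | zero => exact hyp
    | succ p => exact absurd (hv.mem_image_iff_exists.2 ⟨n, p, by omega, hyp⟩) hy
  rw [hv.measure_eq, Measure.restrict_apply' measurableSet_Ici]
  refine measure_mono_null hsub (measure_iUnion_null fun n₀ => ?_)
  have hlim : Tendsto (fun n => ENNReal.ofReal (v.width n)) atTop (𝓝 0) := by
    simpa using ENNReal.tendsto_ofReal hv.tendsto_width
  refine le_antisymm (ge_of_tendsto hlim (eventually_atTop.2 ⟨n₀, fun n hn => ?_⟩)) zero_le
  rw [← hv.measure_level n 0, hv.measure_apply_of_nonneg (hv.level_subset_Ici n 0)]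
  exact measure_mono (biInter_subset_of_mem hn)

lemma measurePreserving_map : MeasurePreserving v.map v.measure v.measure := by
  refine ⟨hv.measurable_map, Measure.ext fun E hE => ?_⟩
  rw [Measure.map_apply hv.measurable_map hE]
  set Y : ℕ → Set ℝ := fun n => ⋃ p ∈ Finset.range (v.height n - 1), v.level n p with hY
  set Z : ℕ → Set ℝ := fun n => ⋃ p ∈ Finset.range (v.height n - 1), v.level n (p + 1) with hZ
  have hmemY : ∀ n x, x ∈ Y n ↔ ∃ p, p + 1 < v.height n ∧ x ∈ v.level n p := fun n x => by
    simp only [hY, Finset.mem_range, mem_iUnion, exists_prop, Nat.lt_sub_iff_add_lt]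
  have hYZ : ∀ n, Z n = v.map '' Y n := fun n => by
    rw [hY, hZ, image_iUnion₂]
    refine iUnion₂_congr fun p hp => ?_
    rw [Finset.mem_range] at hp
    exact (hv.image_iterate_level (i := 1) (by omega)).symm
  have hmono : Monotone Y := by
    intro n N hN x hx
    obtain ⟨p, hp, hx⟩ := (hmemY n x).1 hx
    obtain ⟨p', hp', H⟩ := hv.exists_lift hN (by omega) hx
    exact (hmemY N x).2 ⟨p', (H 1 hp).1, hp'⟩
  have hUY : ⋃ n, Y n = Ici 0 := by
    ext x
    simp only [mem_iUnion, hmemY]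
    refine ⟨fun ⟨n, p, _, hx⟩ => hv.level_subset_Ici _ _ hx, fun hx => ?_⟩
    obtain ⟨n, hn⟩ := hv.exists_level hx
    exact ⟨n, hn n le_rfl⟩
  have hUZ : ⋃ n, Z n = v.map '' Ici 0 := by
    simp only [hYZ, ← image_iUnion, hUY]
  have hmonoZ : Monotone Z := fun n N hN => by
    simp only [hYZ]; exact image_mono (hmono hN)
  have h1 : Tendsto (fun n => v.measure (v.map ⁻¹' E ∩ Y n)) atTop
      (𝓝 (v.measure (v.map ⁻¹' E))) := by
    have := tendsto_measure_iUnion_atTop (μ := v.measure) (s := fun n => v.map ⁻¹' E ∩ Y n)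
      (fun n N hN => inter_subset_inter_right _ (hmono hN))
    rw [← inter_iUnion, hUY] at this
    rwa [show v.measure (v.map ⁻¹' E ∩ Ici 0) = v.measure (v.map ⁻¹' E) by
      rw [hv.measure_eq, Measure.restrict_apply' measurableSet_Ici,
        Measure.restrict_apply' measurableSet_Ici, inter_assoc, inter_self]] at this
  have h2 : Tendsto (fun n => v.measure (E ∩ Z n)) atTop (𝓝 (v.measure E)) := by
    have := tendsto_measure_iUnion_atTop (μ := v.measure) (s := fun n => E ∩ Z n)
      (fun n N hN => inter_subset_inter_right _ (hmonoZ hN))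
    rw [← inter_iUnion, hUZ] at this
    rwa [measure_inter_conull hv.measure_compl_image] at this
  refine tendsto_nhds_unique h1 (h2.congr fun n => ?_)
  rw [hY, hv.measure_inter_biUnion_level (fun p hp => by rw [Finset.mem_range] at hp; omega)
    (hv.measurable_map hE)]
  have hZ' : Z n = ⋃ p ∈ (Finset.range (v.height n - 1)).image (· + 1), v.level n p := by
    simp only [hZ, Finset.mem_image, iUnion_exists, biUnion_and', iUnion_iUnion_eq_right]
  rw [hZ', hv.measure_inter_biUnion_level _ hE, Finset.sum_image (by intro a _ b _ h; simpa using h)]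
  · refine Finset.sum_congr rfl fun p hp => ?_
    rw [Finset.mem_range] at hp
    rw [hv.measure_preimage_inter_level (by omega)]
  · intro p hp
    simp only [Finset.mem_image, Finset.mem_range] at hp
    obtain ⟨a, ha, rfl⟩ := hp; omega

lemma measure_compl_range : v.measure (range v.map)ᶜ = 0 :=
  measure_mono_null (compl_subset_compl.2 (image_subset_range _ _)) hv.measure_compl_image

lemma measurableSet_image_iterate (i : ℕ) {E : Set ℝ} (hE : MeasurableSet E) :
    MeasurableSet (v.map^[i] '' E) :=
  hE.image_of_measurable_injOn (hv.measurable_map.iterate i) (hv.map_injective.iterate i).injOn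

lemma measure_image_iterate (i : ℕ) {E : Set ℝ} (hE : MeasurableSet E) :
    v.measure (v.map^[i] '' E) = v.measure E := by
  rw [← (hv.measurePreserving_map.iterate i).measure_preimage
    (hv.measurableSet_image_iterate i hE).nullMeasurableSet,
    preimage_image_eq _ (hv.map_injective.iterate i)]

end Nondegenerate

/-! ### Counting pairs of levels in the initial interval -/

/-- The indicator of `p ≤ p' < p + t`. -/
def window (t p p' : ℕ) : ℝ := if p ≤ p' ∧ p' < p + t then 1 else 0

variable (v)

/-- The number of pairs `p ≤ p' < p + t` of heights of levels of `C_n` in `I_0`. -/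
def pairCount (n t : ℕ) : ℝ := ∑ p ∈ v.basePos n, ∑ p' ∈ v.basePos n, window t p p'

/-- The number of pairs of heights of levels of `C_n` in `I_0` with `p' - p < x`. -/
def diffCount (n : ℕ) (x : ℤ) : ℝ :=
  ∑ p ∈ v.basePos n, ∑ p' ∈ v.basePos n, if (p' : ℤ) - p < x then 1 else 0

/-- The number of pairs counted by `window t`, with the first level in a copy of `C_n` that starts
at height `a` and the second one in a copy that starts at height `a'`. -/
def blockCount (n t a a' : ℕ) : ℝ :=
  ∑ s ∈ v.basePos n, ∑ s' ∈ v.basePos n, window t (a + s) (a' + s')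

/-- The part of `pairCount (n + 1) t` that comes from the tall copies of `C_n`. -/
def tallPairCount (n t : ℕ) : ℝ :=
  ∑ c ∈ Finset.range (v.tallCount n), ∑ c' ∈ Finset.range (v.tallCount n),
    v.blockCount n t (c * v.bigH n) (c' * v.bigH n)

variable {v}

lemma window_nonneg (t p p' : ℕ) : 0 ≤ window t p p' := by unfold window; split_ifs <;> norm_num

lemma window_le_one (t p p' : ℕ) : window t p p' ≤ 1 := by unfold window; split_ifs <;> norm_num

lemma window_add_left (t a s s' : ℕ) : window t (a + s) (a + s') = window t s s' := by
  unfold window; congr 1; apply propext; constructor <;> rintro ⟨_, _⟩ <;> constructor <;> omega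

lemma diffCount_nonneg (n : ℕ) (x : ℤ) : 0 ≤ v.diffCount n x :=
  Finset.sum_nonneg fun _ _ => Finset.sum_nonneg fun _ _ => by split_ifs <;> norm_num

lemma blockCount_nonneg (n t a a' : ℕ) : 0 ≤ v.blockCount n t a a' :=
  Finset.sum_nonneg fun _ _ => Finset.sum_nonneg fun _ _ => window_nonneg _ _ _

lemma blockCount_self (n t a : ℕ) : v.blockCount n t a a = v.pairCount n t := by
  simp only [blockCount, pairCount, window_add_left]

lemma pairCount_eq_sub (n t : ℕ) : v.pairCount n t = v.diffCount n t - v.diffCount n 0 := by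
  simp only [pairCount, diffCount, ← Finset.sum_sub_distrib]
  refine Finset.sum_congr rfl fun p _ => Finset.sum_congr rfl fun p' _ => ?_
  unfold window
  split_ifs <;> first | omega | norm_num

lemma start_of_le {n c : ℕ} (hc : c ≤ v.tallCount n) : v.start n c = c * v.bigH n := by
  unfold start
  split_ifs with h
  · rfl
  · obtain rfl : c = v.tallCount n := by omega
    simp

lemma start_tall_add (n j : ℕ) :
    v.start n (v.tallCount n + j) = v.tallCount n * v.bigH n + j * v.height n := by
  unfold start
  rw [if_neg (by omega), Nat.add_sub_cancel_left]

lemma start_add_height_le_succ (n c : ℕ) : v.start n c + v.height n ≤ v.start n (c + 1) := by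
  have := height_le_bigH (v := v) n
  rcases lt_or_ge c (v.tallCount n) with h | h
  · rw [start_of_le h.le, start_of_le h, Nat.succ_mul]; omega
  · obtain ⟨j, rfl⟩ := Nat.exists_eq_add_of_le h
    rw [add_assoc, start_tall_add, start_tall_add, add_mul]; omega

lemma start_mono (n : ℕ) : Monotone (v.start n) :=
  monotone_nat_of_le_succ fun c => (Nat.le_add_right _ _).trans (start_add_height_le_succ n c)

lemma start_add_height_le_of_lt {n c c' : ℕ} (h : c < c') :
    v.start n c + v.height n ≤ v.start n c' :=
  (start_add_height_le_succ n c).trans (start_mono n h)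

lemma start_add_bigH_le_of_lt {n c c' : ℕ} (hc : c < v.tallCount n) (h : c < c') :
    v.start n c + v.bigH n ≤ v.start n c' := by
  refine le_trans ?_ (start_mono n h)
  rw [start_of_le hc.le, start_of_le hc, Nat.succ_mul]

lemma blockCount_eq_zero {n t a a' : ℕ} (h : a' + v.height n ≤ a) :
    v.blockCount n t a a' = 0 := by
  refine Finset.sum_eq_zero fun s _ => Finset.sum_eq_zero fun s' hs' => ?_
  have := lt_height_of_mem hs'
  unfold window
  rw [if_neg (by omega)]

lemma blockCount_eq_diffCount {n t a a' : ℕ} (h : a + v.height n ≤ a') :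
    v.blockCount n t a a' = v.diffCount n (t - (a' - a)) := by
  refine Finset.sum_congr rfl fun s hs => Finset.sum_congr rfl fun s' _ => ?_
  have := lt_height_of_mem hs
  unfold window
  congr 1
  apply propext
  constructor
  · rintro ⟨_, _⟩; omega
  · intro _; constructor <;> omega

lemma sum_blockCount_tall {n t c : ℕ} (hc : c < v.tallCount n) :
    ∑ c' ∈ Finset.range (v.tallCount n), v.blockCount n t (c * v.bigH n) (c' * v.bigH n) =
      ∑ d ∈ Finset.range (v.tallCount n - 1 - c + 1), v.diffCount n (t - (d * v.bigH n : ℕ)) -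
        v.diffCount n 0 := by
  have hH := height_le_bigH (v := v) n
  obtain ⟨e, he⟩ := Nat.exists_eq_add_of_lt hc
  have h0 : ∑ c' ∈ Finset.range c, v.blockCount n t (c * v.bigH n) (c' * v.bigH n) = 0 := by
    refine Finset.sum_eq_zero fun c' hc' => blockCount_eq_zero ?_
    have : (c' + 1) * v.bigH n ≤ c * v.bigH n :=
      Nat.mul_le_mul_right _ (Finset.mem_range.1 hc')
    rw [add_mul] at this; omega
  rw [show v.tallCount n - 1 - c + 1 = e + 1 by omega, show v.tallCount n = c + (e + 1) by omega,
    Finset.sum_range_add, h0, zero_add, Finset.sum_range_succ', Finset.sum_range_succ' (n := e),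
    add_zero, blockCount_self, pairCount_eq_sub]
  have : ∀ i ∈ Finset.range e, v.blockCount n t (c * v.bigH n) ((c + (i + 1)) * v.bigH n) =
      v.diffCount n (t - ((i + 1) * v.bigH n : ℕ)) := by
    intro i _
    rw [blockCount_eq_diffCount (by rw [add_mul, add_mul i 1]; omega)]
    congr 1; push_cast; ring
  rw [Finset.sum_congr rfl this]
  simp
  ring

namespace Nondegenerate

variable (hv : v.Nondegenerate)
include hv

lemma diffCount_le (n : ℕ) (x : ℤ) : v.diffCount n x ≤ (v.hat n : ℝ) ^ 2 := by
  calc v.diffCount n x ≤ ∑ p ∈ v.basePos n, ∑ p' ∈ v.basePos n, (1 : ℝ) :=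
        Finset.sum_le_sum fun _ _ => Finset.sum_le_sum fun _ _ => by split_ifs <;> norm_num
    _ = _ := by simp [hv.card_basePos]; ring

lemma diffCount_eq_sq {n : ℕ} {x : ℤ} (hx : (v.height n : ℤ) ≤ 2 * x) :
    v.diffCount n x = (v.hat n : ℝ) ^ 2 := by
  have : v.diffCount n x = ∑ p ∈ v.basePos n, ∑ p' ∈ v.basePos n, (1 : ℝ) := by
    refine Finset.sum_congr rfl fun p _ => Finset.sum_congr rfl fun p' hp' => ?_
    have := hv.two_mul_lt_of_mem hp'
    rw [if_pos (by omega)]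
  rw [this]
  simp [hv.card_basePos]; ring

lemma diffCount_eq_zero {n : ℕ} {x : ℤ} (hx : 2 * x ≤ -(v.height n : ℤ)) :
    v.diffCount n x = 0 := by
  refine Finset.sum_eq_zero fun p hp => Finset.sum_eq_zero fun p' _ => ?_
  have := hv.two_mul_lt_of_mem hp
  rw [if_neg (by omega)]

/-- The set of differences is symmetric. -/
lemma diffCount_add_diffCount (n : ℕ) (x : ℤ) :
    v.diffCount n x + v.diffCount n (1 - x) = (v.hat n : ℝ) ^ 2 := by
  have : v.diffCount n (1 - x) =
      ∑ p ∈ v.basePos n, ∑ p' ∈ v.basePos n, if (p : ℤ) - p' < 1 - x then (1 : ℝ) else 0 :=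
    Finset.sum_comm
  rw [this]
  simp only [diffCount, ← Finset.sum_add_distrib]
  calc _ = ∑ p ∈ v.basePos n, ∑ p' ∈ v.basePos n, (1 : ℝ) :=
        Finset.sum_congr rfl fun p _ => Finset.sum_congr rfl fun p' _ => by
          split_ifs <;> first | omega | norm_num
    _ = _ := by simp [hv.card_basePos]; ring

lemma pairCount_one (n : ℕ) : v.pairCount n 1 = v.hat n := by
  have : ∀ p ∈ v.basePos n, ∑ p' ∈ v.basePos n, window 1 p p' = 1 := by
    intro p hp
    rw [Finset.sum_eq_single_of_mem p hp]
    · simp [window]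
    · intro b _ hb
      unfold window
      rw [if_neg (by omega)]
  rw [pairCount, Finset.sum_congr rfl this]
  simp [hv.card_basePos]

lemma diffCount_zero (n : ℕ) :
    v.diffCount n 0 = ((v.hat n : ℝ) ^ 2 - v.hat n) / 2 := by
  have h1 := hv.diffCount_add_diffCount n 0
  have h2 := hv.pairCount_one n
  rw [pairCount_eq_sub] at h2
  norm_num at h1 h2
  linarith

lemma diffCount_natCast (n t : ℕ) :
    v.diffCount n t = v.pairCount n t + ((v.hat n : ℝ) ^ 2 - v.hat n) / 2 := by
  rw [pairCount_eq_sub, hv.diffCount_zero]; ring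

lemma blockCount_le (n t a a' : ℕ) : v.blockCount n t a a' ≤ (v.hat n : ℝ) ^ 2 := by
  calc v.blockCount n t a a' ≤ ∑ p ∈ v.basePos n, ∑ p' ∈ v.basePos n, (1 : ℝ) :=
        Finset.sum_le_sum fun _ _ => Finset.sum_le_sum fun _ _ => window_le_one _ _ _
    _ = _ := by simp [hv.card_basePos]; ring

/-- Two copies that are more than `t + h_n / 2` apart do not contribute. -/
lemma blockCount_eq_zero_of_far {n t a a' : ℕ} (h : 2 * a + 2 * t + v.height n ≤ 2 * a') :
    v.blockCount n t a a' = 0 := by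
  refine Finset.sum_eq_zero fun s hs => Finset.sum_eq_zero fun s' _ => ?_
  have := hv.two_mul_lt_of_mem hs
  unfold window
  rw [if_neg (by omega)]

lemma pairCount_succ (n t : ℕ) :
    v.pairCount (n + 1) t = ∑ c ∈ Finset.range (v.copies n), ∑ c' ∈ Finset.range (v.copies n),
      v.blockCount n t (v.start n c) (v.start n c') := by
  rw [pairCount, hv.sum_basePos_succ]
  refine Finset.sum_congr rfl fun c _ => ?_
  simp only [hv.sum_basePos_succ n, blockCount]
  rw [Finset.sum_comm]

/-- The number of pairs with the first level in a fixed tall copy that is followed by `e` further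
tall copies. -/
lemma sum_diffCount_range (n q r e : ℕ) (hr : r < v.bigH n) :
    ∑ d ∈ Finset.range (e + 1), v.diffCount n ((q * v.bigH n + r : ℕ) - (d * v.bigH n : ℕ)) =
      (min (e + 1) q : ℕ) * (v.hat n : ℝ) ^ 2 + (if q ≤ e then v.diffCount n r else 0) +
        (if q + 1 ≤ e then v.diffCount n (r - v.bigH n) else 0) := by
  have hH := height_le_bigH (v := v) n
  have hval : ∀ d, v.diffCount n ((q * v.bigH n + r : ℕ) - (d * v.bigH n : ℕ)) =
      if d < q then (v.hat n : ℝ) ^ 2 else if d = q then v.diffCount n r else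
        if d = q + 1 then v.diffCount n (r - v.bigH n) else 0 := by
    intro d
    split_ifs with h1 h2 h3
    · refine hv.diffCount_eq_sq ?_
      have : (d + 1) * v.bigH n ≤ q * v.bigH n := Nat.mul_le_mul_right _ h1
      rw [add_mul] at this; push_cast; zify at *; linarith
    · subst h2; congr 1; push_cast; ring
    · subst h3; congr 1; push_cast; ring
    · refine hv.diffCount_eq_zero ?_
      have : (q + 2) * v.bigH n ≤ d * v.bigH n := Nat.mul_le_mul_right _ (by omega)
      rw [add_mul] at this; push_cast; zify at *; linarith
  simp only [hval]
  clear hval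
  induction e with
  | zero =>
    rw [Finset.sum_range_one]
    rcases Nat.eq_zero_or_pos q with rfl | h
    · simp
    · simp [h, show ¬ q = 0 by omega, show min 1 q = 1 by omega]
  | succ e ih =>
    rw [Finset.sum_range_succ, ih]
    rcases lt_trichotomy (e + 1) q with h | h | h
    · rw [if_pos h, if_neg (show ¬ q ≤ e by omega), if_neg (show ¬ q + 1 ≤ e by omega),
        if_neg (show ¬ q ≤ e + 1 by omega), if_neg (show ¬ q + 1 ≤ e + 1 by omega),
        min_eq_left (show e + 1 ≤ q by omega), min_eq_left (show e + 1 + 1 ≤ q by omega)]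
      push_cast; ring
    · rw [if_neg (show ¬ e + 1 < q by omega), if_pos h, if_neg (show ¬ q ≤ e by omega),
        if_neg (show ¬ q + 1 ≤ e by omega), if_pos (show q ≤ e + 1 by omega),
        if_neg (show ¬ q + 1 ≤ e + 1 by omega), min_eq_left (show e + 1 ≤ q by omega),
        min_eq_right (show q ≤ e + 1 + 1 by omega), h]
      ring
    · rw [if_neg (show ¬ e + 1 < q by omega), if_neg (show ¬ e + 1 = q by omega),
        if_pos (show q ≤ e by omega), if_pos (show q ≤ e + 1 by omega),
        if_pos (show q + 1 ≤ e + 1 by omega), min_eq_right (show q ≤ e + 1 by omega),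
        min_eq_right (show q ≤ e + 1 + 1 by omega)]
      by_cases h' : e + 1 = q + 1
      · rw [if_pos h', if_neg (show ¬ q + 1 ≤ e by omega)]; ring
      · rw [if_neg h', if_pos (show q + 1 ≤ e by omega)]; ring

/-- The exact number of pairs in the tall part, where the copies of `C_n` are `H_n` apart. -/
lemma tallPairCount_eq (n q r : ℕ) (hr : r < v.bigH n) :
    v.tallPairCount n (q * v.bigH n + r) =
      (v.hat n : ℝ) ^ 2 * ((min q (v.tallCount n) : ℕ) * v.tallCount n -
        ((min q (v.tallCount n) : ℕ) : ℝ) ^ 2 / 2) +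
      (v.tallCount n - q : ℕ) * (v.diffCount n r - (v.hat n : ℝ) ^ 2 / 2) +
      (v.tallCount n - q - 1 : ℕ) * v.diffCount n (r - v.bigH n) +
      v.tallCount n * v.hat n / 2 := by
  have h1 : v.tallPairCount n (q * v.bigH n + r) = ∑ e ∈ Finset.range (v.tallCount n),
      ((min (e + 1) q : ℕ) * (v.hat n : ℝ) ^ 2 + (if q ≤ e then v.diffCount n r else 0) +
        (if q + 1 ≤ e then v.diffCount n (r - v.bigH n) else 0) - v.diffCount n 0) := by
    rw [← Finset.sum_range_reflect]
    refine Finset.sum_congr rfl fun c hc => ?_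
    rw [sum_blockCount_tall (Finset.mem_range.1 hc), hv.sum_diffCount_range n q r _ hr]
  rw [h1, hv.diffCount_zero]
  clear h1
  induction v.tallCount n with
  | zero => simp
  | succ K ih =>
    rw [Finset.sum_range_succ, ih]
    rcases lt_trichotomy K q with h | h | h
    · rw [if_neg (show ¬ q ≤ K by omega), if_neg (show ¬ q + 1 ≤ K by omega),
        min_eq_right (show K ≤ q by omega), min_eq_right (show K + 1 ≤ q by omega),
        min_eq_left (show K + 1 ≤ q by omega), show K - q = 0 by omega,
        show K + 1 - q = 0 by omega]
      push_cast; ring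
    · subst h
      rw [if_pos le_rfl, if_neg (show ¬ K + 1 ≤ K by omega), min_self,
        min_eq_left (show K ≤ K + 1 by omega), min_eq_right (show K ≤ K + 1 by omega),
        Nat.sub_self, show K + 1 - K = 1 by omega]
      push_cast; ring
    · obtain ⟨d, rfl⟩ := Nat.exists_eq_add_of_lt h
      rw [if_pos (show q ≤ q + d + 1 by omega), if_pos (show q + 1 ≤ q + d + 1 by omega),
        min_eq_left (show q ≤ q + d + 1 by omega), min_eq_left (show q ≤ q + d + 1 + 1 by omega),
        min_eq_right (show q ≤ q + d + 1 + 1 by omega), show q + d + 1 - q = d + 1 by omega,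
        show q + d + 1 + 1 - q = d + 2 by omega, show d + 1 - 1 = d by omega,
        show d + 2 - 1 = d + 1 by omega]
      push_cast; ring

/-- The pairs within the tall part of a single copy, as part of all pairs. -/
lemma sum_tall_le_sum_basePos (n : ℕ) (f : ℕ → ℕ → ℝ) (hf : ∀ p p', 0 ≤ f p p') :
    ∑ c ∈ Finset.range (v.tallCount n), ∑ c' ∈ Finset.range (v.tallCount n),
      ∑ s ∈ v.basePos n, ∑ s' ∈ v.basePos n, f (c * v.bigH n + s) (c' * v.bigH n + s') ≤
    ∑ p ∈ v.basePos (n + 1), ∑ p' ∈ v.basePos (n + 1), f p p' := by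
  have hsub : Finset.range (v.tallCount n) ⊆ Finset.range (v.copies n) :=
    Finset.range_subset_range.2 (by rw [hv.copies_eq]; omega)
  rw [hv.sum_basePos_succ]
  simp only [hv.sum_basePos_succ n]
  calc _ = ∑ c ∈ Finset.range (v.tallCount n), ∑ s ∈ v.basePos n,
        ∑ c' ∈ Finset.range (v.tallCount n),
          ∑ s' ∈ v.basePos n, f (v.start n c + s) (v.start n c' + s') := by
        refine Finset.sum_congr rfl fun c hc => ?_
        rw [Finset.sum_comm]
        refine Finset.sum_congr rfl fun s _ => Finset.sum_congr rfl fun c' hc' => ?_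
        rw [start_of_le (Finset.mem_range.1 hc).le, start_of_le (Finset.mem_range.1 hc').le]
    _ ≤ ∑ c ∈ Finset.range (v.tallCount n), ∑ s ∈ v.basePos n,
        ∑ c' ∈ Finset.range (v.copies n),
          ∑ s' ∈ v.basePos n, f (v.start n c + s) (v.start n c' + s') := by
        gcongr with c _ s _
        exact fun c' _ _ => Finset.sum_nonneg fun _ _ => hf _ _
    _ ≤ _ := Finset.sum_le_sum_of_subset_of_nonneg hsub fun c _ _ =>
          Finset.sum_nonneg fun _ _ => Finset.sum_nonneg fun _ _ =>
            Finset.sum_nonneg fun _ _ => hf _ _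

/-- Within the tall part, a level sees few copies of `C_n` in time `t`, since these are `H_n`
apart. -/
lemma sum_window_tall_le {n q r c s : ℕ} (hr : r < v.bigH n) (hs : s ∈ v.basePos n) :
    ∑ c' ∈ Finset.range (v.tallCount n), ∑ s' ∈ v.basePos n,
      window (q * v.bigH n + r) (c * v.bigH n + s) (c' * v.bigH n + s') ≤
        2 * ((min q (v.copies n) : ℕ) + 1) * v.hat n := by
  have hsH := (lt_height_of_mem hs).trans_le (height_le_bigH n)
  have h1 : ∀ c' ∈ Finset.range (v.tallCount n), ∑ s' ∈ v.basePos n,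
      window (q * v.bigH n + r) (c * v.bigH n + s) (c' * v.bigH n + s') ≤
        if c' ∈ Finset.Ico c (c + (q + 2)) then (v.hat n : ℝ) else 0 := by
    intro c' _
    split_ifs with h
    · calc _ ≤ ∑ s' ∈ v.basePos n, (1 : ℝ) := Finset.sum_le_sum fun _ _ => window_le_one _ _ _
        _ = _ := by simp [hv.card_basePos]
    · refine (Finset.sum_eq_zero fun s' hs' => ?_).le
      have hs'H := (lt_height_of_mem hs').trans_le (height_le_bigH n)
      unfold window
      refine if_neg fun ⟨h2, h3⟩ => h (Finset.mem_Ico.2 ⟨?_, ?_⟩)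
      · by_contra hlt
        have : (c' + 1) * v.bigH n ≤ c * v.bigH n := Nat.mul_le_mul_right _ (by omega)
        rw [add_mul] at this; omega
      · by_contra hlt
        have : (c + (q + 2)) * v.bigH n ≤ c' * v.bigH n := Nat.mul_le_mul_right _ (by omega)
        rw [add_mul, add_mul] at this; omega
  refine (Finset.sum_le_sum h1).trans ?_
  rw [← Finset.sum_filter, Finset.sum_const, nsmul_eq_mul]
  gcongr
  set S := (Finset.range (v.tallCount n)).filter (· ∈ Finset.Ico c (c + (q + 2)))
  have c1 : S.card ≤ v.tallCount n :=
    (Finset.card_filter_le _ _).trans (Finset.card_range _).le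
  have c2 : S.card ≤ q + 2 := by
    refine (Finset.card_le_card (t := Finset.Ico c (c + (q + 2))) fun a ha =>
      (Finset.mem_filter.1 ha).2).trans ?_
    simp
  have : S.card ≤ 2 * (min q (v.copies n) + 1) := by
    have := hv.copies_eq n; omega
  exact_mod_cast this

/-- The same bound for the pairs with a given second level. -/
lemma sum_window_tall_le' {n q r c' s' : ℕ} (hr : r < v.bigH n) (hs' : s' ∈ v.basePos n) :
    ∑ c ∈ Finset.range (v.tallCount n), ∑ s ∈ v.basePos n,
      window (q * v.bigH n + r) (c * v.bigH n + s) (c' * v.bigH n + s') ≤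
        2 * ((min q (v.copies n) : ℕ) + 1) * v.hat n := by
  have hsH' := (lt_height_of_mem hs').trans_le (height_le_bigH n)
  have h1 : ∀ c ∈ Finset.range (v.tallCount n), ∑ s ∈ v.basePos n,
      window (q * v.bigH n + r) (c * v.bigH n + s) (c' * v.bigH n + s') ≤
        if c ∈ Finset.Icc (c' - (q + 1)) c' then (v.hat n : ℝ) else 0 := by
    intro c _
    split_ifs with h
    · calc _ ≤ ∑ s ∈ v.basePos n, (1 : ℝ) := Finset.sum_le_sum fun _ _ => window_le_one _ _ _
        _ = _ := by simp [hv.card_basePos]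
    · refine (Finset.sum_eq_zero fun s hs => ?_).le
      have hsH := (lt_height_of_mem hs).trans_le (height_le_bigH n)
      unfold window
      refine if_neg fun ⟨h2, h3⟩ => h (Finset.mem_Icc.2 ⟨?_, ?_⟩)
      · by_contra hlt
        have : (c + (q + 2)) * v.bigH n ≤ c' * v.bigH n := Nat.mul_le_mul_right _ (by omega)
        rw [add_mul, add_mul] at this; omega
      · by_contra hlt
        have : (c' + 1) * v.bigH n ≤ c * v.bigH n := Nat.mul_le_mul_right _ (by omega)
        rw [add_mul] at this; omega
  refine (Finset.sum_le_sum h1).trans ?_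
  rw [← Finset.sum_filter, Finset.sum_const, nsmul_eq_mul]
  gcongr
  set S := (Finset.range (v.tallCount n)).filter (· ∈ Finset.Icc (c' - (q + 1)) c')
  have c1 : S.card ≤ v.tallCount n :=
    (Finset.card_filter_le _ _).trans (Finset.card_range _).le
  have c2 : S.card ≤ q + 2 := by
    refine (Finset.card_le_card (t := Finset.Icc (c' - (q + 1)) c') fun a ha =>
      (Finset.mem_filter.1 ha).2).trans ?_
    simp; omega
  have : S.card ≤ 2 * (min q (v.copies n) + 1) := by
    have := hv.copies_eq n; omega
  exact_mod_cast this

/-- The pairs that do not lie in the tall part of `C_{n+1}` are those with the second level in a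
low copy of `C_n`. -/
lemma pairCount_succ_eq_add (n t : ℕ) :
    v.pairCount (n + 1) t = v.tallPairCount n t +
      ∑ j ∈ Finset.range (v.m n), ∑ c ∈ Finset.range (v.tallCount n),
        v.blockCount n t (v.start n c) (v.start n (v.tallCount n + j)) +
      ∑ i ∈ Finset.range (v.m n), ∑ j ∈ Finset.range (v.m n),
        v.blockCount n t (v.start n (v.tallCount n + i)) (v.start n (v.tallCount n + j)) := by
  rw [hv.pairCount_succ, hv.copies_eq, Finset.sum_range_add]
  simp only [Finset.sum_range_add, Finset.sum_add_distrib]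
  have h0 : ∑ i ∈ Finset.range (v.m n), ∑ c ∈ Finset.range (v.tallCount n),
      v.blockCount n t (v.start n (v.tallCount n + i)) (v.start n c) = 0 :=
    Finset.sum_eq_zero fun i _ => Finset.sum_eq_zero fun c hc => blockCount_eq_zero
      (start_add_height_le_of_lt ((Finset.mem_range.1 hc).trans_le (Nat.le_add_right _ _)))
  have h1 : ∑ c ∈ Finset.range (v.tallCount n), ∑ c' ∈ Finset.range (v.tallCount n),
      v.blockCount n t (v.start n c) (v.start n c') = v.tallPairCount n t :=
    Finset.sum_congr rfl fun c hc => Finset.sum_congr rfl fun c' hc' => by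
      rw [start_of_le (Finset.mem_range.1 hc).le, start_of_le (Finset.mem_range.1 hc').le]
  rw [h0, h1, Finset.sum_comm (s := Finset.range (v.tallCount n))]
  ring

/-- Only the last `q + 1` tall copies see the low ones. -/
lemma sum_tall_low_le {n q r : ℕ} (hr : r < v.bigH n) :
    ∑ j ∈ Finset.range (v.m n), ∑ c ∈ Finset.range (v.tallCount n),
      v.blockCount n (q * v.bigH n + r) (v.start n c) (v.start n (v.tallCount n + j)) ≤
        v.m n * ((min q (v.copies n) : ℕ) + 1) * (v.hat n : ℝ) ^ 2 := by
  have hH := height_le_bigH (v := v) n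
  have h1 : ∀ j, ∑ c ∈ Finset.range (v.tallCount n),
      v.blockCount n (q * v.bigH n + r) (v.start n c) (v.start n (v.tallCount n + j)) ≤
        ((min q (v.copies n) : ℕ) + 1) * (v.hat n : ℝ) ^ 2 := by
    intro j
    have h2 : ∀ c ∈ Finset.range (v.tallCount n),
        v.blockCount n (q * v.bigH n + r) (v.start n c) (v.start n (v.tallCount n + j)) ≤
          if c ∈ Finset.Ico (v.tallCount n - (q + 1)) (v.tallCount n)
            then (v.hat n : ℝ) ^ 2 else 0 := by
      intro c hc
      split_ifs with h
      · exact hv.blockCount_le _ _ _ _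
      · refine (hv.blockCount_eq_zero_of_far ?_).le
        rw [Finset.mem_range] at hc
        rw [Finset.mem_Ico] at h
        have : (c + (q + 2)) * v.bigH n ≤ v.tallCount n * v.bigH n :=
          Nat.mul_le_mul_right _ (by omega)
        rw [add_mul, add_mul] at this
        rw [start_of_le hc.le, start_tall_add]
        omega
    refine (Finset.sum_le_sum h2).trans ?_
    rw [← Finset.sum_filter, Finset.sum_const, nsmul_eq_mul]
    gcongr
    set S := (Finset.range (v.tallCount n)).filter
      (· ∈ Finset.Ico (v.tallCount n - (q + 1)) (v.tallCount n))
    have c1 : S.card ≤ v.tallCount n :=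
      (Finset.card_filter_le _ _).trans (Finset.card_range _).le
    have c2 : S.card ≤ q + 1 := by
      refine (Finset.card_le_card (t := Finset.Ico (v.tallCount n - (q + 1)) (v.tallCount n))
        fun a ha => (Finset.mem_filter.1 ha).2).trans ?_
      simp; omega
    have : S.card ≤ min q (v.copies n) + 1 := by
      have := hv.copies_eq n; omega
    exact_mod_cast this
  calc _ ≤ ∑ j ∈ Finset.range (v.m n), ((min q (v.copies n) : ℕ) + 1) * (v.hat n : ℝ) ^ 2 :=
        Finset.sum_le_sum fun j _ => h1 j
    _ = _ := by simp; ring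

/-- Here `b` bounds the ratio `H_n / h_n`. -/
lemma sum_low_low_le {n q r b : ℕ} (hr : r < v.bigH n) (hb : v.bigH n ≤ b * v.height n) :
    ∑ i ∈ Finset.range (v.m n), ∑ j ∈ Finset.range (v.m n),
      v.blockCount n (q * v.bigH n + r) (v.start n (v.tallCount n + i))
        (v.start n (v.tallCount n + j)) ≤
        v.m n * ((b + 1) * ((min q (v.copies n) : ℕ) + 1)) * (v.hat n : ℝ) ^ 2 := by
  have h1 : ∀ i, ∑ j ∈ Finset.range (v.m n),
      v.blockCount n (q * v.bigH n + r) (v.start n (v.tallCount n + i))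
        (v.start n (v.tallCount n + j)) ≤
        ((b + 1) * ((min q (v.copies n) : ℕ) + 1)) * (v.hat n : ℝ) ^ 2 := by
    intro i
    have h2 : ∀ j ∈ Finset.range (v.m n),
        v.blockCount n (q * v.bigH n + r) (v.start n (v.tallCount n + i))
          (v.start n (v.tallCount n + j)) ≤
          if j ∈ Finset.Ico i (i + (b + 1) * (q + 1)) then (v.hat n : ℝ) ^ 2 else 0 := by
      intro j hj
      split_ifs with h
      · exact hv.blockCount_le _ _ _ _
      · rw [Finset.mem_Ico] at h
        rcases lt_or_ge j i with hji | hji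
        · exact (blockCount_eq_zero (start_add_height_le_of_lt (by omega))).le
        refine (hv.blockCount_eq_zero_of_far ?_).le
        have e1 : (i + (b + 1) * (q + 1)) * v.height n ≤ j * v.height n :=
          Nat.mul_le_mul_right _ (by omega)
        have e2 : q * v.bigH n + r ≤ (q + 1) * (b * v.height n) := by
          calc q * v.bigH n + r ≤ (q + 1) * v.bigH n := by rw [add_mul]; omega
            _ ≤ _ := Nat.mul_le_mul_left _ hb
        have e3 : (i + (b + 1) * (q + 1)) * v.height n =
          i * v.height n + (q + 1) * (b * v.height n) + q * v.height n + v.height n := by ring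
        have e4 : 0 ≤ q * v.height n := Nat.zero_le _
        rw [start_tall_add, start_tall_add]
        omega
    refine (Finset.sum_le_sum h2).trans ?_
    rw [← Finset.sum_filter, Finset.sum_const, nsmul_eq_mul]
    gcongr
    set S := (Finset.range (v.m n)).filter (· ∈ Finset.Ico i (i + (b + 1) * (q + 1)))
    have c1 : S.card ≤ v.m n :=
      (Finset.card_filter_le _ _).trans (Finset.card_range _).le
    have c2 : S.card ≤ (b + 1) * (q + 1) := by
      refine (Finset.card_le_card (t := Finset.Ico i (i + (b + 1) * (q + 1)))
        fun a ha => (Finset.mem_filter.1 ha).2).trans ?_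
      simp
    have : S.card ≤ (b + 1) * (min q (v.copies n) + 1) := by
      rcases le_total q (v.copies n) with h | h
      · rwa [min_eq_left h]
      · rw [min_eq_right h]
        have := hv.copies_eq n
        calc S.card ≤ 1 * (v.copies n + 1) := by omega
          _ ≤ _ := Nat.mul_le_mul_right _ (by omega)
    exact_mod_cast this
  calc _ ≤ ∑ j ∈ Finset.range (v.m n),
        ((b + 1) * ((min q (v.copies n) : ℕ) + 1)) * (v.hat n : ℝ) ^ 2 :=
        Finset.sum_le_sum fun j _ => h1 j
    _ = _ := by simp; ring

lemma tallPairCount_le_pairCount (n t : ℕ) : v.tallPairCount n t ≤ v.pairCount (n + 1) t := by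
  rw [hv.pairCount_succ_eq_add, add_assoc]
  refine le_add_of_nonneg_right (add_nonneg ?_ ?_) <;>
  exact Finset.sum_nonneg fun _ _ => Finset.sum_nonneg fun _ _ => blockCount_nonneg _ _ _ _

lemma pairCount_succ_le {n q r b : ℕ} (hr : r < v.bigH n) (hb : v.bigH n ≤ b * v.height n) :
    v.pairCount (n + 1) (q * v.bigH n + r) ≤ v.tallPairCount n (q * v.bigH n + r) +
      v.m n * ((b + 2) * ((min q (v.copies n) : ℕ) + 1)) * (v.hat n : ℝ) ^ 2 := by
  rw [hv.pairCount_succ_eq_add]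
  have h1 := hv.sum_tall_low_le (q := q) hr
  have h2 := hv.sum_low_low_le (q := q) hr hb
  linarith

/-- In time `t < h_n`, only consecutive low copies of `C_n` see each other, and only if
`h_n < 2 t`. -/
lemma pairCount_succ_le_of_lt {n t : ℕ} (hH : 2 * v.height n ≤ v.bigH n) (ht : t < v.height n) :
    v.pairCount (n + 1) t ≤ v.copies n * v.pairCount n t +
      if v.height n < 2 * t then v.m n * (v.hat n : ℝ) ^ 2 else 0 := by
  rw [hv.pairCount_succ]
  have h1 : ∀ c ∈ Finset.range (v.copies n), ∑ c' ∈ Finset.range (v.copies n),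
      v.blockCount n t (v.start n c) (v.start n c') ≤ v.pairCount n t +
        if v.tallCount n ≤ c ∧ v.height n < 2 * t then (v.hat n : ℝ) ^ 2 else 0 := by
    intro c hc
    have h2 : ∀ c' ∈ Finset.range (v.copies n), v.blockCount n t (v.start n c) (v.start n c') ≤
        (if c' = c then v.pairCount n t else 0) + if c' = c + 1 then
          (if v.tallCount n ≤ c ∧ v.height n < 2 * t then (v.hat n : ℝ) ^ 2 else 0) else 0 := by
      intro c' _
      rcases lt_trichotomy c' c with h | h | h
      · rw [blockCount_eq_zero (start_add_height_le_of_lt h), if_neg (by omega),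
          if_neg (by omega), add_zero]
      · rw [h, blockCount_self, if_pos rfl, if_neg (by omega), add_zero]
      · rw [if_neg (by omega), zero_add]
        split_ifs with h3 h4
        · exact hv.blockCount_le _ _ _ _
        · refine (hv.blockCount_eq_zero_of_far ?_).le
          have e := start_add_height_le_of_lt (v := v) (n := n) h
          by_cases hcK : c < v.tallCount n
          · have := start_add_bigH_le_of_lt (v := v) hcK h; omega
          · omega
        · refine (hv.blockCount_eq_zero_of_far ?_).le
          have e := start_add_height_le_of_lt (v := v) (n := n) (Nat.lt_succ_self c)
          have e' := start_add_height_le_of_lt (v := v) (n := n) (show c + 1 < c' by omega)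
          simp only [Nat.succ_eq_add_one] at e
          omega
    refine (Finset.sum_le_sum h2).trans ?_
    rw [Finset.sum_add_distrib, Finset.sum_ite_eq', if_pos hc, Finset.sum_ite_eq']
    gcongr
    split_ifs <;> first | positivity | rfl
  refine (Finset.sum_le_sum h1).trans ?_
  rw [Finset.sum_add_distrib, Finset.sum_const, Finset.card_range, nsmul_eq_mul]
  gcongr
  rw [hv.copies_eq, Finset.sum_range_add]
  rw [Finset.sum_eq_zero fun c hc => if_neg fun h => by
    have := Finset.mem_range.1 hc; omega, zero_add]
  simp only [Nat.le_add_right, true_and]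
  split_ifs <;> simp

end Nondegenerate

/-! ### Comparing the number of pairs with the normalizing sequence -/

/-- The construction with `k_n = n + 1` and `ℓ_n = L_n h_n`, for a sequence `L` of positive
integers (from `L_1` on) with `L_n = o(n)`. -/
structure HasSpacerRatio (v : Params) (L : ℕ → ℕ) : Prop where
  k_eq : ∀ n, v.k n = n + 1
  l_eq : ∀ n, v.l n = L n * v.height n
  m_pos : ∀ n, 1 ≤ v.m n
  one_le : ∀ n, 1 ≤ n → 1 ≤ L n
  tendsto_div : Tendsto (fun n : ℕ => (L n : ℝ) / (n + 1)) atTop (𝓝 0)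

/-- A bound, up to constants, for the relative error made by `g_n`. -/
def relErr (v : Params) (L : ℕ → ℕ) (n : ℕ) : ℝ := (L n + 8) / (n + 1) + 1 / v.hat n

/-- The order of magnitude `ĥ_n (min (q, k_n m_n) + 1)` of the number of visits to `I_0` in a
time between `q H_n` and `(q + 1) H_n`. -/
def scale (v : Params) (n q : ℕ) : ℝ := v.hat n * ((min q (v.copies n) : ℕ) + 1)

variable {L : ℕ → ℕ}

lemma scale_nonneg (n q : ℕ) : 0 ≤ v.scale n q := by unfold scale; positivity

lemma relErr_nonneg (n : ℕ) : 0 ≤ v.relErr L n := by unfold relErr; positivity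

lemma Nondegenerate.pairCount_add_one_le (hv : v.Nondegenerate) (n t : ℕ) :
    v.pairCount n (t + 1) ≤ v.pairCount n t + v.hat n := by
  have h : ∀ p ∈ v.basePos n, ∑ p' ∈ v.basePos n, window (t + 1) p p' ≤
      ∑ p' ∈ v.basePos n, window t p p' + 1 := by
    intro p _
    calc _ ≤ ∑ p' ∈ v.basePos n, (window t p p' + if p' = p + t then 1 else 0) :=
          Finset.sum_le_sum fun p' _ => by
            unfold window; split_ifs <;> first | omega | norm_num
      _ ≤ _ := by
        rw [Finset.sum_add_distrib, Finset.sum_ite_eq']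
        gcongr; split_ifs <;> norm_num
  refine (Finset.sum_le_sum h).trans ?_
  rw [Finset.sum_add_distrib, pairCount]
  simp [hv.card_basePos]

lemma pairCount_mono (n : ℕ) : Monotone (v.pairCount n) := fun t t' h =>
  Finset.sum_le_sum fun p _ => Finset.sum_le_sum fun p' _ => by
    unfold window; split_ifs <;> first | omega | norm_num

/-- The error made in the number of pairs when the `K = N - m` tall copies of `C_n` are replaced
by all `N = k m` copies. Here `g = ĥ_n`, while `d`, `x` and `y` stand for `min (q, K)`,
`max (K - q, 0)` and `max (K - q - 1, 0)`, and `c` stands for `min (q, N)`. -/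
lemma abs_tall_sub_le {g N m K k c d x y W U : ℝ} (hg : 0 < g) (hm : 1 ≤ m) (hk : 0 < k)
    (hK : 0 ≤ K) (hN : N = k * m) (hKN : N = K + m) (hc : 0 ≤ c)
    (hcd : (c = d ∧ d ≤ K) ∨ (d = K ∧ K ≤ c ∧ c ≤ N)) (hx : x ≤ N) (hx' : N ≤ x + c + m)
    (hy : y ≤ N) (hy' : N ≤ y + c + m + 1) (hW : 0 ≤ W) (hW' : W ≤ g ^ 2) (hU : 0 ≤ U)
    (hU' : U ≤ g ^ 2) :
    |(g ^ 2 * (d * K - d ^ 2 / 2) + x * (W - g ^ 2 / 2) + y * U + K * g / 2) / (g * N) -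
      (g * c * (1 - c / (2 * N)) + (W - g ^ 2 / 2 + U) / g)| ≤
      g * (c + 1) * (4 / k + 1 / g) := by
  have hNpos : 0 < N := by linarith
  -- the loss in the main term, for a density `1 / k` of low copies
  have e1 : 0 ≤ c * N - c ^ 2 / 2 - (d * K - d ^ 2 / 2) ∧
      c * N - c ^ 2 / 2 - (d * K - d ^ 2 / 2) ≤ m * c := by
    rcases hcd with ⟨rfl, h⟩ | ⟨rfl, h1, h2⟩
    · rw [hKN]; constructor <;> nlinarith
    · obtain ⟨e, rfl⟩ : ∃ e, c = d + e := ⟨c - d, by ring⟩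
      rw [hKN] at h2 ⊢
      constructor <;> nlinarith
  obtain ⟨P, hP⟩ : ∃ P, P = g ^ 2 * (c * N - c ^ 2 / 2 - (d * K - d ^ 2 / 2)) := ⟨_, rfl⟩
  obtain ⟨Q, hQ⟩ : ∃ Q, Q = (N - x) * (W - g ^ 2 / 2) := ⟨_, rfl⟩
  obtain ⟨R, hR⟩ : ∃ R, R = (N - y) * U := ⟨_, rfl⟩
  have e2 : (g ^ 2 * (d * K - d ^ 2 / 2) + x * (W - g ^ 2 / 2) + y * U + K * g / 2) /
      (g * N) - (g * c * (1 - c / (2 * N)) + (W - g ^ 2 / 2 + U) / g) =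
      (-P - Q - R + K * g / 2) / (g * N) := by
    rw [hP, hQ, hR]; field_simp; ring
  have e3 : g * (c + 1) * (4 / k + 1 / g) =
      (4 * (c + 1) * m * g ^ 2 + (c + 1) * N * g) / (g * N) := by
    rw [hN]; field_simp
  rw [e2, e3, abs_div, abs_of_pos (mul_pos hg hNpos)]
  gcongr
  have b1 : 0 ≤ P := hP ▸ mul_nonneg (by positivity) e1.1
  have b2 : P ≤ g ^ 2 * (m * c) := hP ▸ mul_le_mul_of_nonneg_left e1.2 (by positivity)
  have b3 : |Q| ≤ (c + m) * (g ^ 2 / 2) := by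
    rw [hQ, abs_mul, abs_of_nonneg (by linarith)]
    gcongr
    · linarith
    · rw [abs_le]; constructor <;> linarith
  have b4 : R ≤ (c + m + 1) * g ^ 2 := by
    rw [hR]
    gcongr
    linarith
  have b4' : 0 ≤ R := hR ▸ mul_nonneg (by linarith) hU
  have b5 : 0 ≤ K * g / 2 := by positivity
  have b6 : K * g / 2 ≤ (c + 1) * N * g := by
    have h1 : K * g ≤ N * g := by gcongr; linarith
    have h2 : N * g ≤ (c + 1) * (N * g) := le_mul_of_one_le_left (by positivity) (by linarith)
    linarith
  have b7 : g ^ 2 * (m * c) + (c + m) * (g ^ 2 / 2) + (c + m + 1) * g ^ 2 ≤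
      4 * (c + 1) * m * g ^ 2 := by
    have h1 : c ≤ c * m := le_mul_of_one_le_right hc hm
    have : m * c + (c + m) / 2 + (c + m + 1) ≤ 4 * (c + 1) * m := by linarith
    calc _ = (m * c + (c + m) / 2 + (c + m + 1)) * g ^ 2 := by ring
      _ ≤ _ := by gcongr
  have b7' : 0 ≤ 4 * (c + 1) * m * g ^ 2 := by positivity
  generalize 4 * (c + 1) * m * g ^ 2 = Y1 at *
  generalize (c + 1) * N * g = Y2 at *
  generalize g ^ 2 * (m * c) = Y3 at *
  generalize (c + m) * (g ^ 2 / 2) = Y4 at *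
  generalize (c + m + 1) * g ^ 2 = Y5 at *
  generalize K * g / 2 = Y6 at *
  rw [abs_le] at b3
  rw [abs_le]
  constructor <;> linarith [b3.1, b3.2]

namespace HasSpacerRatio

variable (hL : v.HasSpacerRatio L)
include hL

lemma nondegenerate : v.Nondegenerate :=
  ⟨fun n => by rw [hL.k_eq]; omega, hL.m_pos, fun n hn => by rw [hL.k_eq]; omega⟩

lemma bigH_eq (n : ℕ) : v.bigH n = (L n + 1) * v.height n := by
  rw [bigH, hL.l_eq]; ring

lemma two_mul_height_le_bigH {n : ℕ} (hn : 1 ≤ n) : 2 * v.height n ≤ v.bigH n := by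
  rw [hL.bigH_eq]
  exact Nat.mul_le_mul_right _ (by have := hL.one_le n hn; omega)

lemma copies_eq_mul (n : ℕ) : (v.copies n : ℝ) = (n + 1) * v.m n := by
  rw [copies, hL.k_eq]; push_cast; ring

lemma tendsto_relErr : Tendsto (v.relErr L) atTop (𝓝 0) := by
  have h1 : Tendsto (fun n : ℕ => (8 : ℝ) / (n + 1)) atTop (𝓝 0) := by
    have := (tendsto_one_div_add_atTop_nhds_zero_nat (𝕜 := ℝ)).const_mul 8
    simpa only [mul_one_div, mul_zero] using this
  have h2 : Tendsto (fun n : ℕ => (1 : ℝ) / v.hat n) atTop (𝓝 0) := by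
    have := tendsto_inv_atTop_zero.comp
      ((tendsto_natCast_atTop_atTop (R := ℝ)).comp hL.nondegenerate.tendsto_hat)
    simpa [Function.comp_def] using this
  have := (hL.tendsto_div.add h1).add h2
  simp only [add_zero] at this
  refine this.congr fun n => ?_
  simp only [relErr, add_div]

omit hL in
lemma profile_eq (hv : v.Nondegenerate) (n q : ℕ) :
    v.profile n q = v.hat n * (min q (v.copies n) : ℕ) *
      (1 - ((min q (v.copies n) : ℕ) : ℝ) / (2 * (v.copies n : ℝ))) := by
  rw [profile, hv.hatHeight_eq]

/-- The term `(W - ĥ_n² / 2 + W') / ĥ_n`, with the numbers `W` and `W'` of pairs of levels at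
distances less than `r` and `r - H_n`, accounts for the pairs in copies of `C_n` that
are reached at the very end of a time interval of length `q H_n + r`. -/
lemma abs_tallPairCount_sub_le {n q r : ℕ} (hr : r < v.bigH n) :
    |v.tallPairCount n (q * v.bigH n + r) / v.hat (n + 1) - (v.profile n q +
      (v.diffCount n r - (v.hat n : ℝ) ^ 2 / 2 + v.diffCount n (r - v.bigH n)) / v.hat n)| ≤
      v.scale n q * (4 / (n + 1) + 1 / v.hat n) := by
  have hv := hL.nondegenerate
  have hh : (0 : ℝ) < v.hat n := by exact_mod_cast hv.hat_pos n
  have hKN := hv.copies_eq n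
  rw [hv.tallPairCount_eq n q r hr, profile_eq hv, hat_succ, scale, Nat.cast_mul]
  refine abs_tall_sub_le hh (by exact_mod_cast hL.m_pos n) (by positivity) (by positivity)
    (hL.copies_eq_mul n) (by exact_mod_cast hKN) (by positivity) ?_ ?_ ?_ ?_ ?_
    (diffCount_nonneg _ _) (hv.diffCount_le _ _) (diffCount_nonneg _ _) (hv.diffCount_le _ _)
  · rcases le_total q (v.tallCount n) with h | h
    · left
      rw [min_eq_left h, min_eq_left (by omega)]
      exact ⟨rfl, by exact_mod_cast h⟩
    · right
      rw [min_eq_right h]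
      exact ⟨rfl, Nat.cast_le.2 (le_min h (by omega)), Nat.cast_le.2 (min_le_right _ _)⟩
  · exact Nat.cast_le.2 (by omega)
  · have : v.copies n ≤ (v.tallCount n - q) + min q (v.copies n) + v.m n := by omega
    rw [← Nat.cast_add, ← Nat.cast_add]; exact Nat.cast_le.2 this
  · exact Nat.cast_le.2 (by omega)
  · have : v.copies n ≤ (v.tallCount n - q - 1) + min q (v.copies n) + v.m n + 1 := by omega
    rw [← Nat.cast_add, ← Nat.cast_add, ← Nat.cast_add_one]; exact Nat.cast_le.2 this

lemma abs_pairCount_succ_sub_le {n q r : ℕ} (hr : r < v.bigH n) :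
    |v.pairCount (n + 1) (q * v.bigH n + r) / v.hat (n + 1) - (v.profile n q +
      (v.diffCount n r - (v.hat n : ℝ) ^ 2 / 2 + v.diffCount n (r - v.bigH n)) / v.hat n)| ≤
      v.scale n q * ((L n + 7) / (n + 1) + 1 / v.hat n) := by
  have hv := hL.nondegenerate
  have hm : (0 : ℝ) < v.m n := by exact_mod_cast hL.m_pos n
  have hh : (0 : ℝ) < v.hat n := by exact_mod_cast hv.hat_pos n
  have h1 := hL.abs_tallPairCount_sub_le (q := q) hr
  have h2 : 0 ≤ (v.pairCount (n + 1) (q * v.bigH n + r) -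
      v.tallPairCount n (q * v.bigH n + r)) / v.hat (n + 1) :=
    div_nonneg (sub_nonneg.2 (hv.tallPairCount_le_pairCount n _)) (by positivity)
  have h3 : (v.pairCount (n + 1) (q * v.bigH n + r) -
      v.tallPairCount n (q * v.bigH n + r)) / v.hat (n + 1) ≤
        v.scale n q * ((L n + 3) / (n + 1)) := by
    have := hv.pairCount_succ_le (q := q) hr (hL.bigH_eq n).le
    rw [div_le_iff₀ (by exact_mod_cast hv.hat_pos (n + 1)), hat_succ, scale]
    rw [Nat.cast_mul, hL.copies_eq_mul]
    generalize ((min q (v.copies n) : ℕ) : ℝ) = c at *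
    calc _ ≤ v.m n * ((((L n + 1 : ℕ) : ℝ) + 2) * (c + 1)) * (v.hat n : ℝ) ^ 2 := by linarith
      _ = _ := by push_cast; field_simp; ring
  have h4 : v.scale n q * (((L n : ℝ) + 7) / (n + 1) + 1 / v.hat n) =
      v.scale n q * (4 / (n + 1) + 1 / v.hat n) + v.scale n q * ((L n + 3) / (n + 1)) := by
    ring
  rw [sub_div] at h2 h3
  rw [h4]
  rw [abs_le] at h1 ⊢
  constructor <;> linarith [h1.1, h1.2]

/-- Within one column, `g_n` counts the pairs up to a small multiple of their total number. -/
lemma abs_pairCount_succ_sub_profile_le (n t : ℕ) :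
    |v.pairCount (n + 1) t / v.hat (n + 1) - v.profile n (t / v.bigH n)| ≤
      2 * v.hat (n + 1) * v.relErr L n := by
  have hv := hL.nondegenerate
  have hh : (0 : ℝ) < v.hat n := by exact_mod_cast hv.hat_pos n
  have hm : (1 : ℝ) ≤ v.m n := by exact_mod_cast hL.m_pos n
  have hN : (1 : ℝ) ≤ v.copies n := by exact_mod_cast hv.copies_pos n
  have hN' := hL.copies_eq_mul n
  have h1 := hL.abs_pairCount_succ_sub_le (q := t / v.bigH n) (Nat.mod_lt t (hv.bigH_pos n))
  rw [Nat.div_add_mod'] at h1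
  set q := t / v.bigH n
  have h2 : v.scale n q ≤ 2 * v.hat (n + 1) := by
    rw [scale, hat_succ]
    have : ((min q (v.copies n) : ℕ) : ℝ) ≤ v.copies n := by exact_mod_cast min_le_right _ _
    rw [Nat.cast_mul]
    generalize ((min q (v.copies n) : ℕ) : ℝ) = c at *
    nlinarith
  have hW1 := diffCount_nonneg (v := v) n (t % v.bigH n : ℕ)
  have hW2 := hv.diffCount_le n (t % v.bigH n : ℕ)
  have hU1 := diffCount_nonneg (v := v) n ((t % v.bigH n : ℕ) - v.bigH n)
  have hU2 := hv.diffCount_le n ((t % v.bigH n : ℕ) - v.bigH n)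
  set W := v.diffCount n (t % v.bigH n : ℕ)
  set U := v.diffCount n ((t % v.bigH n : ℕ) - v.bigH n)
  have h3 : |(W - (v.hat n : ℝ) ^ 2 / 2 + U) / v.hat n| ≤
      2 * (v.hat (n + 1) : ℝ) * (1 / (n + 1)) := by
    have : |W - (v.hat n : ℝ) ^ 2 / 2 + U| ≤ 2 * (v.hat n : ℝ) ^ 2 := by
      rw [abs_le]; constructor <;> nlinarith
    rw [abs_div, abs_of_pos hh, div_le_iff₀ hh]
    refine this.trans ?_
    rw [hat_succ]; push_cast; rw [hN']
    have : 2 * ((v.hat n : ℝ) * ((n + 1) * v.m n)) * (1 / (n + 1)) * v.hat n =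
      2 * (v.hat n : ℝ) ^ 2 * v.m n := by field_simp
    rw [this]
    exact le_mul_of_one_le_right (by positivity) hm
  have h4 : v.scale n q * (((L n : ℝ) + 7) / (n + 1) + 1 / v.hat n) ≤
      2 * v.hat (n + 1) * (((L n : ℝ) + 7) / (n + 1) + 1 / v.hat n) := by gcongr
  have h5 : 2 * (v.hat (n + 1) : ℝ) * v.relErr L n =
      2 * v.hat (n + 1) * (((L n : ℝ) + 7) / (n + 1) + 1 / v.hat n) +
        2 * v.hat (n + 1) * (1 / (n + 1)) := by rw [relErr]; ring
  rw [h5]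
  rw [abs_le] at h1 h3 ⊢
  constructor <;> linarith [h1.1, h1.2, h3.1, h3.2]

omit hL in
lemma profile_nonneg (hv : v.Nondegenerate) (n q : ℕ) : 0 ≤ v.profile n q := by
  have hN : (0 : ℝ) < v.copies n := by exact_mod_cast hv.copies_pos n
  have : ((min q (v.copies n) : ℕ) : ℝ) ≤ v.copies n := by exact_mod_cast min_le_right _ _
  rw [profile_eq hv]
  refine mul_nonneg (by positivity) (sub_nonneg.2 ?_)
  rw [div_le_one (by positivity)]; linarith

omit hL in
lemma profile_le (hv : v.Nondegenerate) (n q : ℕ) : v.profile n q ≤ v.hat (n + 1) / 2 := by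
  have hN : (0 : ℝ) < v.copies n := by exact_mod_cast hv.copies_pos n
  rw [profile_eq hv, hat_succ]
  set c : ℝ := ((min q (v.copies n) : ℕ) : ℝ)
  push_cast
  have : c * (1 - c / (2 * v.copies n)) ≤ v.copies n / 2 := by
    rw [← sub_nonneg]
    have : (v.copies n : ℝ) / 2 - c * (1 - c / (2 * v.copies n)) =
      (v.copies n - c) ^ 2 / (2 * v.copies n) := by field_simp; ring
    rw [this]; positivity
  calc _ = v.hat n * (c * (1 - c / (2 * v.copies n))) := by ring
    _ ≤ v.hat n * (v.copies n / 2) := by gcongr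
    _ = _ := by ring

omit hL in
lemma le_profile (hv : v.Nondegenerate) (n q : ℕ) :
    v.hat n * ((min q (v.copies n) : ℕ) : ℝ) / 2 ≤ v.profile n q := by
  have hN : (0 : ℝ) < v.copies n := by exact_mod_cast hv.copies_pos n
  have : ((min q (v.copies n) : ℕ) : ℝ) ≤ v.copies n := by exact_mod_cast min_le_right _ _
  rw [profile_eq hv]
  set c : ℝ := ((min q (v.copies n) : ℕ) : ℝ)
  have h : c / (2 * v.copies n) ≤ 1 / 2 := by rw [div_le_iff₀ (by positivity)]; linarith
  calc _ = v.hat n * c * (1 - 1 / 2) := by ring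
    _ ≤ _ := by gcongr

end HasSpacerRatio

lemma Nondegenerate.stage_spec (hv : v.Nondegenerate) {t : ℕ} (ht : 1 ≤ t) :
    v.height (v.stage t) ≤ t ∧ t < v.height (v.stage t + 1) := by
  have h0 : v.height 0 ≤ t := ht
  refine ⟨Nat.findGreatest_spec (P := fun n => v.height n ≤ t) (Nat.zero_le t) h0, ?_⟩
  by_contra h
  have h1 : v.stage t + 1 ≤ t := (hv.lt_height _).le.trans (not_lt.1 h)
  have h2 := Nat.le_findGreatest (P := fun n => v.height n ≤ t) h1 (not_lt.1 h)
  exact absurd h2 (by rw [stage]; omega)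

lemma Nondegenerate.tendsto_stage (hv : v.Nondegenerate) : Tendsto v.stage atTop atTop := by
  refine tendsto_atTop.2 fun n => eventually_atTop.2 ⟨v.height n, fun t ht => ?_⟩
  exact Nat.le_findGreatest ((hv.lt_height n).le.trans ht) ht

lemma Nondegenerate.hat_le_scale (n q : ℕ) : (v.hat n : ℝ) ≤ v.scale n q := by
  rw [scale]
  exact le_mul_of_one_le_right (by positivity) (by
    have : (0 : ℝ) ≤ ((min q (v.copies n) : ℕ) : ℝ) := by positivity
    linarith)

namespace HasSpacerRatio

variable (hL : v.HasSpacerRatio L)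
include hL

/-- The three cases in the definition of `a_t`: the copy of `C_n` that is reached last is partly
covered, or is fully covered, or the next one is already partly covered. -/
lemma abs_sub_normalizer_le {j t : ℕ} (hst : v.stage t = j + 1) :
    |v.profile (j + 1) (t / v.bigH (j + 1)) +
      (v.diffCount (j + 1) (t % v.bigH (j + 1) : ℕ) - (v.hat (j + 1) : ℝ) ^ 2 / 2 +
        v.diffCount (j + 1) ((t % v.bigH (j + 1) : ℕ) - v.bigH (j + 1))) / v.hat (j + 1) -
      v.normalizer t| ≤ v.scale (j + 1) (t / v.bigH (j + 1)) *
        (2 * v.relErr L j + 2 * (1 / v.hat (j + 1)) + 1 / ((j + 1 : ℕ) + 1)) := by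
  have hv := hL.nondegenerate
  have hg : (0 : ℝ) < v.hat (j + 1) := by exact_mod_cast hv.hat_pos (j + 1)
  have hHh := hL.two_mul_height_le_bigH (show 1 ≤ j + 1 by omega)
  have hr := Nat.mod_lt t (hv.bigH_pos (j + 1))
  have hscale := Nondegenerate.hat_le_scale (v := v) (j + 1) (t / v.bigH (j + 1))
  have hN : (0 : ℝ) < v.copies (j + 1) := by exact_mod_cast hv.copies_pos (j + 1)
  have hNk : ((j + 1 : ℕ) : ℝ) + 1 ≤ v.copies (j + 1) := by
    rw [hL.copies_eq_mul]
    exact le_mul_of_one_le_right (by positivity) (by exact_mod_cast hL.m_pos (j + 1))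
  have herr := relErr_nonneg (v := v) (L := L) j
  simp only [normalizer, hst, Nat.add_sub_cancel, hv.hatHeight_eq]
  set q := t / v.bigH (j + 1) with hq
  set r := t % v.bigH (j + 1) with hrdef
  have hone : 1 ≤ v.scale (j + 1) q * (1 / v.hat (j + 1)) := by
    rw [mul_one_div, le_div_iff₀ hg, one_mul]; exact hscale
  have hB : 2 * v.hat (j + 1) * v.relErr L j ≤ v.scale (j + 1) q * (2 * v.relErr L j) := by
    nlinarith
  have hlast : 0 ≤ v.scale (j + 1) q * (1 / ((j + 1 : ℕ) + 1)) :=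
    mul_nonneg (scale_nonneg _ _) (by positivity)
  rw [mul_add, mul_add, mul_left_comm _ 2 (1 / (v.hat (j + 1) : ℝ))]
  by_cases h1 : r < v.height (j + 1)
  · rw [if_pos h1, hv.diffCount_eq_zero (x := (r : ℤ) - v.bigH (j + 1)) (by omega),
      hv.diffCount_natCast]
    have h := hL.abs_pairCount_succ_sub_profile_le j r
    have e : v.profile (j + 1) q + (v.pairCount (j + 1) r +
        ((v.hat (j + 1) : ℝ) ^ 2 - v.hat (j + 1)) / 2 - (v.hat (j + 1) : ℝ) ^ 2 / 2 + 0) /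
          v.hat (j + 1) - (v.profile (j + 1) q + v.profile j (r / v.bigH j)) =
        (v.pairCount (j + 1) r / v.hat (j + 1) - v.profile j (r / v.bigH j)) - 1 / 2 := by
      field_simp; ring
    rw [e]
    rw [abs_le] at h ⊢
    constructor <;> linarith [h.1, h.2]
  rw [if_neg h1, hv.diffCount_eq_sq (x := (r : ℤ)) (by omega)]
  by_cases h2 : r < v.bigH (j + 1) - v.height (j + 1)
  · rw [if_pos h2, hv.diffCount_eq_zero (x := (r : ℤ) - v.bigH (j + 1)) (by omega)]
    have e : v.profile (j + 1) q + ((v.hat (j + 1) : ℝ) ^ 2 - (v.hat (j + 1) : ℝ) ^ 2 / 2 + 0) /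
        v.hat (j + 1) - (v.profile (j + 1) q + v.hat (j + 1) / 2) = 0 := by
      field_simp; ring
    rw [e, abs_zero]
    have : 0 ≤ v.scale (j + 1) q * (2 * v.relErr L j) :=
      mul_nonneg (scale_nonneg _ _) (by positivity)
    linarith
  rw [if_neg h2]
  -- the time that is missing for a whole number of periods
  obtain ⟨x, hx⟩ : ∃ x, x = v.bigH (j + 1) - r := ⟨_, rfl⟩
  have hW : v.diffCount (j + 1) ((r : ℤ) - v.bigH (j + 1)) =
      (v.hat (j + 1) : ℝ) ^ 2 - (v.pairCount (j + 1) (x + 1) +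
        ((v.hat (j + 1) : ℝ) ^ 2 - v.hat (j + 1)) / 2) := by
    rw [← hv.diffCount_natCast, ← hv.diffCount_add_diffCount (j + 1) ((r : ℤ) - v.bigH (j + 1)),
      show (1 : ℤ) - (r - v.bigH (j + 1)) = (x + 1 : ℕ) by omega]
    ring
  rw [← hx, hW, HasSpacerRatio.profile_eq hv (j + 1) q]
  have h := hL.abs_pairCount_succ_sub_profile_le j x
  have hp0 := HasSpacerRatio.profile_nonneg hv j (x / v.bigH j)
  have hp1 := HasSpacerRatio.profile_le hv j (x / v.bigH j)
  have hD0 := pairCount_mono (v := v) (j + 1) (Nat.le_succ x)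
  have hD1 := hv.pairCount_add_one_le (j + 1) x
  obtain ⟨δ, hδ⟩ : ∃ δ, δ = (v.pairCount (j + 1) (x + 1) - v.pairCount (j + 1) x) /
    v.hat (j + 1) := ⟨_, rfl⟩
  have hδ0 : 0 ≤ δ := hδ ▸ div_nonneg (sub_nonneg.2 hD0) hg.le
  have hδ1 : δ ≤ 1 := by rw [hδ, div_le_one hg]; linarith
  set p := v.profile j (x / v.bigH j)
  have hc : (v.hat (j + 1) : ℝ) * (((min q (v.copies (j + 1)) : ℕ) : ℝ) / v.copies (j + 1)) ≤
      v.scale (j + 1) q * (1 / ((j + 1 : ℕ) + 1)) := by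
    rw [scale, mul_assoc]
    gcongr
    rw [mul_one_div]
    gcongr
    linarith
  set c : ℝ := ((min q (v.copies (j + 1)) : ℕ) : ℝ) with hcdef
  have hc0 : 0 ≤ c / v.copies (j + 1) := by positivity
  set g : ℝ := (v.hat (j + 1) : ℝ)
  set N : ℝ := (v.copies (j + 1) : ℝ)
  have e : g * c * (1 - c / (2 * N)) + (g ^ 2 - g ^ 2 / 2 + (g ^ 2 -
      (v.pairCount (j + 1) (x + 1) + (g ^ 2 - g) / 2))) / g -
        ((c + 1) * g * (1 - c / (2 * N)) - p * (1 - c / N)) =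
      1 / 2 - δ - (v.pairCount (j + 1) x / g - p) + (g / 2 - p) * (c / N) := by
    rw [hδ]; field_simp; ring
  rw [e]
  have f1 : 0 ≤ (g / 2 - p) * (c / N) := mul_nonneg (by linarith) hc0
  have f2 : (g / 2 - p) * (c / N) ≤ g * (c / N) := by gcongr; linarith
  rw [abs_le] at h ⊢
  constructor <;> linarith [h.1, h.2]

/-- The errors, which are small multiples of `scale`, are thus small compared with `a_t`. -/
lemma scale_le_normalizer {j t : ℕ} (hst : v.stage t = j + 1) :
    v.scale (j + 1) (t / v.bigH (j + 1)) ≤ 4 * v.normalizer t := by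
  have hv := hL.nondegenerate
  have ht : 1 ≤ t := by
    by_contra h
    obtain rfl : t = 0 := by omega
    simp [stage] at hst
  have hle := (hv.stage_spec ht).1
  rw [hst] at hle
  have hg : (0 : ℝ) < v.hat (j + 1) := by exact_mod_cast hv.hat_pos (j + 1)
  have hN : (0 : ℝ) < v.copies (j + 1) := by exact_mod_cast hv.copies_pos (j + 1)
  have hprof := HasSpacerRatio.le_profile hv (j + 1) (t / v.bigH (j + 1))
  simp only [normalizer, hst, Nat.add_sub_cancel, hv.hatHeight_eq, scale]
  set q := t / v.bigH (j + 1) with hq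
  set r := t % v.bigH (j + 1) with hr
  have hmin : ((min q (v.copies (j + 1)) : ℕ) : ℝ) ≤ v.copies (j + 1) := by
    exact_mod_cast min_le_right _ _
  by_cases h1 : r < v.height (j + 1)
  · rw [if_pos h1]
    have hq1 : 1 ≤ q := by
      by_contra h0
      have h2 := (Nat.div_eq_zero_iff_lt (hv.bigH_pos (j + 1))).1
        (hq.symm.trans (Nat.eq_zero_of_not_pos h0))
      rw [hr, Nat.mod_eq_of_lt h2] at h1
      omega
    have hc1 : (1 : ℝ) ≤ ((min q (v.copies (j + 1)) : ℕ) : ℝ) := by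
      have := hv.copies_pos (j + 1)
      exact_mod_cast (le_min hq1 this)
    have := HasSpacerRatio.profile_nonneg hv j (r / v.bigH j)
    nlinarith
  rw [if_neg h1]
  by_cases h2 : r < v.bigH (j + 1) - v.height (j + 1)
  · rw [if_pos h2]
    have : 0 ≤ (v.hat (j + 1) : ℝ) * ((min q (v.copies (j + 1)) : ℕ) : ℝ) := by positivity
    linarith
  rw [if_neg h2]
  rw [HasSpacerRatio.profile_eq hv] at hprof
  have hp1 := HasSpacerRatio.profile_le hv j ((v.bigH (j + 1) - r) / v.bigH j)
  set c : ℝ := ((min q (v.copies (j + 1)) : ℕ) : ℝ) with hcdef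
  have hc0 : 0 ≤ c := by positivity
  set g : ℝ := (v.hat (j + 1) : ℝ)
  set N : ℝ := (v.copies (j + 1) : ℝ)
  have hcN : c / N ≤ 1 := (div_le_one hN).2 hmin
  have f1 : v.profile j ((v.bigH (j + 1) - r) / v.bigH j) * (1 - c / N) ≤
      g / 2 * (1 - c / N) := mul_le_mul_of_nonneg_right hp1 (by linarith)
  have e : (c + 1) * g * (1 - c / (2 * N)) - g / 2 * (1 - c / N) =
    g * c * (1 - c / (2 * N)) + g / 2 := by field_simp; ring
  have : 0 ≤ g * c := by positivity
  nlinarith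

/-- Passing from `C_{n+1}` to `C_{n+2}` adds few pairs. -/
lemma pairCount_add_two_le {n t : ℕ} (hn : 1 ≤ n) (ht : t < v.height (n + 1)) :
    v.pairCount (n + 2) t / v.hat (n + 2) ≤ v.pairCount (n + 1) t / v.hat (n + 1) +
      v.scale n (t / v.bigH n) * (2 * (1 / (n + 1))) := by
  have hv := hL.nondegenerate
  have hg : (0 : ℝ) < v.hat (n + 1) := by exact_mod_cast hv.hat_pos (n + 1)
  have hN : (0 : ℝ) < v.copies (n + 1) := by exact_mod_cast hv.copies_pos (n + 1)
  have hm : (0 : ℝ) < v.m (n + 1) := by exact_mod_cast hL.m_pos (n + 1)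
  have h := hv.pairCount_succ_le_of_lt (hL.two_mul_height_le_bigH (show 1 ≤ n + 1 by omega)) ht
  have hcase : (if v.height (n + 1) < 2 * t then (v.m (n + 1) : ℝ) * (v.hat (n + 1) : ℝ) ^ 2 else 0)
      ≤ v.scale n (t / v.bigH n) * (2 * (1 / (n + 1))) * v.hat (n + 2) := by
    split_ifs with hc
    · have hq : v.copies n ≤ 2 * min (t / v.bigH n) (v.copies n) := by
        have h1 : v.tallCount n ≤ t / v.bigH n := by
          rw [Nat.le_div_iff_mul_le (hv.bigH_pos n)]
          rw [height_succ] at hc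
          have : 0 ≤ v.m n * v.height n := Nat.zero_le _
          omega
        have h2 := hv.copies_eq n
        have h3 : v.m n ≤ v.tallCount n := by
          rw [tallCount, hL.k_eq]
          exact Nat.le_mul_of_pos_right _ (by omega)
        omega
      have hq' : (v.copies n : ℝ) ≤ 2 * (((min (t / v.bigH n) (v.copies n) : ℕ) : ℝ) + 1) := by
        have : (v.copies n : ℝ) ≤ 2 * ((min (t / v.bigH n) (v.copies n) : ℕ) : ℝ) := by
          exact_mod_cast hq
        linarith
      have h1 : (v.hat (n + 1) : ℝ) ≤ 2 * v.scale n (t / v.bigH n) := by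
        rw [scale, hat_succ, Nat.cast_mul]
        have := mul_le_mul_of_nonneg_left hq' (Nat.cast_nonneg (α := ℝ) (v.hat n))
        linarith
      rw [hat_succ (n + 1), Nat.cast_mul, hL.copies_eq_mul]
      have h2 : (1 : ℝ) ≤ 1 / (n + 1) * ((n + 1 : ℕ) + 1) := by
        rw [one_div, inv_mul_eq_div, le_div_iff₀ (by positivity)]; push_cast; linarith
      calc (v.m (n + 1) : ℝ) * (v.hat (n + 1) : ℝ) ^ 2
          = v.hat (n + 1) * 1 * (v.hat (n + 1) * v.m (n + 1)) := by ring
        _ ≤ 2 * v.scale n (t / v.bigH n) * (1 / (n + 1) * ((n + 1 : ℕ) + 1)) *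
            (v.hat (n + 1) * v.m (n + 1)) := by
          gcongr
          exact mul_nonneg zero_le_two (scale_nonneg _ _)
        _ = _ := by ring
    · exact mul_nonneg (mul_nonneg (scale_nonneg _ _) (by positivity)) (by positivity)
  have hg2 : (0 : ℝ) < v.hat (n + 2) := by exact_mod_cast hv.hat_pos (n + 2)
  rw [div_le_iff₀ hg2, add_mul]
  have e : v.pairCount (n + 1) t / v.hat (n + 1) * v.hat (n + 2) =
      v.copies (n + 1) * v.pairCount (n + 1) t := by
    rw [hat_succ (n + 1), Nat.cast_mul]; field_simp
  rw [e]
  exact h.trans (add_le_add le_rfl hcase)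

omit hL in
lemma pairCount_div_hat_le_succ (hv : v.Nondegenerate) (n t : ℕ) :
    v.pairCount n t / v.hat n ≤ v.pairCount (n + 1) t / v.hat (n + 1) := by
  have hg : (0 : ℝ) < v.hat n := by exact_mod_cast hv.hat_pos n
  have hN : (0 : ℝ) < v.copies n := by exact_mod_cast hv.copies_pos n
  rw [hat_succ, Nat.cast_mul, div_le_div_iff₀ hg (by positivity)]
  have : v.copies n * v.pairCount n t ≤ v.pairCount (n + 1) t := by
    rw [hv.pairCount_succ]
    calc (v.copies n : ℝ) * v.pairCount n t =
        ∑ c ∈ Finset.range (v.copies n), v.pairCount n t := by simp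
      _ ≤ _ := Finset.sum_le_sum fun c hc => by
        rw [← blockCount_self n t (v.start n c)]
        exact Finset.single_le_sum (f := fun c' => v.blockCount n t (v.start n c) (v.start n c'))
          (fun c' _ => blockCount_nonneg _ _ _ _) hc
  nlinarith

/-- The number of pairs, divided by the number of levels, agrees with the normalizing sequence
up to a small relative error. -/
lemma abs_pairCount_sub_normalizer_le {j t : ℕ} (hst : v.stage t = j + 1) :
    |v.pairCount (j + 3) t / v.hat (j + 3) - v.normalizer t| ≤
      v.scale (j + 1) (t / v.bigH (j + 1)) * (3 * v.relErr L (j + 1) + 2 * v.relErr L j) := by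
  have hv := hL.nondegenerate
  have ht : 1 ≤ t := by
    by_contra h
    obtain rfl : t = 0 := by omega
    simp [stage] at hst
  have hlt := (hv.stage_spec ht).2
  rw [hst] at hlt
  have h1 := hL.abs_sub_normalizer_le hst
  have h2 := hL.abs_pairCount_succ_sub_le (q := t / v.bigH (j + 1))
    (Nat.mod_lt t (hv.bigH_pos (j + 1)))
  rw [Nat.div_add_mod'] at h2
  have h3 := hL.pairCount_add_two_le (show 1 ≤ j + 1 by omega) hlt
  have h4 := pairCount_div_hat_le_succ hv (j + 2) t
  have hs := scale_nonneg (v := v) (j + 1) (t / v.bigH (j + 1))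
  set S := v.scale (j + 1) (t / v.bigH (j + 1))
  have e : S * (3 * v.relErr L (j + 1) + 2 * v.relErr L j) =
      S * (2 * v.relErr L j + 2 * (1 / v.hat (j + 1)) + 1 / ((j + 1 : ℕ) + 1)) +
      S * ((L (j + 1) + 7) / ((j + 1 : ℕ) + 1) + 1 / v.hat (j + 1)) +
      S * (2 * (1 / ((j + 1 : ℕ) + 1))) +
      S * (2 * ((L (j + 1) + 7) / ((j + 1 : ℕ) + 1))) := by
    simp only [relErr]; ring
  have hpos : 0 ≤ S * (2 * (((L (j + 1) : ℝ) + 7) / ((j + 1 : ℕ) + 1))) := by positivity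
  rw [e]
  rw [abs_le] at h1 h2 ⊢
  constructor <;> linarith [h1.1, h1.2, h2.1, h2.2]

/-- Few pairs lie outside the tall parts of the copies of `C_{n+1}`. -/
lemma pairCount_sub_tall_le {n t : ℕ} (hn : 1 ≤ n) (ht : t < v.height (n + 1)) :
    v.pairCount (n + 2) t / v.hat (n + 2) - v.tallPairCount n t / v.hat (n + 1) ≤
      v.scale n (t / v.bigH n) * v.relErr L n := by
  have hv := hL.nondegenerate
  have hm : (0 : ℝ) < v.m n := by exact_mod_cast hL.m_pos n
  have hh : (0 : ℝ) < v.hat n := by exact_mod_cast hv.hat_pos n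
  have h3 := hL.pairCount_add_two_le hn ht
  have h1 : v.pairCount (n + 1) t / v.hat (n + 1) - v.tallPairCount n t / v.hat (n + 1) ≤
      v.scale n (t / v.bigH n) * ((L n + 3) / (n + 1)) := by
    have := hv.pairCount_succ_le (q := t / v.bigH n) (Nat.mod_lt t (hv.bigH_pos n))
      (hL.bigH_eq n).le
    rw [Nat.div_add_mod'] at this
    rw [← sub_div, div_le_iff₀ (by exact_mod_cast hv.hat_pos (n + 1)), hat_succ, scale,
      Nat.cast_mul, hL.copies_eq_mul]
    generalize ((min (t / v.bigH n) (v.copies n) : ℕ) : ℝ) = c at *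
    calc _ ≤ v.m n * ((((L n + 1 : ℕ) : ℝ) + 2) * (c + 1)) * (v.hat n : ℝ) ^ 2 := by linarith
      _ = _ := by push_cast; field_simp; ring
  have hs := scale_nonneg (v := v) n (t / v.bigH n)
  set S := v.scale n (t / v.bigH n)
  have e : S * v.relErr L n = S * ((L n + 3) / (n + 1)) + S * (2 * (1 / (n + 1))) +
      S * (3 * (1 / (n + 1)) + 1 / v.hat n) := by simp only [relErr]; ring
  have : 0 ≤ S * (3 * (1 / ((n : ℝ) + 1)) + 1 / v.hat n) := by positivity
  linarith

end HasSpacerRatio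

/-! ### Overlaps of subsets of the initial interval -/

namespace Nondegenerate

variable (hv : v.Nondegenerate)
include hv

lemma measureReal_level (n p : ℕ) : v.measure.real (v.level n p) = (v.hat n : ℝ)⁻¹ := by
  rw [Measure.real, hv.measure_level, ENNReal.toReal_ofReal (hv.width_pos n).le, width_eq]

lemma measure_ne_top_of_subset_base {A : Set ℝ} (hA : A ⊆ v.base) : v.measure A ≠ ⊤ :=
  ne_top_of_le_ne_top (by rw [hv.measure_base]; exact ENNReal.one_ne_top) (measure_mono hA)

lemma measure_level_ne_top (n p : ℕ) : v.measure (v.level n p) ≠ ⊤ := by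
  rw [hv.measure_level]; exact ENNReal.ofReal_ne_top

lemma measureReal_image_iterate (i : ℕ) {E : Set ℝ} (hE : MeasurableSet E) :
    v.measure.real (v.map^[i] '' E) = v.measure.real E := by
  rw [Measure.real, hv.measure_image_iterate i hE, Measure.real]

lemma measurableSet_base : MeasurableSet v.base := by rw [hv.base_eq]; exact measurableSet_Ico

lemma base_eq_biUnion (n : ℕ) : v.base = ⋃ p ∈ v.basePos n, v.level n p := by
  ext x; simp only [hv.mem_base_iff n, mem_iUnion, exists_prop]

lemma pairwiseDisjoint_level (n : ℕ) :
    Set.PairwiseDisjoint (v.basePos n : Set ℕ) (v.level n) := by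
  intro p hp p' hp' hne
  exact Set.disjoint_left.2 fun x hx hx' =>
    hne (hv.level_disjoint (lt_height_of_mem hp) (lt_height_of_mem hp') hx hx')

lemma sum_measureReal_inter_level {A : Set ℝ} (hA : MeasurableSet A) (hAF : A ⊆ v.base) (n : ℕ) :
    ∑ p ∈ v.basePos n, v.measure.real (A ∩ v.level n p) = v.measure.real A := by
  have e : A = ⋃ p ∈ v.basePos n, A ∩ v.level n p := by
    rw [← inter_iUnion₂, ← hv.base_eq_biUnion n, inter_eq_left.2 hAF]
  conv_rhs => rw [e]
  exact (measureReal_biUnion_finset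
    (fun p hp p' hp' hne =>
      (hv.pairwiseDisjoint_level n hp hp' hne).mono inter_subset_right inter_subset_right)
    (fun p _ => hA.inter (measurableSet_level n p))
    (fun p _ => hv.measure_ne_top_of_subset_base (inter_subset_left.trans hAF))).symm

/-- The overlap at time `i` is the sum over the pairs of levels at distance `i`. -/
lemma measureReal_inter_image {A B : Set ℝ} (hA : MeasurableSet A) (hB : MeasurableSet B)
    (hAF : A ⊆ v.base) (hBF : B ⊆ v.base) {N i : ℕ} (hi : 2 * i ≤ v.height N) :
    v.measure.real (A ∩ v.map^[i] '' B) = ∑ p ∈ v.basePos N, ∑ p' ∈ v.basePos N,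
      if p' = p + i then v.measure.real (A ∩ v.map^[i] '' (B ∩ v.level N p)) else 0 := by
  have e : A ∩ v.map^[i] '' B = ⋃ p ∈ v.basePos N, A ∩ v.map^[i] '' (B ∩ v.level N p) := by
    rw [← inter_iUnion₂, ← image_iUnion₂, ← inter_iUnion₂, ← hv.base_eq_biUnion N,
      inter_eq_left.2 hBF]
  rw [e, measureReal_biUnion_finset
    (h := fun p _ => hv.measure_ne_top_of_subset_base (inter_subset_left.trans hAF))]
  · refine Finset.sum_congr rfl fun p hp => ?_
    rw [Finset.sum_ite_eq']
    split_ifs with h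
    · rfl
    · have hlt := hv.two_mul_lt_of_mem hp
      have : A ∩ v.map^[i] '' (B ∩ v.level N p) = ∅ := by
        refine eq_empty_of_forall_notMem ?_
        rintro _ ⟨hyA, x, ⟨_, hx⟩, rfl⟩
        obtain ⟨p', hp', hy⟩ := (hv.mem_base_iff N).1 (hAF hyA)
        have := hv.level_disjoint (by omega) (lt_height_of_mem hp')
          (hv.iterate_map_mem (i := i) (by omega) hx) hy
        exact h (this ▸ hp')
      rw [this, measureReal_empty]
  · intro p hp p' hp' hne
    refine Disjoint.mono inter_subset_right inter_subset_right ?_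
    exact (disjoint_image_iff (hv.map_injective.iterate i)).2
      ((hv.pairwiseDisjoint_level N hp hp' hne).mono inter_subset_right inter_subset_right)
  · exact fun p _ => hA.inter
      (hv.measurableSet_image_iterate i (hB.inter (measurableSet_level N p)))

lemma overlapSum_eq {A B : Set ℝ} (hA : MeasurableSet A) (hB : MeasurableSet B)
    (hAF : A ⊆ v.base) (hBF : B ⊆ v.base) {N t : ℕ} (ht : 2 * t ≤ v.height N) :
    overlapSum v.map v.measure A B t = ∑ p ∈ v.basePos N, ∑ p' ∈ v.basePos N,
      window t p p' * v.measure.real (A ∩ v.map^[p' - p] '' (B ∩ v.level N p)) := by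
  have h1 : overlapSum v.map v.measure A B t = ∑ i ∈ Finset.range t,
      ∑ p ∈ v.basePos N, ∑ p' ∈ v.basePos N,
      if p' = p + i then v.measure.real (A ∩ v.map^[i] '' (B ∩ v.level N p)) else 0 :=
    Finset.sum_congr rfl fun i hi => hv.measureReal_inter_image hA hB hAF hBF
      (by have := Finset.mem_range.1 hi; omega)
  rw [h1, Finset.sum_comm]
  refine Finset.sum_congr rfl fun p _ => ?_
  rw [Finset.sum_comm]
  refine Finset.sum_congr rfl fun p' _ => ?_
  unfold window
  split_ifs with h
  · rw [Finset.sum_eq_single (p' - p)]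
    · rw [if_pos (by omega), one_mul]
    · intro b _ hb; rw [if_neg (by omega)]
    · intro hn; exact absurd (Finset.mem_range.2 (by omega)) hn
  · rw [zero_mul]
    refine Finset.sum_eq_zero fun i hi => ?_
    have := Finset.mem_range.1 hi
    rw [if_neg (by omega)]

lemma overlapSum_base {N t : ℕ} (ht : 2 * t ≤ v.height N) :
    overlapSum v.map v.measure v.base v.base t = v.pairCount N t / v.hat N := by
  rw [hv.overlapSum_eq hv.measurableSet_base hv.measurableSet_base subset_rfl subset_rfl ht,
    pairCount, Finset.sum_div]
  refine Finset.sum_congr rfl fun p hp => ?_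
  rw [Finset.sum_div]
  refine Finset.sum_congr rfl fun p' hp' => ?_
  have hsub : ∀ p ∈ v.basePos N, v.level N p ⊆ v.base := fun p hp =>
    hv.level_subset_base_iff.2 (Finset.mem_filter.1 hp).2
  by_cases h : p ≤ p' ∧ p' < p + t
  · rw [inter_eq_right.2 (hsub p hp), hv.image_iterate_level
      (by have := lt_height_of_mem hp'; omega), Nat.add_sub_cancel' h.1,
      inter_eq_right.2 (hsub p' hp'), hv.measureReal_level, div_eq_mul_inv]
  · rw [window, if_neg h]; simp

/-- The overlaps of `A` and `B` in terms of the measures of the pieces of `B`. -/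
lemma overlapSum_le_left {A B : Set ℝ} (hA : MeasurableSet A) (hB : MeasurableSet B)
    (hAF : A ⊆ v.base) (hBF : B ⊆ v.base) {N t : ℕ} (ht : 2 * t ≤ v.height N) :
    overlapSum v.map v.measure A B t ≤ ∑ p ∈ v.basePos N, ∑ p' ∈ v.basePos N,
      v.measure.real (B ∩ v.level N p) * window t p p' := by
  rw [hv.overlapSum_eq hA hB hAF hBF ht]
  refine Finset.sum_le_sum fun p _ => Finset.sum_le_sum fun p' _ => ?_
  rw [mul_comm]
  refine mul_le_mul_of_nonneg_right ?_ (window_nonneg _ _ _)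
  have hBm := hB.inter (measurableSet_level (v := v) N p)
  rw [← hv.measureReal_image_iterate (p' - p) hBm]
  refine measureReal_mono inter_subset_right ?_
  rw [hv.measure_image_iterate _ hBm]
  exact hv.measure_ne_top_of_subset_base (inter_subset_left.trans hBF)

lemma overlapSum_le_right {A B : Set ℝ} (hA : MeasurableSet A) (hB : MeasurableSet B)
    (hAF : A ⊆ v.base) (hBF : B ⊆ v.base) {N t : ℕ} (ht : 2 * t ≤ v.height N) :
    overlapSum v.map v.measure A B t ≤ ∑ p ∈ v.basePos N, ∑ p' ∈ v.basePos N,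
      v.measure.real (A ∩ v.level N p') * window t p p' := by
  rw [hv.overlapSum_eq hA hB hAF hBF ht]
  refine Finset.sum_le_sum fun p _ => Finset.sum_le_sum fun p' hp' => ?_
  by_cases h : p ≤ p' ∧ p' < p + t
  · rw [mul_comm]
    refine mul_le_mul_of_nonneg_right ?_ (window_nonneg _ _ _)
    refine measureReal_mono ?_ (hv.measure_ne_top_of_subset_base (inter_subset_left.trans hAF))
    refine inter_subset_inter_right _ ?_
    rintro _ ⟨x, ⟨_, hx⟩, rfl⟩
    have := hv.iterate_map_mem (i := p' - p) (by have := lt_height_of_mem hp'; omega) hx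
    rwa [Nat.add_sub_cancel' h.1] at this
  · rw [window, if_neg h]; simp

lemma sum_diag_le_sum_basePos (n : ℕ) (f : ℕ → ℕ → ℝ) (hf : ∀ p p', 0 ≤ f p p') :
    ∑ c ∈ Finset.range (v.copies n), ∑ s ∈ v.basePos n, ∑ s' ∈ v.basePos n,
      f (v.start n c + s) (v.start n c + s') ≤
    ∑ p ∈ v.basePos (n + 1), ∑ p' ∈ v.basePos (n + 1), f p p' := by
  rw [hv.sum_basePos_succ]
  simp only [hv.sum_basePos_succ n]
  refine Finset.sum_le_sum fun c hc => Finset.sum_le_sum fun s _ => ?_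
  exact Finset.single_le_sum (f := fun c' => ∑ s' ∈ v.basePos n,
    f (v.start n c + s) (v.start n c' + s')) (fun _ _ => Finset.sum_nonneg fun _ _ => hf _ _) hc

lemma sum_tall_le_sum (n : ℕ) (x : ℕ → ℝ) (hx : ∀ p, 0 ≤ x p) :
    ∑ c ∈ Finset.range (v.tallCount n), ∑ s ∈ v.basePos n, x (c * v.bigH n + s) ≤
      ∑ p ∈ v.basePos (n + 1), x p := by
  rw [hv.sum_basePos_succ]
  calc _ = ∑ c ∈ Finset.range (v.tallCount n), ∑ s ∈ v.basePos n, x (v.start n c + s) :=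
        Finset.sum_congr rfl fun c hc => by rw [start_of_le (Finset.mem_range.1 hc).le]
    _ ≤ _ := Finset.sum_le_sum_of_subset_of_nonneg
        (Finset.range_subset_range.2 (by rw [hv.copies_eq]; omega))
        fun _ _ _ => Finset.sum_nonneg fun _ _ => hx _

/-- A weighted number of pairs, with weights `z ≤ w`: the pairs in the tall parts are counted with
their weights, and all others with weight `w`. -/
lemma sum_mul_window_le (n t : ℕ) {w : ℝ} (z : ℕ → ℕ → ℝ) (hz : ∀ p p', z p p' ≤ w) :
    ∑ p ∈ v.basePos (n + 2), ∑ p' ∈ v.basePos (n + 2), z p p' * window t p p' ≤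
      w * (v.pairCount (n + 2) t - v.copies (n + 1) * v.tallPairCount n t) +
      ∑ C ∈ Finset.range (v.copies (n + 1)), ∑ c ∈ Finset.range (v.tallCount n),
        ∑ c' ∈ Finset.range (v.tallCount n), ∑ s ∈ v.basePos n, ∑ s' ∈ v.basePos n,
          z (v.start (n + 1) C + (c * v.bigH n + s)) (v.start (n + 1) C + (c' * v.bigH n + s')) *
            window t (c * v.bigH n + s) (c' * v.bigH n + s') := by
  have hf : ∀ p p', 0 ≤ (w - z p p') * window t p p' := fun p p' =>
    mul_nonneg (sub_nonneg.2 (hz _ _)) (window_nonneg _ _ _)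
  have h1 := hv.sum_diag_le_sum_basePos (n + 1) _ hf
  have h2 : ∀ C ∈ Finset.range (v.copies (n + 1)), _ := fun C _ =>
    hv.sum_tall_le_sum_basePos n (fun p p' => (w - z (v.start (n + 1) C + p)
      (v.start (n + 1) C + p')) * window t (v.start (n + 1) C + p) (v.start (n + 1) C + p'))
      fun _ _ => hf _ _
  have h3 := (Finset.sum_le_sum h2).trans h1
  simp only [window_add_left, sub_mul, Finset.sum_sub_distrib, ← Finset.mul_sum] at h3
  have e1 : ∑ c ∈ Finset.range (v.tallCount n), ∑ c' ∈ Finset.range (v.tallCount n),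
      ∑ s ∈ v.basePos n, ∑ s' ∈ v.basePos n, window t (c * v.bigH n + s) (c' * v.bigH n + s') =
      v.tallPairCount n t := rfl
  have e2 : ∑ p ∈ v.basePos (n + 1 + 1), ∑ p' ∈ v.basePos (n + 1 + 1), window t p p' =
      v.pairCount (n + 2) t := rfl
  rw [e1, e2, Finset.sum_const, Finset.card_range, nsmul_eq_mul] at h3
  rw [mul_sub]
  linarith

/-- If the weight depends on one level of the pair only, the pairs in the tall parts contribute at
most a multiple of the total weight. -/
lemma sum_left_mul_window_le (n t : ℕ) {w : ℝ} (x : ℕ → ℝ) (hx0 : ∀ p, 0 ≤ x p)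
    (hx : ∀ p, x p ≤ w) :
    ∑ p ∈ v.basePos (n + 2), ∑ p' ∈ v.basePos (n + 2), x p * window t p p' ≤
      w * (v.pairCount (n + 2) t - v.copies (n + 1) * v.tallPairCount n t) +
        2 * v.scale n (t / v.bigH n) * ∑ p ∈ v.basePos (n + 2), x p := by
  refine (hv.sum_mul_window_le n t (fun p _ => x p) fun p _ => hx p).trans ?_
  gcongr
  rw [hv.sum_basePos_succ (n + 1), Finset.mul_sum]
  refine Finset.sum_le_sum fun C _ => ?_
  refine le_trans ?_ (mul_le_mul_of_nonneg_left (hv.sum_tall_le_sum n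
    (fun p => x (v.start (n + 1) C + p)) fun _ => hx0 _)
    (mul_nonneg zero_le_two (scale_nonneg _ _)))
  rw [Finset.mul_sum]
  refine Finset.sum_le_sum fun c _ => ?_
  rw [Finset.mul_sum, Finset.sum_comm]
  refine Finset.sum_le_sum fun s hs => ?_
  simp only [← Finset.mul_sum]
  rw [mul_comm]
  refine mul_le_mul_of_nonneg_right ?_ (hx0 _)
  have := hv.sum_window_tall_le (q := t / v.bigH n) (c := c) (Nat.mod_lt t (hv.bigH_pos n)) hs
  rw [Nat.div_add_mod'] at this
  refine this.trans (le_of_eq ?_)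
  rw [scale]; ring

lemma sum_right_mul_window_le (n t : ℕ) {w : ℝ} (x : ℕ → ℝ) (hx0 : ∀ p, 0 ≤ x p)
    (hx : ∀ p, x p ≤ w) :
    ∑ p ∈ v.basePos (n + 2), ∑ p' ∈ v.basePos (n + 2), x p' * window t p p' ≤
      w * (v.pairCount (n + 2) t - v.copies (n + 1) * v.tallPairCount n t) +
        2 * v.scale n (t / v.bigH n) * ∑ p ∈ v.basePos (n + 2), x p := by
  refine (hv.sum_mul_window_le n t (fun _ p' => x p') fun _ p' => hx p').trans ?_
  gcongr
  rw [hv.sum_basePos_succ (n + 1), Finset.mul_sum]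
  refine Finset.sum_le_sum fun C _ => ?_
  refine le_trans ?_ (mul_le_mul_of_nonneg_left (hv.sum_tall_le_sum n
    (fun p => x (v.start (n + 1) C + p)) fun _ => hx0 _)
    (mul_nonneg zero_le_two (scale_nonneg _ _)))
  rw [Finset.mul_sum, Finset.sum_comm]
  refine Finset.sum_le_sum fun c' _ => ?_
  rw [Finset.mul_sum]
  have e : ∀ c, ∑ s ∈ v.basePos n, ∑ s' ∈ v.basePos n,
      x (v.start (n + 1) C + (c' * v.bigH n + s')) *
        window t (c * v.bigH n + s) (c' * v.bigH n + s') = ∑ s' ∈ v.basePos n,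
      x (v.start (n + 1) C + (c' * v.bigH n + s')) *
        ∑ s ∈ v.basePos n, window t (c * v.bigH n + s) (c' * v.bigH n + s') := fun c => by
    rw [Finset.sum_comm]; simp only [Finset.mul_sum]
  simp only [e]
  rw [Finset.sum_comm]
  refine Finset.sum_le_sum fun s' hs' => ?_
  rw [← Finset.mul_sum, mul_comm]
  refine mul_le_mul_of_nonneg_right ?_ (hx0 _)
  have := hv.sum_window_tall_le' (q := t / v.bigH n) (c' := c') (Nat.mod_lt t (hv.bigH_pos n)) hs'
  rw [Nat.div_add_mod'] at this
  refine this.trans (le_of_eq ?_)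
  rw [scale]; ring

end Nondegenerate

namespace HasSpacerRatio

variable (hL : v.HasSpacerRatio L)
include hL

/-- Uniform integrability of the numbers of visits: small sets have few overlaps. -/
lemma overlapSum_le {A B : Set ℝ} (hA : MeasurableSet A) (hB : MeasurableSet B)
    (hAF : A ⊆ v.base) (hBF : B ⊆ v.base) {j t : ℕ} (hst : v.stage t = j + 1) :
    overlapSum v.map v.measure A B t ≤ v.scale (j + 1) (t / v.bigH (j + 1)) *
        (2 * v.measure.real A + v.relErr L (j + 1)) ∧
    overlapSum v.map v.measure A B t ≤ v.scale (j + 1) (t / v.bigH (j + 1)) *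
        (2 * v.measure.real B + v.relErr L (j + 1)) := by
  have hv := hL.nondegenerate
  have ht1 : 1 ≤ t := by
    by_contra h
    obtain rfl : t = 0 := by omega
    simp [stage] at hst
  have hlt := (hv.stage_spec ht1).2
  rw [hst] at hlt
  have ht : 2 * t ≤ v.height (j + 1 + 2) := by
    have : 2 * v.height (j + 1 + 1) ≤ v.height (j + 1 + 2) := hv.two_mul_height_le _
    omega
  have htall := hL.pairCount_sub_tall_le (show 1 ≤ j + 1 by omega) hlt
  have hg : (0 : ℝ) < v.hat (j + 1 + 1) := by exact_mod_cast hv.hat_pos (j + 1 + 1)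
  have hN : (0 : ℝ) < v.copies (j + 1 + 1) := by exact_mod_cast hv.copies_pos (j + 1 + 1)
  have e : (v.hat (j + 1 + 2) : ℝ)⁻¹ * (v.pairCount (j + 1 + 2) t -
      v.copies (j + 1 + 1) * v.tallPairCount (j + 1) t) =
      v.pairCount (j + 1 + 2) t / v.hat (j + 1 + 2) -
        v.tallPairCount (j + 1) t / v.hat (j + 1 + 1) := by
    rw [hat_succ (j + 1 + 1), Nat.cast_mul]; field_simp
  have hle : ∀ E : Set ℝ, ∀ p, v.measure.real (E ∩ v.level (j + 1 + 2) p) ≤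
      (v.hat (j + 1 + 2) : ℝ)⁻¹ := fun E p => by
    rw [← hv.measureReal_level (j + 1 + 2) p]
    exact measureReal_mono inter_subset_right (hv.measure_level_ne_top _ _)
  constructor
  · refine (hv.overlapSum_le_right hA hB hAF hBF ht).trans
      ((hv.sum_right_mul_window_le (j + 1) t _ (fun _ => measureReal_nonneg) (hle A)).trans ?_)
    rw [hv.sum_measureReal_inter_level hA hAF, e]
    linarith
  · refine (hv.overlapSum_le_left hA hB hAF hBF ht).trans
      ((hv.sum_left_mul_window_le (j + 1) t _ (fun _ => measureReal_nonneg) (hle B)).trans ?_)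
    rw [hv.sum_measureReal_inter_level hB hBF, e]
    linarith

lemma tendsto_relErr_stage : Tendsto (fun t => v.relErr L (v.stage t)) atTop (𝓝 0) :=
  hL.tendsto_relErr.comp hL.nondegenerate.tendsto_stage

omit hL in
lemma eventually_stage (hv : v.Nondegenerate) : ∀ᶠ t in atTop, ∃ j, v.stage t = j + 1 := by
  filter_upwards [hv.tendsto_stage.eventually_ge_atTop 1] with t ht
  exact ⟨v.stage t - 1, by omega⟩

lemma hat_stage_le_normalizer : ∀ᶠ t in atTop, (v.hat (v.stage t) : ℝ) ≤ 4 * v.normalizer t := by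
  filter_upwards [eventually_stage hL.nondegenerate] with t ⟨j, hj⟩
  rw [hj]
  exact (Nondegenerate.hat_le_scale _ _).trans (hL.scale_le_normalizer hj)

lemma tendsto_normalizer : Tendsto v.normalizer atTop atTop := by
  have h1 : Tendsto (fun t => (v.hat (v.stage t) : ℝ) / 4) atTop atTop :=
    ((tendsto_natCast_atTop_atTop.comp hL.nondegenerate.tendsto_hat).comp
      hL.nondegenerate.tendsto_stage).atTop_div_const (by norm_num)
  refine tendsto_atTop_mono' _ ?_ h1
  filter_upwards [hL.hat_stage_le_normalizer] with t ht
  linarith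

lemma tendsto_overlapSum_base :
    Tendsto (fun t => (1 / v.normalizer t) * overlapSum v.map v.measure v.base v.base t)
      atTop (𝓝 1) := by
  have hv := hL.nondegenerate
  have hsub : Tendsto (fun t => v.stage t - 1) atTop atTop :=
    (tendsto_sub_atTop_nat 1).comp hv.tendsto_stage
  have hlim : Tendsto (fun t => 4 * (3 * v.relErr L (v.stage t) +
      2 * v.relErr L (v.stage t - 1))) atTop (𝓝 0) := by
    have := ((hL.tendsto_relErr_stage.const_mul 3).add
      ((hL.tendsto_relErr.comp hsub).const_mul 2)).const_mul 4
    simpa using this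
  rw [tendsto_iff_norm_sub_tendsto_zero]
  refine squeeze_zero' (Eventually.of_forall fun _ => norm_nonneg _) ?_ hlim
  filter_upwards [eventually_stage hv, hL.tendsto_normalizer.eventually_gt_atTop 0] with t ⟨j, hj⟩ h0
  have ht1 : 1 ≤ t := by
    by_contra h
    obtain rfl : t = 0 := by omega
    simp [stage] at hj
  have hlt := (hv.stage_spec ht1).2
  rw [hj] at hlt
  have ht : 2 * t ≤ v.height (j + 3) := by
    have : 2 * v.height (j + 1 + 1) ≤ v.height (j + 3) := hv.two_mul_height_le _
    omega
  rw [hv.overlapSum_base ht, hj, Nat.add_sub_cancel, Real.norm_eq_abs]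
  have h1 := hL.abs_pairCount_sub_normalizer_le hj
  have h2 := hL.scale_le_normalizer hj
  have e : 1 / v.normalizer t * (v.pairCount (j + 3) t / v.hat (j + 3)) - 1 =
      (v.pairCount (j + 3) t / v.hat (j + 3) - v.normalizer t) / v.normalizer t := by
    field_simp
  rw [e, abs_div, abs_of_pos h0, div_le_iff₀ h0]
  refine h1.trans ?_
  have h3 : 0 ≤ 3 * v.relErr L (j + 1) + 2 * v.relErr L j := by
    have := relErr_nonneg (v := v) (L := L) j
    have := relErr_nonneg (v := v) (L := L) (j + 1)
    linarith
  calc _ ≤ 4 * v.normalizer t * (3 * v.relErr L (j + 1) + 2 * v.relErr L j) := by gcongr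
    _ = _ := by ring

lemma eventually_overlapSum_le {A B : Set ℝ} (hA : MeasurableSet A) (hB : MeasurableSet B)
    (hAF : A ⊆ v.base) (hBF : B ⊆ v.base) : ∀ᶠ t in atTop,
    (1 / v.normalizer t) * overlapSum v.map v.measure A B t ≤
      8 * v.measure.real A + 4 * v.relErr L (v.stage t) ∧
    (1 / v.normalizer t) * overlapSum v.map v.measure A B t ≤
      8 * v.measure.real B + 4 * v.relErr L (v.stage t) := by
  filter_upwards [eventually_stage hL.nondegenerate,
    hL.tendsto_normalizer.eventually_gt_atTop 0] with t ⟨j, hj⟩ h0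
  obtain ⟨h1, h2⟩ := hL.overlapSum_le hA hB hAF hBF hj
  have h3 := hL.scale_le_normalizer hj
  have he := relErr_nonneg (v := v) (L := L) (j + 1)
  have key : ∀ y, 0 ≤ y → overlapSum v.map v.measure A B t ≤
      v.scale (j + 1) (t / v.bigH (j + 1)) * (2 * y + v.relErr L (j + 1)) →
      1 / v.normalizer t * overlapSum v.map v.measure A B t ≤ 8 * y + 4 * v.relErr L (j + 1) := by
    intro y hy h
    rw [one_div, inv_mul_eq_div, div_le_iff₀ h0]
    calc _ ≤ _ := h
      _ ≤ 4 * v.normalizer t * (2 * y + v.relErr L (j + 1)) := by gcongr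
      _ = _ := by ring
  rw [hj]
  exact ⟨key _ measureReal_nonneg h1, key _ measureReal_nonneg h2⟩

end HasSpacerRatio

/-! ### Weak rational ergodicity -/

/-- Two sums over `i < t` of the same terms, shifted by `s` places, differ by at most `s`. -/
lemma abs_sum_sub_sum_le_of_shift {f g : ℕ → ℝ} {s : ℕ} (hfg : ∀ i, g (i + s) = f i)
    (hg0 : ∀ i, 0 ≤ g i) (hg1 : ∀ i, g i ≤ 1) (t : ℕ) :
    |∑ i ∈ Finset.range t, g i - ∑ i ∈ Finset.range t, f i| ≤ s := by
  have h1 : ∑ i ∈ Finset.range (s + t), g i =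
      ∑ i ∈ Finset.range s, g i + ∑ i ∈ Finset.range t, f i := by
    rw [Finset.sum_range_add]
    congr 1
    exact Finset.sum_congr rfl fun i _ => by rw [add_comm, hfg]
  have h2 : ∑ i ∈ Finset.range (t + s), g i =
      ∑ i ∈ Finset.range t, g i + ∑ i ∈ Finset.range s, g (t + i) := Finset.sum_range_add ..
  rw [add_comm] at h1
  have b1 : ∑ i ∈ Finset.range s, g i ≤ s := by
    simpa using Finset.sum_le_sum fun i (_ : i ∈ Finset.range s) => hg1 i
  have b2 : ∑ i ∈ Finset.range s, g (t + i) ≤ s := by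
    simpa using Finset.sum_le_sum fun i (_ : i ∈ Finset.range s) => hg1 (t + i)
  have b3 : 0 ≤ ∑ i ∈ Finset.range s, g i := Finset.sum_nonneg fun i _ => hg0 i
  have b4 : 0 ≤ ∑ i ∈ Finset.range s, g (t + i) := Finset.sum_nonneg fun i _ => hg0 _
  rw [abs_le]
  constructor <;> linarith

namespace Nondegenerate

variable (hv : v.Nondegenerate)
include hv

lemma measureReal_inter_level_le_one (E : Set ℝ) (n p : ℕ) :
    v.measure.real (E ∩ v.level n p) ≤ 1 := by
  refine (measureReal_mono inter_subset_right (hv.measure_level_ne_top n p)).trans ?_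
  rw [hv.measureReal_level]
  exact inv_le_one_of_one_le₀ (by exact_mod_cast hv.hat_pos n)

lemma abs_overlapSum_level_left_sub_le {n p s : ℕ} (hp : p + s < v.height n) {B : Set ℝ}
    (hB : MeasurableSet B) (t : ℕ) :
    |overlapSum v.map v.measure (v.level n (p + s)) B t -
      overlapSum v.map v.measure (v.level n p) B t| ≤ s := by
  refine abs_sum_sub_sum_le_of_shift (fun i => ?_) (fun _ => measureReal_nonneg) (fun i => ?_) t
  · rw [← hv.image_iterate_level hp, add_comm i s, Function.iterate_add, image_comp,
      ← image_inter (hv.map_injective.iterate s)]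
    exact hv.measureReal_image_iterate s
      ((measurableSet_level n p).inter (hv.measurableSet_image_iterate i hB))
  · rw [inter_comm]; exact hv.measureReal_inter_level_le_one _ _ _

lemma abs_overlapSum_level_right_sub_le {n p s : ℕ} (hp : p + s < v.height n) {A : Set ℝ}
    (t : ℕ) :
    |overlapSum v.map v.measure A (v.level n (p + s)) t -
      overlapSum v.map v.measure A (v.level n p) t| ≤ s := by
  rw [abs_sub_comm]
  refine abs_sum_sub_sum_le_of_shift (fun i => ?_) (fun _ => measureReal_nonneg) (fun i => ?_) t
  · rw [← hv.image_iterate_level hp, Function.iterate_add, image_comp]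
  · have hm := measurableSet_level (v := v) n p
    refine (measureReal_mono (s₂ := v.map^[i] '' v.level n p) inter_subset_right ?_).trans ?_
    · rw [hv.measure_image_iterate i hm]; exact hv.measure_level_ne_top n p
    · rw [hv.measureReal_image_iterate i hm, ← univ_inter (v.level n p)]
      exact hv.measureReal_inter_level_le_one _ _ _

lemma overlapSum_union_left {A A' B : Set ℝ} (hA' : MeasurableSet A') (hB : MeasurableSet B)
    (hAF : A ⊆ v.base) (hAF' : A' ⊆ v.base) (hd : Disjoint A A') (t : ℕ) :
    overlapSum v.map v.measure (A ∪ A') B t =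
      overlapSum v.map v.measure A B t + overlapSum v.map v.measure A' B t := by
  simp only [overlapSum, ← Finset.sum_add_distrib]
  refine Finset.sum_congr rfl fun i _ => ?_
  rw [union_inter_distrib_right]
  exact measureReal_union (hd.mono inter_subset_left inter_subset_left)
    (hA'.inter (hv.measurableSet_image_iterate i hB))
    (hv.measure_ne_top_of_subset_base (inter_subset_left.trans hAF))
    (hv.measure_ne_top_of_subset_base (inter_subset_left.trans hAF'))

lemma overlapSum_union_right {A B B' : Set ℝ} (hA : MeasurableSet A) (hB' : MeasurableSet B')
    (hAF : A ⊆ v.base) (hd : Disjoint B B') (t : ℕ) :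
    overlapSum v.map v.measure A (B ∪ B') t =
      overlapSum v.map v.measure A B t + overlapSum v.map v.measure A B' t := by
  simp only [overlapSum, ← Finset.sum_add_distrib]
  refine Finset.sum_congr rfl fun i _ => ?_
  rw [image_union, inter_union_distrib_left]
  exact measureReal_union
    (((disjoint_image_iff (hv.map_injective.iterate i)).2 hd).mono inter_subset_right
      inter_subset_right)
    (hA.inter (hv.measurableSet_image_iterate i hB'))
    (hv.measure_ne_top_of_subset_base (inter_subset_left.trans hAF))
    (hv.measure_ne_top_of_subset_base (inter_subset_left.trans hAF))

/-- A sequence of additive set functions that is uniformly absolutely continuous, and converges to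
`b μ` for the levels in `I_0`, converges to `b μ` for all measurable subsets of `I_0`. -/
lemma tendsto_of_tendsto_level {φ : ℕ → Set ℝ → ℝ} {b C : ℝ} {e : ℕ → ℝ}
    (h0 : ∀ᶠ t in atTop, ∀ A, 0 ≤ φ t A)
    (hadd : ∀ t A A', MeasurableSet A → MeasurableSet A' → A ⊆ v.base → A' ⊆ v.base →
      Disjoint A A' → φ t (A ∪ A') = φ t A + φ t A')
    (hac : ∀ A, MeasurableSet A → A ⊆ v.base → ∀ᶠ t in atTop,
      φ t A ≤ C * v.measure.real A + e t)
    (he : Tendsto e atTop (𝓝 0))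
    (hlev : ∀ n, ∀ p ∈ v.basePos n,
      Tendsto (fun t => φ t (v.level n p)) atTop (𝓝 (b * v.measure.real (v.level n p))))
    {A : Set ℝ} (hA : MeasurableSet A) (hAF : A ⊆ v.base) :
    Tendsto (fun t => φ t A) atTop (𝓝 (b * v.measure.real A)) := by
  have hfin := fun {E : Set ℝ} (hE : E ⊆ v.base) => hv.measure_ne_top_of_subset_base hE
  -- approximation from inside
  have happ : ∀ E, MeasurableSet E → E ⊆ v.base → (∀ ε > 0, ∃ U ⊆ E, MeasurableSet U ∧
      v.measure.real (E \ U) ≤ ε ∧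
      Tendsto (fun t => φ t U) atTop (𝓝 (b * v.measure.real U))) →
      Tendsto (fun t => φ t E) atTop (𝓝 (b * v.measure.real E)) := by
    intro E hE hEF h
    rw [Metric.tendsto_nhds]
    intro ε hε
    have hD : 0 < 4 * (|C| + |b| + 1) := by positivity
    obtain ⟨U, hUE, hU, hμ, hlim⟩ := h (ε / (4 * (|C| + |b| + 1))) (by positivity)
    have hdU : Disjoint U (E \ U) := disjoint_sdiff_right
    have hEU : U ∪ E \ U = E := union_sdiff_cancel hUE
    have hμE : v.measure.real E = v.measure.real U + v.measure.real (E \ U) := by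
      conv_lhs => rw [← hEU]
      exact measureReal_union hdU (hE.diff hU) (hfin (hUE.trans hEF))
        (hfin (sdiff_subset.trans hEF))
    filter_upwards [h0, Metric.tendsto_nhds.1 hlim (ε / 4) (by positivity),
      Metric.tendsto_nhds.1 he (ε / 4) (by positivity),
      hac (E \ U) (hE.diff hU) (sdiff_subset.trans hEF)] with t t0 t1 t2 t3
    have hφ : φ t E = φ t U + φ t (E \ U) := by
      conv_lhs => rw [← hEU]
      exact hadd t _ _ hU (hE.diff hU) (hUE.trans hEF) (sdiff_subset.trans hEF) hdU
    have t0' := t0 (E \ U)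
    have hμ0 : 0 ≤ v.measure.real (E \ U) := measureReal_nonneg
    have hC : |C * v.measure.real (E \ U)| + |b * v.measure.real (E \ U)| ≤ ε / 4 := by
      rw [abs_mul, abs_mul, abs_of_nonneg hμ0, ← add_mul]
      calc (|C| + |b|) * v.measure.real (E \ U)
          ≤ (|C| + |b| + 1) * (ε / (4 * (|C| + |b| + 1))) :=
            mul_le_mul (by linarith) hμ hμ0 (by positivity)
        _ = ε / 4 := by field_simp
    rw [Real.dist_eq, abs_lt] at t1 t2 ⊢
    rw [hφ, hμE, mul_add]
    have := le_abs_self (C * v.measure.real (E \ U))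
    have := abs_nonneg (C * v.measure.real (E \ U))
    have := le_abs_self (b * v.measure.real (E \ U))
    have := neg_abs_le (b * v.measure.real (E \ U))
    constructor <;> linarith [t1.1, t1.2, t2.1, t2.2]
  have hempty : ∀ t, φ t ∅ = 0 := fun t => by
    have := hadd t ∅ ∅ MeasurableSet.empty MeasurableSet.empty (empty_subset _) (empty_subset _)
      (disjoint_bot_left)
    rw [union_empty] at this; linarith
  -- finite disjoint unions
  have hunion : ∀ {ι : Type} (S : Finset ι) (E : ι → Set ℝ), (∀ i ∈ S, MeasurableSet (E i)) →
      (∀ i ∈ S, E i ⊆ v.base) → (S : Set ι).PairwiseDisjoint E →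
      (∀ i ∈ S, Tendsto (fun t => φ t (E i)) atTop (𝓝 (b * v.measure.real (E i)))) →
      Tendsto (fun t => φ t (⋃ i ∈ S, E i)) atTop (𝓝 (b * v.measure.real (⋃ i ∈ S, E i))) := by
    classical
    intro ι S E
    induction S using Finset.induction_on with
    | empty => intros; simp [hempty]
    | insert a S ha ih =>
      intro hm hsub hd hlim
      simp only [Finset.mem_insert, forall_eq_or_imp] at hm hsub hlim
      rw [Finset.coe_insert] at hd
      have ih' := ih hm.2 hsub.2 (hd.subset (subset_insert _ _)) hlim.2
      have hmU : MeasurableSet (⋃ i ∈ S, E i) := Finset.measurableSet_biUnion S hm.2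
      have hsU : (⋃ i ∈ S, E i) ⊆ v.base := iUnion₂_subset hsub.2
      have hdU : Disjoint (E a) (⋃ i ∈ S, E i) := disjoint_iUnion₂_right.2 fun i hi =>
        hd (mem_insert _ _) (mem_insert_of_mem _ hi) (by rintro rfl; exact ha hi)
      rw [Finset.set_biUnion_insert, measureReal_union hdU hmU (hfin hsub.1) (hfin hsU), mul_add]
      refine (hlim.1.add ih').congr fun t => ?_
      rw [hadd t _ _ hm.1 hmU hsub.1 hsU hdU]
  have hbase : Tendsto (fun t => φ t v.base) atTop (𝓝 (b * v.measure.real v.base)) := by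
    rw [hv.base_eq_biUnion 0]
    exact hunion _ _ (fun p _ => measurableSet_level 0 p)
      (fun p hp => hv.level_subset_base_iff.2 (Finset.mem_filter.1 hp).2)
      (hv.pairwiseDisjoint_level 0) (hlev 0)
  suffices h : ∀ E, MeasurableSet E →
      Tendsto (fun t => φ t (E ∩ v.base)) atTop (𝓝 (b * v.measure.real (E ∩ v.base))) by
    have := h A hA
    rwa [inter_eq_left.2 hAF] at this
  have hgen : (inferInstance : MeasurableSpace ℝ) = MeasurableSpace.generateFrom (range Iio) := by
    rw [← borel_eq_generateFrom_Iio]; exact BorelSpace.measurable_eq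
  intro E hE
  have hFm := hv.measurableSet_base
  induction E, hE using MeasurableSpace.induction_on_inter hgen isPiSystem_Iio with
  | empty => simp [hempty]
  | basic E hE =>
    obtain ⟨x, rfl⟩ := hE
    refine happ _ (measurableSet_Iio.inter hFm) inter_subset_right fun ε hε => ?_
    obtain ⟨n, hn⟩ := (hv.tendsto_width.eventually_lt_const hε).exists
    -- the levels of `C_n` to the left of `x`
    set S := (v.basePos n).filter fun p => ((v.slot n p : ℝ) + 1) * v.width n ≤ x with hS
    have hsub : (⋃ p ∈ S, v.level n p) ⊆ Iio x ∩ v.base := by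
      refine iUnion₂_subset fun p hp y hy => ?_
      obtain ⟨hp1, hp2⟩ := Finset.mem_filter.1 hp
      exact ⟨hy.2.trans_le hp2, (hv.mem_base_iff n).2 ⟨p, hp1, hy⟩⟩
    have hmU : MeasurableSet (⋃ p ∈ S, v.level n p) :=
      Finset.measurableSet_biUnion S fun p _ => measurableSet_level n p
    refine ⟨_, hsub, hmU, ?_, ?_⟩
    · have hR : (Iio x ∩ v.base) \ (⋃ p ∈ S, v.level n p) ⊆ Ico (x - v.width n) x := by
        rintro y ⟨⟨hyx, hyF⟩, hyU⟩
        obtain ⟨p, hp, hy⟩ := (hv.mem_base_iff n).1 hyF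
        refine ⟨?_, hyx⟩
        by_contra hlt
        refine hyU (mem_iUnion₂.2 ⟨p, Finset.mem_filter.2 ⟨hp, ?_⟩, hy⟩)
        have := hy.1
        linarith
      have hF0 : (Iio x ∩ v.base) \ (⋃ p ∈ S, v.level n p) ⊆ Ici 0 := fun y hy => by
        have := hy.1.2
        rw [hv.base_eq] at this
        exact this.1
      have : v.measure.real ((Iio x ∩ v.base) \ (⋃ p ∈ S, v.level n p)) ≤ v.width n := by
        rw [Measure.real, hv.measure_apply_of_nonneg hF0]
        refine ENNReal.toReal_le_of_le_ofReal (hv.width_pos n).le ((measure_mono hR).trans ?_)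
        rw [Real.volume_Ico]; simp
      exact this.trans hn.le
    · exact hunion S _ (fun p _ => measurableSet_level n p)
        (fun p hp => hv.level_subset_base_iff.2 (Finset.mem_filter.1 (Finset.mem_filter.1 hp).1).2)
        ((hv.pairwiseDisjoint_level n).subset (by
          rw [hS]; exact Finset.coe_subset.2 (Finset.filter_subset _ _)))
        fun p hp => hlev n p (Finset.mem_filter.1 hp).1
  | compl E hE ih =>
    have hd : Disjoint (E ∩ v.base) (Eᶜ ∩ v.base) :=
      (disjoint_compl_right).mono inter_subset_left inter_subset_left
    have hu : E ∩ v.base ∪ Eᶜ ∩ v.base = v.base := by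
      rw [← union_inter_distrib_right, union_compl_self, univ_inter]
    have hμ : v.measure.real v.base =
        v.measure.real (E ∩ v.base) + v.measure.real (Eᶜ ∩ v.base) := by
      conv_lhs => rw [← hu]
      exact measureReal_union hd (hE.compl.inter hFm) (hfin inter_subset_right)
        (hfin inter_subset_right)
    have e2 : b * v.measure.real (Eᶜ ∩ v.base) =
        b * v.measure.real v.base - b * v.measure.real (E ∩ v.base) := by rw [hμ]; ring
    rw [e2]
    refine (hbase.sub ih).congr fun t => ?_
    have := hadd t _ _ (hE.inter hFm) (hE.compl.inter hFm) inter_subset_right inter_subset_right hd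
    rw [hu] at this
    rw [this]; ring
  | iUnion E hd hE ih =>
    have hm : MeasurableSet ((⋃ i, E i) ∩ v.base) := (MeasurableSet.iUnion hE).inter hFm
    refine happ _ hm inter_subset_right fun ε hε => ?_
    set U : ℕ → Set ℝ := fun M => ⋃ i ∈ Finset.range M, E i ∩ v.base with hU
    have hUm : ∀ M, MeasurableSet (U M) := fun M =>
      Finset.measurableSet_biUnion _ fun i _ => (hE i).inter hFm
    have hUsub : ∀ M, U M ⊆ (⋃ i, E i) ∩ v.base := fun M =>
      iUnion₂_subset fun i _ => inter_subset_inter_left _ (subset_iUnion E i)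
    have hUmono : Monotone U := fun M M' h =>
      biUnion_mono (Finset.range_subset_range.2 h) fun _ _ => subset_rfl
    have hUU : ⋃ M, U M = (⋃ i, E i) ∩ v.base := by
      refine Subset.antisymm (iUnion_subset hUsub) ?_
      rintro x ⟨hx, hxF⟩
      obtain ⟨i, hi⟩ := mem_iUnion.1 hx
      exact mem_iUnion.2 ⟨i + 1, mem_iUnion₂.2 ⟨i, Finset.self_mem_range_succ i, hi, hxF⟩⟩
    have hlim := tendsto_measure_iUnion_atTop (μ := v.measure) hUmono
    rw [hUU] at hlim
    have hlim' := (ENNReal.tendsto_toReal (hfin inter_subset_right)).comp hlim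
    obtain ⟨M, hM⟩ := (hlim'.eventually_const_lt
      (show v.measure.real ((⋃ i, E i) ∩ v.base) - ε < (v.measure ((⋃ i, E i) ∩ v.base)).toReal by
        rw [Measure.real]; linarith)).exists
    refine ⟨U M, hUsub M, hUm M, ?_, ?_⟩
    · rw [measureReal_sdiff (hUsub M) (hUm M) (hfin inter_subset_right)]
      simp only [Function.comp_apply] at hM
      rw [← Measure.real] at hM
      linarith
    · exact hunion _ _ (fun i _ => (hE i).inter hFm) (fun _ _ => inter_subset_right)
        (fun i _ j _ hij => (hd hij).mono inter_subset_left inter_subset_left) fun i _ => ih i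

/-- If the values of a set function on the levels of `C_n` in `I_0` are asymptotically equal, then
each is asymptotically the right fraction of their sum. -/
lemma tendsto_level_of_tendsto_sub {φ : ℕ → Set ℝ → ℝ} {b : ℝ} {n : ℕ}
    (hsum : ∀ t, ∑ p ∈ v.basePos n, φ t (v.level n p) = φ t v.base)
    (hb : Tendsto (fun t => φ t v.base) atTop (𝓝 b))
    (hsub : ∀ p ∈ v.basePos n, ∀ p' ∈ v.basePos n,
      Tendsto (fun t => φ t (v.level n p) - φ t (v.level n p')) atTop (𝓝 0))
    {p : ℕ} (hp : p ∈ v.basePos n) :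
    Tendsto (fun t => φ t (v.level n p)) atTop (𝓝 (b * v.measure.real (v.level n p))) := by
  have hg : (v.hat n : ℝ) ≠ 0 := by exact_mod_cast (hv.hat_pos n).ne'
  have h1 : Tendsto (fun t => ∑ p' ∈ v.basePos n, (φ t (v.level n p) - φ t (v.level n p')))
      atTop (𝓝 0) := by
    have := tendsto_finsetSum (v.basePos n) fun p' hp' => hsub p hp p' hp'
    simpa using this
  rw [hv.measureReal_level]
  have h2 := (hb.add h1).mul_const (v.hat n : ℝ)⁻¹
  rw [add_zero] at h2
  refine h2.congr fun t => ?_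
  rw [Finset.sum_sub_distrib, hsum, Finset.sum_const, hv.card_basePos, nsmul_eq_mul]
  field_simp; ring

end Nondegenerate

namespace HasSpacerRatio

variable (hL : v.HasSpacerRatio L)
include hL

lemma tendsto_mul_of_abs_le {f : ℕ → ℝ} {C : ℝ} (hf : ∀ t, |f t| ≤ C) :
    Tendsto (fun t => 1 / v.normalizer t * f t) atTop (𝓝 0) := by
  have h := hL.tendsto_normalizer
  have h1 : Tendsto (fun t => 1 / v.normalizer t) atTop (𝓝 0) := by
    simpa only [one_div, Function.comp_def] using tendsto_inv_atTop_zero.comp h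
  exact h1.zero_mul_isBoundedUnder_le
    (isBoundedUnder_of ⟨C, fun t => by simpa using hf t⟩)

omit hL in
lemma abs_sub_le_height_of_shift {f : ℕ → ℝ} {n : ℕ}
    (hf : ∀ p s, p + s < v.height n → |f (p + s) - f p| ≤ s) {p p' : ℕ}
    (hp : p ∈ v.basePos n) (hp' : p' ∈ v.basePos n) : |f p - f p'| ≤ v.height n := by
  have h1 := lt_height_of_mem hp
  have h2 := lt_height_of_mem hp'
  rcases le_total p' p with h | h
  · obtain ⟨s, rfl⟩ := Nat.exists_eq_add_of_le h
    exact (hf p' s h1).trans (by exact_mod_cast (by omega))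
  · obtain ⟨s, rfl⟩ := Nat.exists_eq_add_of_le h
    rw [abs_sub_comm]
    exact (hf p s h2).trans (by exact_mod_cast (by omega))

lemma tendsto_errTerm : Tendsto (fun t => 4 * v.relErr L (v.stage t)) atTop (𝓝 0) := by
  simpa using hL.tendsto_relErr_stage.const_mul 4

omit hL in
lemma overlapSum_nonneg (A B : Set ℝ) (t : ℕ) : 0 ≤ overlapSum v.map v.measure A B t :=
  Finset.sum_nonneg fun _ _ => measureReal_nonneg

lemma tendsto_overlapSum_base_left {B : Set ℝ} (hB : MeasurableSet B) (hBF : B ⊆ v.base) :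
    Tendsto (fun t => (1 / v.normalizer t) * overlapSum v.map v.measure v.base B t)
      atTop (𝓝 (v.measure.real B)) := by
  have hv := hL.nondegenerate
  have hFm := hv.measurableSet_base
  rw [← one_mul (v.measure.real B)]
  refine hv.tendsto_of_tendsto_level
    (φ := fun t E => (1 / v.normalizer t) * overlapSum v.map v.measure v.base E t) (C := 8)
    ?_ ?_ ?_ hL.tendsto_errTerm ?_ hB hBF
  · filter_upwards [hL.tendsto_normalizer.eventually_gt_atTop 0] with t ht E
    exact mul_nonneg (by positivity) (overlapSum_nonneg _ _ _)
  · intro t E E' _ hE' _ _ hd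
    rw [hv.overlapSum_union_right hFm hE' subset_rfl hd, mul_add]
  · intro E hE hEF
    filter_upwards [hL.eventually_overlapSum_le hFm hE subset_rfl hEF] with t ht
    exact ht.2
  · intro n p hp
    refine hv.tendsto_level_of_tendsto_sub
      (φ := fun t E => (1 / v.normalizer t) * overlapSum v.map v.measure v.base E t)
      (fun t => ?_) hL.tendsto_overlapSum_base (fun p hp p' hp' => ?_) hp
    · rw [← Finset.mul_sum]
      congr 1
      simp only [overlapSum]
      rw [Finset.sum_comm]
      refine Finset.sum_congr rfl fun i _ => ?_
      conv_rhs => rw [hv.base_eq_biUnion n, image_iUnion₂, inter_iUnion₂, ← hv.base_eq_biUnion n]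
      rw [measureReal_biUnion_finset
        (h := fun p _ => hv.measure_ne_top_of_subset_base inter_subset_left)]
      · intro p hp p' hp' hne
        exact ((disjoint_image_iff (hv.map_injective.iterate i)).2
          (hv.pairwiseDisjoint_level n hp hp' hne)).mono inter_subset_right inter_subset_right
      · exact fun p _ => hFm.inter (hv.measurableSet_image_iterate i (measurableSet_level n p))
    · simp only [← mul_sub]
      refine hL.tendsto_mul_of_abs_le (C := v.height n) fun t => ?_
      exact abs_sub_le_height_of_shift
        (f := fun p => overlapSum v.map v.measure v.base (v.level n p) t)
        (fun p s hps => hv.abs_overlapSum_level_right_sub_le hps t) hp hp'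

/-- The averages along the normalizing sequence converge. -/
theorem tendsto_overlapSum {A B : Set ℝ} (hA : MeasurableSet A) (hB : MeasurableSet B)
    (hAF : A ⊆ v.base) (hBF : B ⊆ v.base) :
    Tendsto (fun t => (1 / v.normalizer t) * overlapSum v.map v.measure A B t)
      atTop (𝓝 (v.measure.real A * v.measure.real B)) := by
  have hv := hL.nondegenerate
  rw [mul_comm (v.measure.real A)]
  refine hv.tendsto_of_tendsto_level
    (φ := fun t E => (1 / v.normalizer t) * overlapSum v.map v.measure E B t) (C := 8)
    ?_ ?_ ?_ hL.tendsto_errTerm ?_ hA hAF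
  · filter_upwards [hL.tendsto_normalizer.eventually_gt_atTop 0] with t ht E
    exact mul_nonneg (by positivity) (overlapSum_nonneg _ _ _)
  · intro t E E' _ hE' hEF hEF' hd
    rw [hv.overlapSum_union_left hE' hB hEF hEF' hd, mul_add]
  · intro E hE hEF
    filter_upwards [hL.eventually_overlapSum_le hE hB hEF hBF] with t ht
    exact ht.1
  · intro n p hp
    refine hv.tendsto_level_of_tendsto_sub
      (φ := fun t E => (1 / v.normalizer t) * overlapSum v.map v.measure E B t)
      (fun t => ?_) (hL.tendsto_overlapSum_base_left hB hBF) (fun p hp p' hp' => ?_) hp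
    · rw [← Finset.mul_sum]
      congr 1
      simp only [overlapSum]
      rw [Finset.sum_comm]
      refine Finset.sum_congr rfl fun i _ => ?_
      rw [hv.base_eq_biUnion n, iUnion₂_inter]
      rw [measureReal_biUnion_finset (h := fun p _ => ne_top_of_le_ne_top
        (hv.measure_level_ne_top n p) (measure_mono inter_subset_left))]
      · intro p hp p' hp' hne
        exact (hv.pairwiseDisjoint_level n hp hp' hne).mono inter_subset_left inter_subset_left
      · exact fun p _ => (measurableSet_level n p).inter (hv.measurableSet_image_iterate i hB)
    · simp only [← mul_sub]
      refine hL.tendsto_mul_of_abs_le (C := v.height n) fun t => ?_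
      exact abs_sub_le_height_of_shift
        (f := fun p => overlapSum v.map v.measure (v.level n p) B t)
        (fun p s hps => hv.abs_overlapSum_level_left_sub_le hps hB t) hp hp'

theorem isWeakRationalErgodicSet_base :
    IsWeakRationalErgodicSet v.map v.measure v.base := by
  have hv := hL.nondegenerate
  refine ⟨hv.measurableSet_base, by rw [hv.measure_base]; exact zero_lt_one,
    by rw [hv.measure_base]; exact ENNReal.one_lt_top, fun A B hA hB hAF hBF => ?_⟩
  have h := (hL.tendsto_overlapSum hA hB hAF hBF).div hL.tendsto_overlapSum_base one_ne_zero
  rw [div_one] at h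
  refine h.congr' ?_
  filter_upwards [hL.tendsto_normalizer.eventually_gt_atTop 0] with t ht
  simp only [Pi.div_apply, Measure.real, hv.measure_base, ENNReal.toReal_one, one_pow, div_one]
  rw [mul_div_mul_left _ _ (by positivity), div_eq_inv_mul, one_div]

/-! ### Conservativity and ergodicity -/

/-- Sets without any overlap at positive times are null. -/
lemma measureReal_mul_eq_zero {A B : Set ℝ} (hA : MeasurableSet A) (hB : MeasurableSet B)
    (hAF : A ⊆ v.base) (hBF : B ⊆ v.base) (h : ∀ i, i ≠ 0 → A ∩ v.map^[i] '' B = ∅) :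
    v.measure.real A * v.measure.real B = 0 := by
  have hv := hL.nondegenerate
  refine tendsto_nhds_unique (hL.tendsto_overlapSum hA hB hAF hBF)
    (hL.tendsto_mul_of_abs_le (C := v.measure.real A) fun t => ?_)
  rw [abs_of_nonneg (overlapSum_nonneg _ _ _), overlapSum]
  calc _ ≤ ∑ i ∈ Finset.range t, if i = 0 then v.measure.real A else 0 := by
        refine Finset.sum_le_sum fun i _ => ?_
        split_ifs with hi
        · exact measureReal_mono inter_subset_left (hv.measure_ne_top_of_subset_base hAF)
        · rw [h i hi, measureReal_empty]
    _ ≤ _ := by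
        rw [Finset.sum_ite_eq']
        split_ifs
        · exact le_rfl
        · exact measureReal_nonneg

omit hL in
lemma level_zero_subset_base (hv : v.Nondegenerate) (n : ℕ) : v.level n 0 ⊆ v.base := by
  rw [hv.level_subset_base_iff]
  have : v.slot n 0 = 0 := by
    induction n with
    | zero => rfl
    | succ n ih =>
      have h := hv.slot_start_add (hv.copies_pos n) (hv.height_pos n)
      rw [start_of_le (Nat.zero_le _), zero_mul, add_zero, ih, zero_mul, zero_add] at h
      rw [h, piece]
      split_ifs with h0
      · simp
      · have : v.tallCount n = 0 := by omega
        rw [tallCount, mul_comm] at this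
        rw [this]; simp
  rw [this]
  exact hv.hat_pos n

omit hL in
lemma measure_eq_zero_of_level (hv : v.Nondegenerate) {E : Set ℝ}
    (h : ∀ n p, p < v.height n → v.measure (E ∩ v.level n p) = 0) : v.measure E = 0 := by
  rw [hv.measure_eq, Measure.restrict_apply' measurableSet_Ici, ← hv.measure_apply_of_nonneg
    inter_subset_right]
  refine measure_mono_null (t := ⋃ n, ⋃ p ∈ Finset.range (v.height n), E ∩ v.level n p) ?_ ?_
  · rintro x ⟨hx, h0⟩
    obtain ⟨n, hn⟩ := hv.exists_level h0
    obtain ⟨p, hp, hxp⟩ := hn n le_rfl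
    exact mem_iUnion.2 ⟨n, mem_iUnion₂.2 ⟨p, Finset.mem_range.2 (by omega), hx, hxp⟩⟩
  · refine measure_iUnion_null fun n => ?_
    exact (measure_biUnion_null_iff (Finset.countable_toSet _)).2 fun p hp =>
      h n p (Finset.mem_range.1 hp)

omit hL in
lemma image_inter_level_zero (hv : v.Nondegenerate) {n p : ℕ} (hp : p < v.height n) (E : Set ℝ) :
    v.map^[p] '' (v.map^[p] ⁻¹' E ∩ v.level n 0) = E ∩ v.level n p := by
  rw [inter_comm, image_inter_preimage, hv.image_iterate_level (by omega), zero_add, inter_comm]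

/-- A set without returns would give, moved down to a level in `I_0`, a set with bounded
overlaps. -/
theorem conservative : Conservative v.map v.measure := by
  have hv := hL.nondegenerate
  refine ⟨hv.measurePreserving_map.quasiMeasurePreserving, fun E hE hE0 => ?_⟩
  by_contra! hret
  refine hE0 (measure_eq_zero_of_level hv fun n p hp => ?_)
  set A := v.map^[p] ⁻¹' E ∩ v.level n 0 with hA
  have hAm : MeasurableSet A := ((hv.measurable_map.iterate p) hE).inter (measurableSet_level n 0)
  have hAF : A ⊆ v.base := inter_subset_right.trans (level_zero_subset_base hv n)
  have h0 := hL.measureReal_mul_eq_zero hAm hAm hAF hAF fun i hi => by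
    refine eq_empty_of_forall_notMem ?_
    rintro _ ⟨⟨h1, _⟩, y, ⟨h2, _⟩, rfl⟩
    refine hret _ h2 i hi ?_
    rw [mem_preimage, ← Function.iterate_add_apply, add_comm, Function.iterate_add_apply] at h1
    exact h1
  rw [← image_inter_level_zero hv hp, hv.measure_image_iterate p hAm]
  exact (measureReal_eq_zero_iff (hv.measure_ne_top_of_subset_base hAF)).1 (mul_self_eq_zero.1 h0)

omit hL in
lemma measure_eq_zero_of_invariant (hv : v.Nondegenerate) {E : Set ℝ} (hE : MeasurableSet E)
    (hinv : v.map ⁻¹' E = E) (h0 : v.measure (E ∩ v.base) = 0) : v.measure E = 0 := by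
  refine measure_eq_zero_of_level hv fun n p hp => ?_
  have hit : v.map^[p] ⁻¹' E = E := by
    rw [preimage_iterate_eq]; exact Function.iterate_fixed hinv p
  rw [← image_inter_level_zero hv hp, hit,
    hv.measure_image_iterate p (hE.inter (measurableSet_level n 0))]
  exact measure_mono_null (inter_subset_inter_right _ (level_zero_subset_base hv n)) h0

theorem ergodic : Ergodic v.map v.measure := by
  have hv := hL.nondegenerate
  refine ⟨hv.measurePreserving_map, ⟨fun E hE hinv => eventuallyConst_set'.2 ?_⟩⟩
  have hFm := hv.measurableSet_base
  have hinv' : v.map ⁻¹' Eᶜ = Eᶜ := by rw [preimage_compl, hinv]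
  have h0 := hL.measureReal_mul_eq_zero (hE.inter hFm) (hE.compl.inter hFm) inter_subset_right
    inter_subset_right fun i _ => by
      refine eq_empty_of_forall_notMem ?_
      rintro _ ⟨⟨h1, _⟩, y, ⟨h2, _⟩, rfl⟩
      have hit : v.map^[i] ⁻¹' E = E := by
        rw [preimage_iterate_eq]; exact Function.iterate_fixed hinv i
      rw [← mem_preimage, hit] at h1
      exact h2 h1
  have hzero : ∀ {S : Set ℝ}, v.measure.real (S ∩ v.base) = 0 → v.measure (S ∩ v.base) = 0 :=
    fun h => (measureReal_eq_zero_iff (hv.measure_ne_top_of_subset_base inter_subset_right)).1 h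
  rcases mul_eq_zero.1 h0 with h | h
  · exact Or.inl (ae_eq_empty.2 (measure_eq_zero_of_invariant hv hE hinv (hzero h)))
  · exact Or.inr (ae_eq_univ.2 (measure_eq_zero_of_invariant hv hE.compl hinv' (hzero h)))

end HasSpacerRatio

/-- For `v` in the class `V`, the ratios `ℓ_n / h_n = ⌊n ^ α⌋` are `o(n)`, because `α < 1`. -/
lemma exists_hasSpacerRatio (hv : v ∈ familyV) : ∃ L, v.HasSpacerRatio L := by
  simp only [familyV, mem_iUnion] at hv
  obtain ⟨α, ⟨hα0, hα1⟩, hk, hl, hm, -⟩ := hv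
  refine ⟨fun n => ⌊(n : ℝ) ^ α⌋₊, hk, hl, hm, fun n hn => ?_, ?_⟩
  · exact Nat.le_floor (by
      rw [Nat.cast_one]; exact Real.one_le_rpow (by exact_mod_cast hn) hα0.le)
  · have h1 : Tendsto (fun n : ℕ => (n : ℝ) ^ (-(1 - α))) atTop (𝓝 0) :=
      (tendsto_rpow_neg_atTop (by linarith)).comp tendsto_natCast_atTop_atTop
    refine squeeze_zero' (Eventually.of_forall fun n => by positivity) ?_ h1
    filter_upwards [eventually_gt_atTop 0] with n hn
    have hn' : (0 : ℝ) < n := by exact_mod_cast hn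
    rw [div_le_iff₀ (by positivity)]
    calc (⌊(n : ℝ) ^ α⌋₊ : ℝ) ≤ (n : ℝ) ^ α := Nat.floor_le (by positivity)
      _ = (n : ℝ) ^ (-(1 - α)) * n := by
        rw [← Real.rpow_add_one hn'.ne']; congr 1; ring
      _ ≤ _ := by gcongr; linarith

end Params

end CutStack

end

theorem theorem3p1 (v : CutStack.Params) (hv : v ∈ CutStack.familyV) :
    v.measure univ = ⊤ ∧
    MeasurePreserving v.map v.measure v.measure ∧
    (Function.Injective v.map ∧ v.measure (range v.map)ᶜ = 0) ∧
    Conservative v.map v.measure ∧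
    Ergodic v.map v.measure ∧
    WeaklyRationallyErgodic v.map v.measure ∧
    IsWeakRationalErgodicSet v.map v.measure v.base ∧
    ∀ A B : Set ℝ, MeasurableSet A → MeasurableSet B → A ⊆ v.base → B ⊆ v.base →
      Tendsto (fun t : ℕ => (1 / v.normalizer t) * overlapSum v.map v.measure A B t)
        atTop (𝓝 (v.measure.real A * v.measure.real B)) := by
  obtain ⟨L, hL⟩ := CutStack.Params.exists_hasSpacerRatio hv
  have hnd := hL.nondegenerate
  exact ⟨hnd.measure_univ, hnd.measurePreserving_map, ⟨hnd.map_injective, hnd.measure_compl_range⟩,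
    hL.conservative, hL.ergodic, ⟨hL.conservative, hL.ergodic, _, hL.isWeakRationalErgodicSet_base⟩,
    hL.isWeakRationalErgodicSet_base, fun A B hA hB hAF hBF => hL.tendsto_overlapSum hA hB hAF hBF⟩
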